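/- **Theorem 1.1.** Let $\mathbb{H}=\{(z_1,z_2)\in\mathbb{C}^2 : |z_1|<|z_2|<1\}$ be the Hartogs triangle. For $s'\in\mathbb{R}$ and $1\le p<\infty$ let $L^p(\mathbb{H},|z_2|^{s'})$ be the space of measurable functions $f$ on $\mathbb{H}$ with $\|f\|_p=\big(\int_{\mathbb{H}}|f(z)|^p|z_2|^{s'}\,dV(z)\big)^{1/p}<\infty$, where $dV$ is Lebesgue measure. Let $\mathcal{B}_{\mathbb{H},s'}$ be the weighted Bergman projection, that is, the orthogonal projection of $L^2(\mathbb{H},|z_2|^{s'})$ onto its closed subspace of holomorphic functions. We call $\mathcal{B}_{\mathbb{H},s'}$ *$L^p$ bounded* if there is a constant $C<\infty$ such that $\|\mathcal{B}_{\mathbb{H},s'}f\|_p\le C\|f\|_p$ for all $f\in L^2(\mathbb{H},|z_2|^{s'})\cap L^p(\mathbb{H},|z_2|^{s'})$. Every $s'\in\mathbb{R}$ has a unique expression $s'=s+2k$ with $k\in\mathbb{Z}$ and $s\in(0,2]$. With this $s$ and $k$, and for $1\le p<\infty$: 1. If $s'\in(-2,\infty)$, then $\mathcal{B}_{\mathbb{H},s'}$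 is $L^p$ bounded if and only if $p\in\left(\frac{s+2k+4}{s+k+2},\frac{s+2k+4}{k+2}\right)$. 2. If $s'\in[-5,-2]$, then $\mathcal{B}_{\mathbb{H},s'}$ is $L^p$ bounded if and only if $p\in(1,\infty)$. 3. If $s'\in(-6,-5)$, then $k=-3$, $s\in(0,1)$, and $\mathcal{B}_{\mathbb{H},s'}$ is $L^p$ bounded if and only if $p\in\left(2-s,\frac{2-s}{1-s}\right)$. 4. If $s'=-6$, then $\mathcal{B}_{\mathbb{H},s'}$ is $L^p$ bounded if and only if $p\in(1,\infty)$. 5. If $s'\in(-\infty,-6)$, then $\mathcal{B}_{\mathbb{H},s'}$ is $L^p$ bounded if and only if $p\in\left(\frac{s+2k+4}{k+2},\frac{s+2k+4}{s+k+2}\right)$. -/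

import Mathlib

namespace HartogsBergman

open MeasureTheory Set Metric Filter Topology
open scoped ENNReal NNReal

/-- The measure `μ dV` on `Ω ⊆ ℂ²`, where `dV` is Lebesgue measure; thus `L^p(Ω, μ)` is
`Lp ℂ p (weightedVolume Ω μ)`. -/
noncomputable def weightedVolume (Ω : Set (ℂ × ℂ)) (μ : ℂ × ℂ → ℝ) : Measure (ℂ × ℂ) :=
  (volume.restrict Ω).withDensity fun z => ENNReal.ofReal (μ z)

/-- The weighted Bergman space `A²(Ω, μ) = L²(Ω, μ) ∩ 𝒪(Ω)`: the classes in `L²(Ω, μ)` that have a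
representative which is holomorphic on `Ω`. -/
def bergmanSpace (Ω : Set (ℂ × ℂ)) (μ : ℂ × ℂ → ℝ) :
    Submodule ℂ (Lp ℂ 2 (weightedVolume Ω μ)) where
  carrier := {F | ∃ f : ℂ × ℂ → ℂ, DifferentiableOn ℂ f Ω ∧ F =ᵐ[weightedVolume Ω μ] f}
  add_mem' := by
    rintro F G ⟨f, hf, hFf⟩ ⟨g, hg, hGg⟩
    exact ⟨f + g, hf.add hg, (Lp.coeFn_add F G).trans (hFf.add hGg)⟩
  zero_mem' := ⟨0, differentiableOn_const 0, Lp.coeFn_zero _ _ _⟩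
  smul_mem' := by
    rintro c F ⟨f, hf, hFf⟩
    exact ⟨c • f, hf.const_smul c, (Lp.coeFn_smul c F).trans (hFf.const_smul c)⟩

/-! The closedness of `A²(Ω, μ)` for a positive continuous weight on an open set, which is what makes
the orthogonal projection onto it exist. -/

theorem measurePreserving_smul_circleMap (θ : ℝ) :
    MeasurePreserving (fun v : ℂ × ℂ => circleMap 0 1 θ • v) volume volume := by
  have h : MeasurePreserving (fun z : ℂ => circleMap 0 1 θ * z) volume volume := by
    have := (rotation (Circle.exp θ)).measurePreserving
    have e : (fun z : ℂ => circleMap 0 1 θ * z) = rotation (Circle.exp θ) := by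
      ext z
      simp [circleMap, rotation_apply]
    rw [e]
    exact this
  exact h.prod h

theorem enorm_le_circle_lintegral {f : ℂ × ℂ → ℂ} {r : ℝ}
    (hf : DifferentiableOn ℂ f (ball 0 r)) {v : ℂ × ℂ} (hv : v ∈ ball (0 : ℂ × ℂ) r) :
    ENNReal.ofReal (2 * Real.pi) * ‖f 0‖ₑ
      ≤ ∫⁻ θ in Ioc 0 (2 * Real.pi), ‖f (circleMap 0 1 θ • v)‖ₑ := by
  have hd : DifferentiableOn ℂ (fun t : ℂ => f (t • v)) (closedBall 0 1) := by
    refine hf.comp (by fun_prop) ?_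
    intro t ht
    simp only [mem_ball, mem_closedBall, dist_zero_right] at *
    rw [norm_smul]
    nlinarith [norm_nonneg v, norm_nonneg t]
  have hd' : DiffContOnCl ℂ (fun t : ℂ => f (t • v)) (ball 0 |1|) := by
    refine DifferentiableOn.diffContOnCl ?_
    rw [abs_one, closure_ball _ one_ne_zero]
    exact hd
  have h := hd'.circleAverage
  rw [Real.circleAverage_def] at h
  have hpi : (0 : ℝ) < 2 * Real.pi := by positivity
  simp only [zero_smul] at h
  rw [← h, enorm_smul, ← mul_assoc, intervalIntegral.integral_of_le hpi.le]
  have : ENNReal.ofReal (2 * Real.pi) * ‖(2 * Real.pi)⁻¹‖ₑ = 1 := by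
    rw [Real.enorm_eq_ofReal (by positivity), ← ENNReal.ofReal_mul hpi.le,
      mul_inv_cancel₀ hpi.ne', ENNReal.ofReal_one]
  rw [this, one_mul]
  exact enorm_integral_le_lintegral_enorm _

theorem volume_mul_enorm_le_lintegral_zero {f : ℂ × ℂ → ℂ} {r : ℝ}
    (hf : DifferentiableOn ℂ f (ball 0 r)) :
    volume (ball (0 : ℂ × ℂ) r) * ‖f 0‖ₑ ≤ ∫⁻ w in ball 0 r, ‖f w‖ₑ := by
  classical
  have hm : Measurable ((ball (0 : ℂ × ℂ) r).indicator f) := by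
    have := hf.continuousOn.measurable_piecewise
      (continuousOn_const (c := (0 : ℂ)) (s := (ball (0 : ℂ × ℂ) r)ᶜ)) measurableSet_ball
    rw [← Set.piecewise_eq_indicator]
    exact this
  have hpi : (0 : ℝ) < 2 * Real.pi := by positivity
  have hmem : ∀ θ (v : ℂ × ℂ), circleMap 0 1 θ • v ∈ ball (0 : ℂ × ℂ) r ↔ v ∈ ball (0 : ℂ × ℂ) r := by
    intro θ v
    simp [norm_smul]
  set g := (ball (0 : ℂ × ℂ) r).indicator f with hg
  have hgm : Measurable fun p : (ℂ × ℂ) × ℝ => ‖g (circleMap 0 1 p.2 • p.1)‖ₑ := by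
    refine (hm.comp ?_).enorm
    have : Continuous fun p : (ℂ × ℂ) × ℝ => circleMap 0 1 p.2 • p.1 :=
      ((continuous_circleMap 0 1).comp continuous_snd).smul continuous_fst
    exact this.measurable
  have key : ENNReal.ofReal (2 * Real.pi) * (volume (ball (0 : ℂ × ℂ) r) * ‖f 0‖ₑ)
      ≤ ENNReal.ofReal (2 * Real.pi) * ∫⁻ w in ball 0 r, ‖f w‖ₑ := by
    calc ENNReal.ofReal (2 * Real.pi) * (volume (ball (0 : ℂ × ℂ) r) * ‖f 0‖ₑ)
        = ∫⁻ v in ball (0 : ℂ × ℂ) r, ENNReal.ofReal (2 * Real.pi) * ‖f 0‖ₑ := by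
          rw [setLIntegral_const]; ring
      _ ≤ ∫⁻ v in ball (0 : ℂ × ℂ) r,
            ∫⁻ θ in Ioc 0 (2 * Real.pi), ‖g (circleMap 0 1 θ • v)‖ₑ := by
          refine setLIntegral_mono' measurableSet_ball fun v hv => ?_
          refine (enorm_le_circle_lintegral hf hv).trans (le_of_eq ?_)
          refine lintegral_congr fun θ => ?_
          rw [hg, indicator_of_mem ((hmem θ v).2 hv)]
      _ = ∫⁻ v : ℂ × ℂ, ∫⁻ θ in Ioc 0 (2 * Real.pi), ‖g (circleMap 0 1 θ • v)‖ₑ := by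
          refine setLIntegral_eq_of_support_subset ?_
          intro v hv
          by_contra hv'
          refine hv ?_
          have : ∀ θ, g (circleMap 0 1 θ • v) = 0 := fun θ =>
            indicator_of_notMem (fun h => hv' ((hmem θ v).1 h)) _
          simp [this]
      _ = ∫⁻ θ in Ioc 0 (2 * Real.pi), ∫⁻ v : ℂ × ℂ, ‖g (circleMap 0 1 θ • v)‖ₑ :=
          lintegral_lintegral_swap hgm.aemeasurable
      _ = ∫⁻ θ in Ioc 0 (2 * Real.pi), ∫⁻ v : ℂ × ℂ, ‖g v‖ₑ := by
          refine lintegral_congr fun θ => ?_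
          exact (measurePreserving_smul_circleMap θ).lintegral_comp (f := fun v => ‖g v‖ₑ) hm.enorm
      _ = ENNReal.ofReal (2 * Real.pi) * ∫⁻ w in ball 0 r, ‖f w‖ₑ := by
          rw [setLIntegral_const, Real.volume_Ioc, sub_zero, mul_comm,
            ← lintegral_indicator measurableSet_ball]
          congr 1
          refine lintegral_congr fun w => ?_
          rw [hg, enorm_indicator_eq_indicator_enorm]
  exact (ENNReal.mul_le_mul_iff_right (by simpa using hpi) ENNReal.ofReal_ne_top).1 key

theorem volume_mul_enorm_le_lintegral {f : ℂ × ℂ → ℂ} {z : ℂ × ℂ} {r : ℝ}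
    (hf : DifferentiableOn ℂ f (ball z r)) :
    volume (ball (0 : ℂ × ℂ) r) * ‖f z‖ₑ ≤ ∫⁻ w in ball z r, ‖f w‖ₑ := by
  have h := volume_mul_enorm_le_lintegral_zero (f := fun v => f (z + v))
    (hf.comp (by fun_prop) (by intro v hv; simpa using hv))
  simp only [add_zero] at h
  refine h.trans (le_of_eq ?_)
  have : (volume : Measure (ℂ × ℂ)).IsAddLeftInvariant :=
    inferInstanceAs ((volume : Measure ℂ).prod (volume : Measure ℂ)).IsAddLeftInvariant
  have := (measurePreserving_add_left (volume : Measure (ℂ × ℂ)) z).setLIntegral_comp_preimage_emb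
    (MeasurableEquiv.addLeft z).measurableEmbedding (fun w => ‖f w‖ₑ) (ball z r)
  rw [← this]
  congr 2
  ext v; simp

theorem exists_ball_enorm_sq_le {Ω : Set (ℂ × ℂ)} {μ : ℂ × ℂ → ℝ} (hΩ : IsOpen Ω)
    (hμ : ContinuousOn μ Ω) (hpos : ∀ z ∈ Ω, 0 < μ z) {z₀ : ℂ × ℂ} (hz₀ : z₀ ∈ Ω) :
    ∃ r > 0, ball z₀ r ⊆ Ω ∧ ∃ C : ℝ≥0, ∀ f : ℂ × ℂ → ℂ, DifferentiableOn ℂ f Ω →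
      ∀ z ∈ ball z₀ r, ‖f z‖ₑ ^ 2 ≤ C * ∫⁻ w, ‖f w‖ₑ ^ 2 ∂(weightedVolume Ω μ) := by
  have h1 : ∀ᶠ z in 𝓝 z₀, z ∈ Ω ∧ μ z₀ / 2 < μ z := by
    refine Filter.Eventually.and (hΩ.mem_nhds hz₀) ?_
    exact (hμ.continuousAt (hΩ.mem_nhds hz₀)).eventually_const_lt (half_lt_self (hpos z₀ hz₀))
  obtain ⟨R, hR, hb⟩ := Metric.eventually_nhds_iff_ball.1 h1
  have hc : 0 < μ z₀ / 2 := half_pos (hpos z₀ hz₀)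
  set c := μ z₀ / 2
  set V := volume (ball (0 : ℂ × ℂ) (R / 2)) with hV
  have hV0 : V ≠ 0 := (measure_ball_pos volume _ (half_pos hR)).ne'
  have hVt : V ≠ ∞ := measure_ball_lt_top.ne
  refine ⟨R / 2, half_pos hR, fun z hz => (hb z (ball_subset_ball (by linarith) hz)).1,
    (V⁻¹ * (ENNReal.ofReal c)⁻¹).toNNReal, fun f hf z hz => ?_⟩
  have hc0 : ENNReal.ofReal c ≠ 0 := by simpa using hc
  have hct : ENNReal.ofReal c ≠ ∞ := ENNReal.ofReal_ne_top
  rw [ENNReal.coe_toNNReal (ENNReal.mul_ne_top (ENNReal.inv_ne_top.2 hV0) (ENNReal.inv_ne_top.2 hc0))]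
  have hsub : ball z (R / 2) ⊆ ball z₀ R := by
    intro w hw
    rw [mem_ball] at *
    linarith [dist_triangle w z z₀]
  have h2 := volume_mul_enorm_le_lintegral (f := fun w => f w ^ 2)
    ((hf.pow 2).mono fun w hw => (hb w (hsub hw)).1)
  simp only [enorm_pow] at h2
  have h3 : ENNReal.ofReal c * ∫⁻ w in ball z (R / 2), ‖f w‖ₑ ^ 2
      ≤ ∫⁻ w, ‖f w‖ₑ ^ 2 ∂(weightedVolume Ω μ) := by
    rw [weightedVolume, ← lintegral_const_mul' _ _ hct]
    calc ∫⁻ w in ball z (R / 2), ENNReal.ofReal c * ‖f w‖ₑ ^ 2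
        ≤ ∫⁻ w in ball z (R / 2), ENNReal.ofReal (μ w) * ‖f w‖ₑ ^ 2 := by
          refine setLIntegral_mono' measurableSet_ball fun w hw => ?_
          gcongr
          exact (hb w (hsub hw)).2.le
      _ ≤ ∫⁻ w in Ω, ENNReal.ofReal (μ w) * ‖f w‖ₑ ^ 2 :=
          lintegral_mono_set fun w hw => (hb w (hsub hw)).1
      _ = _ := by
          rw [lintegral_withDensity_eq_lintegral_mul₀]
          · rfl
          · exact (hμ.aemeasurable hΩ.measurableSet).ennreal_ofReal
          · exact ((hf.continuousOn.aemeasurable hΩ.measurableSet).enorm).pow_const 2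
  calc ‖f z‖ₑ ^ 2 = V⁻¹ * (ENNReal.ofReal c)⁻¹ * (ENNReal.ofReal c * (V * ‖f z‖ₑ ^ 2)) := by
        have e1 : (ENNReal.ofReal c)⁻¹ * ENNReal.ofReal c = 1 := ENNReal.inv_mul_cancel hc0 hct
        have e2 : V⁻¹ * V = 1 := ENNReal.inv_mul_cancel hV0 hVt
        calc ‖f z‖ₑ ^ 2 = (V⁻¹ * V) * ((ENNReal.ofReal c)⁻¹ * ENNReal.ofReal c) * ‖f z‖ₑ ^ 2 := by
              rw [e1, e2, one_mul, one_mul]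
          _ = _ := by ring
    _ ≤ _ := by
        gcongr
        exact (mul_le_mul_right h2 _).trans h3

theorem isClosed_bergmanSpace {Ω : Set (ℂ × ℂ)} {μ : ℂ × ℂ → ℝ} (hΩ : IsOpen Ω)
    (hμ : ContinuousOn μ Ω) (hpos : ∀ z ∈ Ω, 0 < μ z) :
    IsClosed (bergmanSpace Ω μ : Set (Lp ℂ 2 (weightedVolume Ω μ))) := by
  refine IsSeqClosed.isClosed fun F G hF hG => ?_
  choose f hf hFf using hF
  have hL2 : ∀ n m, ∫⁻ w, ‖f n w - f m w‖ₑ ^ 2 ∂(weightedVolume Ω μ)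
      = ENNReal.ofReal (‖F n - F m‖ ^ 2) := by
    intro n m
    have e : eLpNorm (⇑(F n - F m)) 2 (weightedVolume Ω μ)
        = eLpNorm (fun w => f n w - f m w) 2 (weightedVolume Ω μ) :=
      eLpNorm_congr_ae ((Lp.coeFn_sub _ _).trans ((hFf n).sub (hFf m)))
    rw [ENNReal.ofReal_pow (norm_nonneg _), Lp.norm_def, ENNReal.ofReal_toReal (Lp.eLpNorm_ne_top _),
      e, eLpNorm_eq_lintegral_rpow_enorm_toReal (by norm_num) (by norm_num),
      ← ENNReal.rpow_natCast, ← ENNReal.rpow_mul]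
    norm_num
  have hcau := hG.cauchySeq
  -- local uniform control of the differences
  have hloc : ∀ z₀ ∈ Ω, ∃ r > 0, ball z₀ r ⊆ Ω ∧ ∃ C : ℝ, 0 ≤ C ∧ ∀ n m, ∀ z ∈ ball z₀ r,
      ‖f n z - f m z‖ ≤ C * ‖F n - F m‖ := by
    intro z₀ hz₀
    obtain ⟨r, hr, hb, C, hC⟩ := exists_ball_enorm_sq_le hΩ hμ hpos hz₀
    refine ⟨r, hr, hb, Real.sqrt C, Real.sqrt_nonneg _, fun n m z hz => ?_⟩
    have h := hC (fun w => f n w - f m w) ((hf n).sub (hf m)) z hz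
    rw [hL2, ← ofReal_norm, ← ENNReal.ofReal_pow (norm_nonneg _),
      ← ENNReal.ofReal_coe_nnreal, ← ENNReal.ofReal_mul C.coe_nonneg,
      ENNReal.ofReal_le_ofReal_iff (by positivity)] at h
    refine abs_le_of_sq_le_sq' ?_ (by positivity) |>.2
    rwa [mul_pow, Real.sq_sqrt C.coe_nonneg]
  have hcz : ∀ z ∈ Ω, CauchySeq fun n => f n z := by
    intro z hz
    obtain ⟨r, hr, hb, C, hC0, hC⟩ := hloc z hz
    rw [Metric.cauchySeq_iff] at hcau ⊢
    intro ε hε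
    obtain ⟨N, hN⟩ := hcau (ε / (C + 1)) (by positivity)
    refine ⟨N, fun n hn m hm => ?_⟩
    rw [dist_eq_norm]
    have h1 := hN n hn m hm
    rw [dist_eq_norm, lt_div_iff₀ (by positivity)] at h1
    nlinarith [hC n m z (mem_ball_self hr), norm_nonneg (F n - F m)]
  choose! g hg using fun z hz => cauchySeq_tendsto_of_complete (hcz z hz)
  have hdiff : DifferentiableOn ℂ g Ω := by
    intro z₀ hz₀
    obtain ⟨r, hr, hb, C, hC0, hC⟩ := hloc z₀ hz₀
    have hat : ∀ n, ∀ z ∈ Ω, DifferentiableAt ℂ (f n) z := fun n z hz =>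
      (hf n).differentiableAt (hΩ.mem_nhds hz)
    have hsub : ball z₀ (r / 2) ⊆ Ω := (ball_subset_ball (by linarith)).trans hb
    have hfd : ∀ n m, ∀ z ∈ ball z₀ (r / 2),
        ‖fderiv ℂ (f n) z - fderiv ℂ (f m) z‖ ≤ (2 * C * ‖F n - F m‖) / (r / 2) := by
      intro n m z hz
      have hzb : ball z (r / 2) ⊆ ball z₀ r := by
        intro w hw
        rw [mem_ball] at *
        linarith [dist_triangle w z z₀]
      rw [← fderiv_fun_sub (hat n z (hsub hz)) (hat m z (hsub hz))]
      refine Complex.norm_fderiv_le_div_of_mapsTo_ball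
        (((hf n).sub (hf m)).mono (hzb.trans hb)) ?_ (half_pos hr)
      intro w hw
      rw [mem_closedBall, dist_eq_norm]
      have h1 := hC n m w (hzb hw)
      have h2 := hC n m z (hzb (mem_ball_self (half_pos hr)))
      refine (norm_sub_le _ _).trans ?_
      linarith
    have huc : UniformCauchySeqOn (fun n => fderiv ℂ (f n)) atTop (ball z₀ (r / 2)) := by
      rw [Metric.uniformCauchySeqOn_iff]
      intro ε hε
      rw [Metric.cauchySeq_iff] at hcau
      obtain ⟨N, hN⟩ := hcau (ε * (r / 2) / (2 * C + 1)) (by positivity)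
      refine ⟨N, fun n hn m hm z hz => ?_⟩
      rw [dist_eq_norm]
      refine (hfd n m z hz).trans_lt ?_
      have h1 := hN n hn m hm
      rw [dist_eq_norm, lt_div_iff₀ (by positivity)] at h1
      rw [div_lt_iff₀ (by positivity)]
      nlinarith [norm_nonneg (F n - F m)]
    choose! g' hg' using fun z (hz : z ∈ ball z₀ (r / 2)) =>
      cauchySeq_tendsto_of_complete (huc.cauchySeq hz)
    have := hasFDerivAt_of_tendstoUniformlyOn isOpen_ball
      (huc.tendstoUniformlyOn_of_tendsto hg')
      (fun n z hz => (hat n z (hsub hz)).hasFDerivAt) (fun z hz => hg z (hsub hz))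
      (mem_ball_self (half_pos hr))
    exact this.differentiableAt.differentiableWithinAt
  refine ⟨g, hdiff, ?_⟩
  obtain ⟨φ, hφ, hae⟩ := (tendstoInMeasure_of_tendsto_Lp hG).exists_seq_tendsto_ae
  have hΩae : ∀ᵐ z ∂(weightedVolume Ω μ), z ∈ Ω :=
    (withDensity_absolutelyContinuous _ _).ae_le (ae_restrict_mem hΩ.measurableSet)
  filter_upwards [hae, ae_all_iff.2 hFf, hΩae] with z h1 h2 h3
  refine tendsto_nhds_unique h1 ?_
  simp only [h2]
  exact (hg z h3).comp hφ.tendsto_atTop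

/-- The weighted Bergman projection `𝓑_{Ω,μ}`: the orthogonal projection of `L²(Ω, μ)` onto the
closed subspace `A²(Ω, μ)`. -/
noncomputable def bergmanProjection (Ω : Set (ℂ × ℂ)) (μ : ℂ × ℂ → ℝ)
    [(bergmanSpace Ω μ).HasOrthogonalProjection] :
    Lp ℂ 2 (weightedVolume Ω μ) →L[ℂ] Lp ℂ 2 (weightedVolume Ω μ) :=
  (bergmanSpace Ω μ).starProjection

/-- `𝓑_{Ω,μ}` is `L^p(Ω, μ)` bounded: there is a finite constant `C` with
`‖𝓑 f‖_{L^p(Ω,μ)} ≤ C ‖f‖_{L^p(Ω,μ)}` for all `f ∈ L²(Ω, μ) ∩ L^p(Ω, μ)`. -/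
def BergmanProjectionLpBounded (Ω : Set (ℂ × ℂ)) (μ : ℂ × ℂ → ℝ)
    [(bergmanSpace Ω μ).HasOrthogonalProjection] (p : ℝ) : Prop :=
  ∃ C : ℝ≥0, ∀ f : Lp ℂ 2 (weightedVolume Ω μ),
    MemLp f (ENNReal.ofReal p) (weightedVolume Ω μ) →
      eLpNorm (bergmanProjection Ω μ f) (ENNReal.ofReal p) (weightedVolume Ω μ)
        ≤ C * eLpNorm f (ENNReal.ofReal p) (weightedVolume Ω μ)

/-- The Hartogs triangle `{(z₁, z₂) ∈ ℂ² : |z₁| < |z₂| < 1}`. -/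
def hartogsTriangle : Set (ℂ × ℂ) := {z | ‖z.1‖ < ‖z.2‖ ∧ ‖z.2‖ < 1}

/-- The weight `|z₂|^{s'}`. -/
noncomputable def hartogsWeight (s' : ℝ) (z : ℂ × ℂ) : ℝ := ‖z.2‖ ^ s'

theorem isOpen_hartogsTriangle : IsOpen hartogsTriangle :=
  (isOpen_lt continuous_fst.norm continuous_snd.norm).inter
    (isOpen_lt continuous_snd.norm continuous_const)

instance instHasOrthogonalProjectionHartogs (s' : ℝ) :
    (bergmanSpace hartogsTriangle (hartogsWeight s')).HasOrthogonalProjection := by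
  have hpos : ∀ z ∈ hartogsTriangle, 0 < ‖z.2‖ := fun z hz => (norm_nonneg _).trans_lt hz.1
  have hc : IsClosed (bergmanSpace hartogsTriangle (hartogsWeight s') :
      Set (Lp ℂ 2 (weightedVolume hartogsTriangle (hartogsWeight s')))) := by
    refine isClosed_bergmanSpace isOpen_hartogsTriangle ?_ fun z hz => Real.rpow_pos_of_pos (hpos z hz) _
    exact ContinuousOn.rpow_const (by fun_prop) fun z hz => Or.inl (hpos z hz).ne'
  have : CompleteSpace (bergmanSpace hartogsTriangle (hartogsWeight s')) :=
    hc.isComplete.completeSpace_coe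
  infer_instance

end HartogsBergman

/-!
The map `(z₁, z₂) ↦ (z₁ / z₂, z₂)` carries `ℍ` to the product `𝔻 × 𝔻*`, the weight becoming
`|z₂|^(s' + 2)` once the Jacobian is included, and it splits the Bergman kernel into a product of
two disk kernels: the unweighted one and, for `|ζ|^(s' + 2) dV`, a Laurent monomial
`(w ζ̄)^m` times `(c + (1 - c) w ζ̄) / (π (1 - w ζ̄)^2)`, where `m` is the smallest exponent for
which `ζ^m` is square integrable.

If `ζ^m` lies in `L^p` and in the conjugate `L^q`, the Schur test together with Forelli–Rudin
estimates bounds the operator on `L^p`. Conversely, tensor products of test functions reduce a bound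
on `ℍ` to one on each factor. Radial multiples of `ζ^m` cut off near `0` are mapped to multiples of
`ζ^m`, which forces `ζ^m ∈ L^p` and, by letting the cutoff tend to `0`, `ζ^m ∈ L^q`. For `p = 1`,
the unweighted disk operator applied to the normalized indicator of the disk of centre `a` and
radius `1 - a` is the kernel at `a`, whose `L¹` norm grows like `-log (1 - a^2)`.
-/

namespace HartogsBergman

open MeasureTheory Set Metric Filter Topology
open scoped ENNReal NNReal ComplexConjugate Real

/-! ### Integral inequalities and Schur's test -/

section Integral

variable {α β 𝕜 : Type*} [MeasurableSpace α] [MeasurableSpace β] {μ : Measure α} {ν : Measure β}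
  [NormedField 𝕜]

theorem eLpNorm_prod_mul [SFinite ν] {f : α → 𝕜} {g : β → 𝕜}
    (hf : AEStronglyMeasurable f μ) (hg : AEStronglyMeasurable g ν) {p : ℝ≥0∞} (hp0 : p ≠ 0)
    (hpt : p ≠ ∞) :
    eLpNorm (fun z : α × β => f z.1 * g z.2) p (μ.prod ν) = eLpNorm f p μ * eLpNorm g p ν := by
  simp only [eLpNorm_eq_lintegral_rpow_enorm_toReal hp0 hpt, enorm_mul,
    ENNReal.mul_rpow_of_nonneg _ _ ENNReal.toReal_nonneg]
  rw [lintegral_prod_mul (hf.enorm.pow_const _) (hg.enorm.pow_const _),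
    ENNReal.mul_rpow_of_nonneg _ _ (by positivity)]

theorem memLp_prod_mul [SFinite ν] {f : α → 𝕜} {g : β → 𝕜} {p : ℝ≥0∞} (hp0 : p ≠ 0)
    (hpt : p ≠ ∞) (hf : MemLp f p μ) (hg : MemLp g p ν) :
    MemLp (fun z : α × β => f z.1 * g z.2) p (μ.prod ν) := by
  refine ⟨hf.1.comp_fst.mul hg.1.comp_snd, ?_⟩
  rw [eLpNorm_prod_mul hf.1 hg.1 hp0 hpt]
  exact ENNReal.mul_lt_top hf.2 hg.2

theorem memLp_two_iff {E : Type*} [NormedAddCommGroup E] {f : α → E}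
    (hf : AEStronglyMeasurable f μ) : MemLp f 2 μ ↔ ∫⁻ x, ‖f x‖ₑ ^ 2 ∂μ < ∞ := by
  have h := eLpNorm_lt_top_iff_lintegral_rpow_enorm_lt_top (f := f) (p := 2) (μ := μ)
    two_ne_zero ENNReal.ofNat_ne_top
  simp only [ENNReal.toReal_ofNat, ENNReal.rpow_two] at h
  exact ⟨fun hf2 => h.1 hf2.2, fun hlt => ⟨hf, h.2 hlt⟩⟩

theorem enorm_integral_mul_sq_le {𝕜 : Type*} [RCLike 𝕜] {f g : α → 𝕜}
    (hf : AEStronglyMeasurable f μ) (hg : AEStronglyMeasurable g μ) :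
    ‖∫ x, f x * g x ∂μ‖ₑ ^ 2 ≤ (∫⁻ x, ‖f x‖ₑ ^ 2 ∂μ) * ∫⁻ x, ‖g x‖ₑ ^ 2 ∂μ := by
  have hcs := ENNReal.lintegral_mul_le_Lp_mul_Lq μ Real.HolderConjugate.two_two hf.enorm hg.enorm
  simp only [ENNReal.rpow_two, Pi.mul_apply, ← enorm_mul] at hcs
  calc ‖∫ x, f x * g x ∂μ‖ₑ ^ 2
      ≤ ((∫⁻ x, ‖f x‖ₑ ^ 2 ∂μ) ^ (1 / 2 : ℝ) * (∫⁻ x, ‖g x‖ₑ ^ 2 ∂μ) ^ (1 / 2 : ℝ)) ^ 2 :=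
        pow_le_pow_left' ((enorm_integral_le_lintegral_enorm _).trans hcs) 2
    _ = _ := by
      simp only [mul_pow, ← ENNReal.rpow_mul_natCast]
      norm_num

theorem lintegral_enorm_integral_mul_sq_lt_top {𝕜 : Type*} [RCLike 𝕜] [SFinite μ] [SFinite ν]
    {f : α → 𝕜} {G : α × β → 𝕜} (hf : MemLp f 2 μ) (hG : MemLp G 2 (μ.prod ν)) :
    ∫⁻ b, ‖∫ a, f a * G (a, b) ∂μ‖ₑ ^ 2 ∂ν < ∞ := by
  have hslice : ∀ᵐ b ∂ν, AEStronglyMeasurable (fun a => G (a, b)) μ := hG.1.prodMk_right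
  calc ∫⁻ b, ‖∫ a, f a * G (a, b) ∂μ‖ₑ ^ 2 ∂ν
      ≤ ∫⁻ b, (∫⁻ a, ‖f a‖ₑ ^ 2 ∂μ) * ∫⁻ a, ‖G (a, b)‖ₑ ^ 2 ∂μ ∂ν :=
        lintegral_mono_ae (hslice.mono fun b hb => enorm_integral_mul_sq_le hf.1 hb)
    _ = (∫⁻ a, ‖f a‖ₑ ^ 2 ∂μ) * ∫⁻ z, ‖G z‖ₑ ^ 2 ∂(μ.prod ν) := by
        rw [lintegral_const_mul' _ _ ((memLp_two_iff hf.1).1 hf).ne,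
          lintegral_prod_symm _ (hG.1.enorm.pow_const 2)]
    _ < ∞ := ENNReal.mul_lt_top ((memLp_two_iff hf.1).1 hf) ((memLp_two_iff hG.1).1 hG)

/- Hölder's inequality for the splitting `k f = (k^(1/p) f / v) (k^(1/q) v)`. -/
theorem rpow_lintegral_mul_le {p q : ℝ} (hpq : p.HolderConjugate q) {k f v : α → ℝ≥0∞}
    (hk : Measurable k) (hf : Measurable f) (hv : Measurable v)
    (hv0 : ∀ᵐ x ∂μ, v x ≠ 0 ∧ v x ≠ ∞) :
    (∫⁻ x, k x * f x ∂μ) ^ p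
      ≤ (∫⁻ x, k x * v x ^ q ∂μ) ^ (p / q) * ∫⁻ x, k x * (f x * (v x)⁻¹) ^ p ∂μ := by
  have hsplit : ∫⁻ x, k x * f x ∂μ
      = ∫⁻ x, (k x ^ (1 / p) * (f x * (v x)⁻¹)) * (k x ^ (1 / q) * v x) ∂μ := by
    refine lintegral_congr_ae (hv0.mono fun x hx => ?_)
    have hroot : k x ^ (1 / p) * k x ^ (1 / q) = k x := by
      rw [← ENNReal.rpow_add_of_nonneg _ _ hpq.one_div_nonneg hpq.symm.one_div_nonneg, one_div,
        one_div, hpq.inv_add_inv_eq_one, ENNReal.rpow_one]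
    calc k x * f x = (k x ^ (1 / p) * k x ^ (1 / q)) * f x * ((v x)⁻¹ * v x) := by
          rw [hroot, ENNReal.inv_mul_cancel hx.1 hx.2, mul_one]
      _ = _ := by ring
  have hpow : ∀ {r : ℝ}, 0 < r → ∀ a b : ℝ≥0∞, (a ^ (1 / r) * b) ^ r = a * b ^ r :=
    fun hr a b => by
      rw [ENNReal.mul_rpow_of_nonneg _ _ hr.le, ← ENNReal.rpow_mul, one_div_mul_cancel hr.ne',
        ENNReal.rpow_one]
  have hholder := ENNReal.lintegral_mul_le_Lp_mul_Lq μ hpq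
    (f := fun x => k x ^ (1 / p) * (f x * (v x)⁻¹)) (g := fun x => k x ^ (1 / q) * v x)
    ((hk.pow_const _).mul (hf.mul hv.inv)).aemeasurable ((hk.pow_const _).mul hv).aemeasurable
  simp only [Pi.mul_apply, ← hsplit, hpow hpq.pos, hpow hpq.symm.pos] at hholder
  calc (∫⁻ x, k x * f x ∂μ) ^ p ≤ _ := ENNReal.rpow_le_rpow hholder hpq.nonneg
    _ = _ := by
      rw [hpow hpq.pos, ← ENNReal.rpow_mul, one_div_mul_eq_div, mul_comm]

theorem lintegral_rpow_le_of_schur [SFinite μ] [SFinite ν] {p q : ℝ} (hpq : p.HolderConjugate q)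
    {k : α → β → ℝ≥0∞} (hk : Measurable fun z : α × β => k z.1 z.2) {u : α → ℝ≥0∞}
    (hu : Measurable u) {v : β → ℝ≥0∞} (hv : Measurable v) (hv0 : ∀ᵐ y ∂ν, v y ≠ 0 ∧ v y ≠ ∞)
    {C D : ℝ≥0∞} (hC : ∀ᵐ x ∂μ, ∫⁻ y, k x y * v y ^ q ∂ν ≤ C * u x ^ q)
    (hD : ∀ᵐ y ∂ν, ∫⁻ x, k x y * u x ^ p ∂μ ≤ D * v y ^ p) {f : β → ℝ≥0∞} (hf : Measurable f) :
    ∫⁻ x, (∫⁻ y, k x y * f y ∂ν) ^ p ∂μ ≤ C ^ (p / q) * D * ∫⁻ y, f y ^ p ∂ν := by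
  have hkx : ∀ x, Measurable (k x) := fun x => hk.comp measurable_prodMk_left
  have hky : ∀ y, Measurable fun x => k x y := fun y => hk.comp measurable_prodMk_right
  set F : β → ℝ≥0∞ := fun y => (f y * (v y)⁻¹) ^ p
  have hF : Measurable F := (hf.mul hv.inv).pow_const p
  have hholder : ∀ᵐ x ∂μ, (∫⁻ y, k x y * f y ∂ν) ^ p
      ≤ C ^ (p / q) * ∫⁻ y, u x ^ p * (k x y * F y) ∂ν := by
    filter_upwards [hC] with x hx
    have hdiv : 0 ≤ p / q := div_nonneg hpq.nonneg hpq.symm.nonneg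
    calc (∫⁻ y, k x y * f y ∂ν) ^ p
        ≤ (∫⁻ y, k x y * v y ^ q ∂ν) ^ (p / q) * ∫⁻ y, k x y * F y ∂ν :=
          rpow_lintegral_mul_le hpq (hkx x) hf hv hv0
      _ ≤ (C * u x ^ q) ^ (p / q) * ∫⁻ y, k x y * F y ∂ν := by gcongr
      _ = C ^ (p / q) * ∫⁻ y, u x ^ p * (k x y * F y) ∂ν := by
          rw [ENNReal.mul_rpow_of_nonneg _ _ hdiv, ← ENNReal.rpow_mul,
            mul_div_cancel₀ _ hpq.symm.ne_zero, mul_assoc,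
            lintegral_const_mul (f := fun y => k x y * F y) _ ((hkx x).mul hF)]
  have hinner : ∀ᵐ y ∂ν, ∫⁻ x, u x ^ p * (k x y * F y) ∂μ ≤ D * f y ^ p := by
    filter_upwards [hD, hv0] with y hy hy0
    calc ∫⁻ x, u x ^ p * (k x y * F y) ∂μ = (∫⁻ x, k x y * u x ^ p ∂μ) * F y := by
          rw [← lintegral_mul_const (f := fun x => k x y * u x ^ p) _
            ((hky y).mul (hu.pow_const p))]
          exact lintegral_congr fun x => by ring
      _ ≤ D * v y ^ p * F y := by gcongr
      _ = D * f y ^ p := by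
          rw [mul_assoc, ← ENNReal.mul_rpow_of_nonneg _ _ hpq.nonneg, mul_left_comm,
            ENNReal.mul_inv_cancel hy0.1 hy0.2, mul_one]
  have hjoint : Measurable fun z : α × β => u z.1 ^ p * (k z.1 z.2 * F z.2) :=
    ((hu.pow_const p).comp measurable_fst).mul (hk.mul (hF.comp measurable_snd))
  calc ∫⁻ x, (∫⁻ y, k x y * f y ∂ν) ^ p ∂μ
      ≤ C ^ (p / q) * ∫⁻ x, ∫⁻ y, u x ^ p * (k x y * F y) ∂ν ∂μ := by
        rw [← lintegral_const_mul _ hjoint.lintegral_prod_right']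
        exact lintegral_mono_ae hholder
    _ = C ^ (p / q) * ∫⁻ y, ∫⁻ x, u x ^ p * (k x y * F y) ∂μ ∂ν := by
        rw [lintegral_lintegral_swap hjoint.aemeasurable]
    _ ≤ C ^ (p / q) * D * ∫⁻ y, f y ^ p ∂ν := by
        rw [mul_assoc, ← lintegral_const_mul _ (hf.pow_const p)]
        gcongr _ * ?_
        exact lintegral_mono_ae hinner

theorem eLpNorm_integral_mul_le_of_schur {𝕜 : Type*} [RCLike 𝕜] [SFinite μ] [SFinite ν] {p q : ℝ}
    (hpq : p.HolderConjugate q) {k : α → β → 𝕜} (hk : Measurable fun z : α × β => k z.1 z.2)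
    {u : α → ℝ≥0∞} (hu : Measurable u) {v : β → ℝ≥0∞} (hv : Measurable v)
    (hv0 : ∀ᵐ y ∂ν, v y ≠ 0 ∧ v y ≠ ∞)
    {C D : ℝ≥0∞} (hC : ∀ᵐ x ∂μ, ∫⁻ y, ‖k x y‖ₑ * v y ^ q ∂ν ≤ C * u x ^ q)
    (hD : ∀ᵐ y ∂ν, ∫⁻ x, ‖k x y‖ₑ * u x ^ p ∂μ ≤ D * v y ^ p)
    {f : β → 𝕜} (hf : AEStronglyMeasurable f ν) :
    eLpNorm (fun x => ∫ y, k x y * f y ∂ν) (ENNReal.ofReal p) μ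
      ≤ C ^ (1 / q) * D ^ (1 / p) * eLpNorm f (ENNReal.ofReal p) ν := by
  have hp0 : ENNReal.ofReal p ≠ 0 := by simpa using hpq.pos
  have hmk : ∀ x, ∫⁻ y, ‖k x y * f y‖ₑ ∂ν = ∫⁻ y, ‖k x y‖ₑ * ‖hf.mk f y‖ₑ ∂ν := fun x =>
    lintegral_congr_ae (hf.ae_eq_mk.mono fun y hy => by simp only [enorm_mul, ← hy])
  have hschur := lintegral_rpow_le_of_schur hpq hk.enorm hu hv hv0 hC hD
    hf.stronglyMeasurable_mk.measurable.enorm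
  rw [eLpNorm_congr_ae hf.ae_eq_mk,
    eLpNorm_eq_lintegral_rpow_enorm_toReal hp0 ENNReal.ofReal_ne_top,
    eLpNorm_eq_lintegral_rpow_enorm_toReal hp0 ENNReal.ofReal_ne_top,
    ENNReal.toReal_ofReal hpq.nonneg]
  calc (∫⁻ x, ‖∫ y, k x y * f y ∂ν‖ₑ ^ p ∂μ) ^ (1 / p)
      ≤ (C ^ (p / q) * D * ∫⁻ y, ‖hf.mk f y‖ₑ ^ p ∂ν) ^ (1 / p) := by
        refine ENNReal.rpow_le_rpow ((lintegral_mono fun x => ?_).trans hschur)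
          hpq.one_div_nonneg
        exact ENNReal.rpow_le_rpow ((enorm_integral_le_lintegral_enorm _).trans (hmk x).le)
          hpq.nonneg
    _ = _ := by
        rw [ENNReal.mul_rpow_of_nonneg _ _ hpq.one_div_nonneg,
          ENNReal.mul_rpow_of_nonneg _ _ hpq.one_div_nonneg, ← ENNReal.rpow_mul,
          show p / q * (1 / p) = 1 / q by field_simp [hpq.ne_zero]]

end Integral

/-! ### Polar coordinates on the unit disk -/

theorem measurable_circleMap_zero : Measurable fun p : ℝ × ℝ => circleMap 0 p.1 p.2 := by
  unfold circleMap; fun_prop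

theorem norm_circleMap_zero_of_nonneg {r : ℝ} (hr : 0 ≤ r) (θ : ℝ) : ‖circleMap 0 r θ‖ = r := by
  simp [abs_of_nonneg hr]

theorem lintegral_eq_lintegral_circleMap {F : ℂ → ℝ≥0∞} (hF : Measurable F) :
    ∫⁻ w, F w
      = ∫⁻ r in Ioi (0 : ℝ), ENNReal.ofReal r * ∫⁻ θ in Ioo (-π) π, F (circleMap 0 r θ) := by
  have hsymm : ∀ p : ℝ × ℝ, Complex.polarCoord.symm p = circleMap 0 p.1 p.2 := fun p => by
    simp [circleMap, Complex.exp_mul_I]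
  have htarget : polarCoord.target = Ioi (0 : ℝ) ×ˢ Ioo (-π) π := rfl
  have hmeas : Measurable fun p : ℝ × ℝ => ENNReal.ofReal p.1 * F (circleMap 0 p.1 p.2) :=
    measurable_fst.ennreal_ofReal.mul (hF.comp measurable_circleMap_zero)
  rw [← Complex.lintegral_comp_polarCoord_symm, htarget, Measure.volume_eq_prod,
    ← Measure.prod_restrict]
  simp only [hsymm, smul_eq_mul]
  rw [lintegral_prod _ hmeas.aemeasurable]
  exact lintegral_congr fun r => lintegral_const_mul' _ _ ENNReal.ofReal_ne_top

theorem setIntegral_circleMap {E : Type*} [NormedAddCommGroup E] [NormedSpace ℝ E] (f : ℂ → E)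
    (c : ℂ) (r : ℝ) :
    ∫ θ in Ioo (-π) π, f (circleMap c r θ) = (2 * π) • Real.circleAverage f c r := by
  have hp : (fun θ => f (circleMap c r θ)).Periodic (2 * π) := fun x => by
    simp [periodic_circleMap c r x]
  have hshift := hp.intervalIntegral_add_eq (-π) 0
  rw [zero_add, show -π + 2 * π = π by ring] at hshift
  rw [Real.circleAverage_def, ← integral_Ioc_eq_integral_Ioo,
    ← intervalIntegral.integral_of_le (by linarith [Real.pi_pos]), hshift,
    smul_inv_smul₀ Real.two_pi_pos.ne']

theorem setLIntegral_ofReal_circleMap {u : ℂ → ℝ} {c : ℂ} {r : ℝ} (hr : 0 ≤ r)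
    (hu : ContinuousOn u (sphere c r)) (hu0 : ∀ z ∈ sphere c r, 0 ≤ u z) :
    ∫⁻ θ in Ioo (-π) π, ENNReal.ofReal (u (circleMap c r θ))
      = ENNReal.ofReal (2 * π * Real.circleAverage u c r) := by
  have hmem : ∀ θ, circleMap c r θ ∈ sphere c r := circleMap_mem_sphere c hr
  have hcont : Continuous fun θ => u (circleMap c r θ) :=
    hu.comp_continuous (continuous_circleMap c r) hmem
  rw [← smul_eq_mul (2 * π), ← setIntegral_circleMap, ofReal_integral_eq_lintegral_ofReal]
  · exact (hcont.integrableOn_Icc (a := -π) (b := π)).mono_set Ioo_subset_Icc_self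
  · exact Eventually.of_forall fun θ => hu0 _ (hmem θ)

/-- The measure `|w|^t dA` on the unit disk. -/
noncomputable def diskMeasure (t : ℝ) : Measure ℂ :=
  (volume.restrict (ball 0 1)).withDensity fun w => ENNReal.ofReal (‖w‖ ^ t)

/-- The measure `r^(t+1) dr` on `(0, 1)`, the radial part of `diskMeasure t`. -/
noncomputable def radialMeasure (t : ℝ) : Measure ℝ :=
  (volume.restrict (Ioo 0 1)).withDensity fun r => ENNReal.ofReal (r ^ (t + 1))

instance (t : ℝ) : SFinite (diskMeasure t) := by unfold diskMeasure; infer_instance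

instance (t : ℝ) : SFinite (radialMeasure t) := by unfold radialMeasure; infer_instance

theorem diskMeasure_zero : diskMeasure 0 = volume.restrict (ball 0 1) := by
  simp only [diskMeasure, Real.rpow_zero, ENNReal.ofReal_one, withDensity_const, one_smul]

theorem lintegral_diskMeasure (t : ℝ) (F : ℂ → ℝ≥0∞) :
    ∫⁻ w, F w ∂(diskMeasure t) = ∫⁻ w in ball 0 1, ENNReal.ofReal (‖w‖ ^ t) * F w := by
  rw [diskMeasure,
    lintegral_withDensity_eq_lintegral_mul_non_measurable _ (by fun_prop) (by simp)]
  rfl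

theorem lintegral_radialMeasure (t : ℝ) (F : ℝ → ℝ≥0∞) :
    ∫⁻ r, F r ∂(radialMeasure t) = ∫⁻ r in Ioo 0 1, ENNReal.ofReal (r ^ (t + 1)) * F r := by
  rw [radialMeasure,
    lintegral_withDensity_eq_lintegral_mul_non_measurable _ (by fun_prop) (by simp)]
  rfl

theorem integral_radialMeasure {E : Type*} [NormedAddCommGroup E] [NormedSpace ℝ E] (t : ℝ)
    (F : ℝ → E) : ∫ r, F r ∂(radialMeasure t) = ∫ r in Ioo 0 1, r ^ (t + 1) • F r := by
  rw [radialMeasure, integral_withDensity_eq_integral_toReal_smul (by fun_prop) (by simp)]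
  refine setIntegral_congr_fun measurableSet_Ioo fun r hr => ?_
  rw [ENNReal.toReal_ofReal (Real.rpow_nonneg hr.1.le _)]

theorem ae_diskMeasure_mem (t : ℝ) : ∀ᵐ w ∂(diskMeasure t), w ∈ ball (0 : ℂ) 1 ∧ w ≠ 0 := by
  refine (withDensity_absolutelyContinuous _ _).ae_le ?_
  refine (ae_restrict_mem measurableSet_ball).and ?_
  exact ae_restrict_of_ae (Measure.ae_ne volume 0)

theorem ae_radialMeasure_mem (t : ℝ) : ∀ᵐ r ∂(radialMeasure t), r ∈ Ioo (0 : ℝ) 1 :=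
  (withDensity_absolutelyContinuous _ _).ae_le (ae_restrict_mem measurableSet_Ioo)

theorem lintegral_diskMeasure_polar (t : ℝ) {F : ℂ → ℝ≥0∞} (hF : Measurable F) :
    ∫⁻ w, F w ∂(diskMeasure t)
      = ∫⁻ r, ∫⁻ θ in Ioo (-π) π, F (circleMap 0 r θ) ∂volume ∂(radialMeasure t) := by
  rw [lintegral_diskMeasure, ← lintegral_indicator measurableSet_ball,
    lintegral_eq_lintegral_circleMap (.indicator (by fun_prop) measurableSet_ball),
    lintegral_radialMeasure, ← lintegral_indicator measurableSet_Ioo,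
    ← lintegral_indicator measurableSet_Ioi]
  refine lintegral_congr fun r => ?_
  rcases le_or_gt r 0 with hr0 | hr0
  · simp [hr0.not_gt]
  rw [indicator_of_mem (by exact hr0)]
  rcases le_or_gt 1 r with hr1 | hr1
  · simp [abs_of_pos hr0, hr1.not_gt]
  have hmem : ∀ θ, circleMap 0 r θ ∈ ball (0 : ℂ) 1 := fun θ => by simpa [abs_of_pos hr0] using hr1
  rw [indicator_of_mem (by exact ⟨hr0, hr1⟩)]
  simp only [indicator_of_mem (hmem _), norm_circleMap_zero_of_nonneg hr0.le]
  rw [lintegral_const_mul' _ _ ENNReal.ofReal_ne_top, ← mul_assoc, ← ENNReal.ofReal_mul hr0.le,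
    mul_comm r, Real.rpow_add_one hr0.ne']

theorem measurePreserving_circleMap (t : ℝ) :
    MeasurePreserving (fun p : ℝ × ℝ => circleMap 0 p.1 p.2)
      ((radialMeasure t).prod (volume.restrict (Ioo (-π) π))) (diskMeasure t) := by
  refine ⟨measurable_circleMap_zero, Measure.ext_of_lintegral _ fun F hF => ?_⟩
  rw [lintegral_map hF measurable_circleMap_zero,
    lintegral_prod (fun p : ℝ × ℝ => F (circleMap 0 p.1 p.2))
      (hF.comp measurable_circleMap_zero).aemeasurable,
    lintegral_diskMeasure_polar _ hF]

theorem integral_diskMeasure_polar {E : Type*} [NormedAddCommGroup E] [NormedSpace ℝ E] {t : ℝ}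
    {f : ℂ → E} (hf : Integrable f (diskMeasure t)) :
    ∫ w, f w ∂(diskMeasure t) = ∫ r, (2 * π) • Real.circleAverage f 0 r ∂(radialMeasure t) := by
  have h := measurePreserving_circleMap t
  rw [← h.map_eq, integral_map h.measurable.aemeasurable (by rw [h.map_eq]; exact hf.1),
    integral_prod (fun p : ℝ × ℝ => f (circleMap 0 p.1 p.2)) ((h.integrable_comp hf.1).2 hf)]
  simp only [setIntegral_circleMap]

theorem lintegral_diskMeasure_radial (t : ℝ) {φ : ℝ → ℝ≥0∞} (hφ : Measurable φ) :
    ∫⁻ ζ, φ ‖ζ‖ ∂(diskMeasure t)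
      = ENNReal.ofReal (2 * π) * ∫⁻ r in Ioo 0 1, ENNReal.ofReal (r ^ (t + 1)) * φ r := by
  rw [lintegral_diskMeasure_polar _ (by fun_prop), ← lintegral_radialMeasure,
    ← lintegral_const_mul _ hφ]
  refine lintegral_congr_ae ?_
  filter_upwards [ae_radialMeasure_mem t] with r hr
  simp only [norm_circleMap_zero_of_nonneg hr.1.le, setLIntegral_const, Real.volume_Ioo]
  rw [mul_comm, sub_neg_eq_add, two_mul]

theorem lintegral_norm_rpow_lt_top_iff {t a : ℝ} :
    ∫⁻ ζ, ENNReal.ofReal (‖ζ‖ ^ a) ∂(diskMeasure t) < ∞ ↔ -2 < t + a := by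
  have hpow : ∫⁻ r in Ioo (0 : ℝ) 1, ENNReal.ofReal (r ^ (t + 1)) * ENNReal.ofReal (r ^ a)
      = ∫⁻ r in Ioo (0 : ℝ) 1, ‖r ^ (t + 1 + a)‖ₑ := by
    refine setLIntegral_congr_fun measurableSet_Ioo fun r hr => ?_
    rw [← ENNReal.ofReal_mul (Real.rpow_nonneg hr.1.le _), ← Real.rpow_add hr.1,
      Real.enorm_of_nonneg (Real.rpow_nonneg hr.1.le _)]
  have hfin : ∫⁻ r in Ioo (0 : ℝ) 1, ‖r ^ (t + 1 + a)‖ₑ < ∞ ↔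
      IntegrableOn (fun r : ℝ => r ^ (t + 1 + a)) (Ioo 0 1) :=
    ⟨fun h => ⟨by fun_prop, h⟩, fun h => h.2⟩
  have hpi : ENNReal.ofReal (2 * π) ≠ 0 := by simp [Real.pi_pos]
  rw [lintegral_diskMeasure_radial t (φ := fun r => ENNReal.ofReal (r ^ a)) (by fun_prop), hpow,
    ENNReal.mul_lt_top_iff]
  simp only [ENNReal.ofReal_lt_top, true_and, hpi, false_or, hfin,
    intervalIntegral.integrableOn_Ioo_rpow_iff one_pos]
  refine ⟨?_, fun h => .inl (by linarith)⟩
  rintro (h | h)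
  · linarith
  · have : IntegrableOn (fun r : ℝ => r ^ (t + 1 + a)) (Ioo 0 1) := hfin.1 (by simp [h])
    linarith [(intervalIntegral.integrableOn_Ioo_rpow_iff one_pos).1 this]

theorem isFiniteMeasure_diskMeasure {t : ℝ} (ht : -2 < t) : IsFiniteMeasure (diskMeasure t) :=
  ⟨by simpa using (lintegral_norm_rpow_lt_top_iff (t := t) (a := 0)).2 (by simpa using ht)⟩

theorem integral_diskMeasure_radial_mul {t : ℝ} {φ h : ℂ → ℂ}
    (hφ : Integrable φ (diskMeasure t)) (hrad : ∀ ζ, φ ζ = φ ‖ζ‖)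
    (hh : DifferentiableOn ℂ h (ball 0 1))
    (hφh : Integrable (fun ζ => φ ζ * h ζ) (diskMeasure t)) :
    ∫ ζ, φ ζ * h ζ ∂(diskMeasure t) = (∫ ζ, φ ζ ∂(diskMeasure t)) * h 0 := by
  rw [integral_diskMeasure_polar hφ, integral_diskMeasure_polar hφh, ← integral_mul_const]
  refine integral_congr_ae ?_
  filter_upwards [ae_radialMeasure_mem t] with r hr
  have hφr : ∀ z ∈ sphere (0 : ℂ) |r|, φ z = φ r := fun z hz => by
    rw [hrad, mem_sphere_zero_iff_norm.1 hz, abs_of_pos hr.1]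
  have hmean : Real.circleAverage h 0 r = h 0 := by
    refine DiffContOnCl.circleAverage (DifferentiableOn.diffContOnCl (hh.mono ?_))
    rw [abs_of_pos hr.1, closure_ball _ hr.1.ne']
    exact closedBall_subset_ball hr.2
  rw [Real.circleAverage_congr_sphere (f₁ := fun ζ => φ ζ * h ζ) (f₂ := φ (r : ℂ) • h)
      fun z hz => by simp [hφr z hz],
    Real.circleAverage_congr_sphere (f₁ := φ) (f₂ := fun _ => φ r) hφr,
    Real.circleAverage_smul, Real.circleAverage_const, hmean, smul_eq_mul, smul_mul_assoc]

theorem setIntegral_ball_eq_mul {h : ℂ → ℂ} {a : ℂ} {r : ℝ} (hr : 0 < r)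
    (hh : DifferentiableOn ℂ h (ball a r)) (hi : IntegrableOn h (ball a r)) :
    ∫ ζ in ball a r, h ζ = π * r ^ 2 * h a := by
  have hball : ∀ ζ : ℂ, a + r • ζ ∈ ball a r ↔ ζ ∈ ball (0 : ℂ) 1 := fun ζ => by
    rw [mem_ball_iff_norm, add_sub_cancel_left, norm_smul, Real.norm_of_nonneg hr.le,
      mem_ball_zero_iff, mul_lt_iff_lt_one_right hr]
  have hrescale : (fun ζ => (ball a r).indicator h (a + r • ζ))
      = (ball 0 1).indicator fun ζ => h (a + r • ζ) := by
    ext ζ; classical simp only [indicator_apply, hball]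
  have hunit : IntegrableOn (fun ζ => h (a + r • ζ)) (ball 0 1) := by
    rw [← integrable_indicator_iff measurableSet_ball, ← hrescale]
    exact ((hi.integrable_indicator measurableSet_ball).comp_add_left a).comp_smul hr.ne'
  have hmean : ∫ ζ in ball (0 : ℂ) 1, h (a + r • ζ) = π * h a := by
    have hmul := integral_diskMeasure_radial_mul (t := 0) (φ := 1) (h := fun ζ => h (a + r • ζ))
      (by rw [diskMeasure_zero]; exact integrableOn_const measure_ball_lt_top.ne) (fun _ => rfl)
      (hh.comp (by fun_prop) fun ζ hζ => (hball ζ).2 hζ)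
      (by simpa only [diskMeasure_zero, Pi.one_apply, one_mul] using! hunit)
    simpa [diskMeasure_zero, Measure.real] using hmul
  calc ∫ ζ in ball a r, h ζ
      = ∫ ζ, (ball a r).indicator h (a + ζ) := by
        rw [integral_add_left_eq_self, integral_indicator measurableSet_ball]
    _ = r ^ 2 • ∫ ζ, (ball a r).indicator h (a + r • ζ) := by
        rw [Measure.integral_comp_smul volume (fun ζ => (ball a r).indicator h (a + ζ)),
          Complex.finrank_real_complex, abs_of_pos (by positivity),
          smul_inv_smul₀ (by positivity)]
    _ = π * r ^ 2 * h a := by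
        rw [hrescale, integral_indicator measurableSet_ball, hmean, Complex.real_smul]
        push_cast
        ring

theorem volume_ball_mul_enorm_le_setLIntegral {h : ℂ → ℂ} {a : ℂ} {r : ℝ} (hr : 0 < r)
    (hh : DifferentiableOn ℂ h (ball a r)) :
    volume (ball a r) * ‖h a‖ₑ ≤ ∫⁻ w in ball a r, ‖h w‖ₑ := by
  rcases eq_or_ne (∫⁻ w in ball a r, ‖h w‖ₑ) ∞ with htop | hfin
  · rw [htop]; exact le_top
  have hi : IntegrableOn h (ball a r) :=
    ⟨hh.continuousOn.aestronglyMeasurable measurableSet_ball, hfin.lt_top⟩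
  refine le_of_eq_of_le ?_ (enorm_integral_le_lintegral_enorm _)
  rw [setIntegral_ball_eq_mul hr hh hi, enorm_mul, ← Complex.ofReal_pow, ← Complex.ofReal_mul,
    ← ofReal_norm ((π * r ^ 2 : ℝ) : ℂ), Complex.norm_of_nonneg (by positivity), mul_comm π,
    ENNReal.ofReal_mul (by positivity), ENNReal.ofReal_pow hr.le, Complex.volume_ball,
    ← ENNReal.ofReal_coe_nnreal, NNReal.coe_real_pi]

/-! ### The kernel of the unit disk -/

theorem one_sub_ne_zero_of_norm_lt_one {z : ℂ} (hz : ‖z‖ < 1) : 1 - z ≠ 0 :=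
  (isUnit_one_sub_of_norm_lt_one hz).ne_zero

theorem norm_mul_conj_lt_one {w ζ : ℂ} (hw : w ∈ ball (0 : ℂ) 1) (hζ : ζ ∈ ball (0 : ℂ) 1) :
    ‖w * conj ζ‖ < 1 := by
  rw [mem_ball_zero_iff] at hw hζ
  rw [norm_mul, RCLike.norm_conj]
  exact mul_lt_one_of_nonneg_of_lt_one_left (norm_nonneg w) hw hζ.le

theorem circleAverage_norm_one_sub_inv_sq {w : ℂ} {r : ℝ} (hr : 0 < r) (hw : ‖w‖ * r < 1) :
    Real.circleAverage (fun ζ => ‖1 - w * conj ζ‖⁻¹ ^ 2) 0 r = (1 - ‖w‖ ^ 2 * r ^ 2)⁻¹ := by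
  have hpos : 1 - ‖w‖ ^ 2 * r ^ 2 ≠ 0 := by
    rw [← mul_pow]
    exact (sub_pos.2 (pow_lt_one₀ (by positivity) hw two_ne_zero)).ne'
  have hmem : r ^ 2 * w ∈ ball (0 : ℂ) r := by
    rw [mem_ball_zero_iff, norm_mul, norm_pow, Complex.norm_of_nonneg hr.le]
    nlinarith
  have hpoisson : ∀ ζ ∈ sphere (0 : ℂ) |r|, ‖1 - w * conj ζ‖⁻¹ ^ 2
      = ((1 - ‖w‖ ^ 2 * r ^ 2)⁻¹ • (poissonKernel 0 (r ^ 2 * w) • fun _ => (1 : ℝ))) ζ := by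
    intro ζ hζ
    have hζr : ‖ζ‖ = r := by simpa [abs_of_pos hr] using hζ
    have hfactor : ζ - r ^ 2 * w = ζ * (1 - w * conj ζ) := by
      rw [mul_sub, mul_left_comm, Complex.mul_conj, Complex.normSq_eq_norm_sq, hζr]
      push_cast
      ring
    have hnum : r ^ 2 - (r ^ 2 * ‖w‖) ^ 2 = r ^ 2 * (1 - ‖w‖ ^ 2 * r ^ 2) := by ring
    simp only [Pi.smul_apply, Pi.mul_apply, smul_eq_mul, mul_one, poissonKernel_def, sub_zero,
      hfactor, norm_mul, norm_pow, Complex.norm_of_nonneg hr.le, hζr, hnum]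
    rw [mul_pow, mul_div_mul_left _ _ (by positivity), div_eq_mul_inv, inv_mul_cancel_left₀ hpos,
      inv_pow]
  rw [Real.circleAverage_congr_sphere hpoisson, Real.circleAverage_smul,
    InnerProductSpace.HarmonicOnNhd.circleAverage_poissonKernel_smul (by simp) hmem, smul_eq_mul,
    mul_one]

theorem setLIntegral_enorm_one_sub_circleMap {w : ℂ} {r : ℝ} (hr : 0 < r) (hw : ‖w‖ * r < 1) :
    ∫⁻ θ in Ioo (-π) π, ‖1 - w * conj (circleMap 0 r θ)‖ₑ⁻¹ ^ 2
      = ENNReal.ofReal (2 * π / (1 - ‖w‖ ^ 2 * r ^ 2)) := by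
  have hne : ∀ ζ ∈ sphere (0 : ℂ) r, 1 - w * conj ζ ≠ 0 := fun ζ hζ =>
    one_sub_ne_zero_of_norm_lt_one <| by
      rwa [norm_mul, RCLike.norm_conj, mem_sphere_zero_iff_norm.1 hζ]
  have hcont : ContinuousOn (fun ζ => ‖1 - w * conj ζ‖⁻¹ ^ 2) (sphere (0 : ℂ) r) := by
    refine (ContinuousOn.inv₀ (by fun_prop) fun ζ hζ => ?_).pow 2
    exact norm_ne_zero_iff.2 (hne ζ hζ)
  rw [div_eq_mul_inv, ← circleAverage_norm_one_sub_inv_sq hr hw,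
    ← setLIntegral_ofReal_circleMap hr.le hcont fun ζ _ => by positivity]
  refine lintegral_congr fun θ => ?_
  have hpos := norm_pos_iff.2 (hne _ (circleMap_mem_sphere 0 hr.le θ))
  rw [ENNReal.ofReal_pow (by positivity), ENNReal.ofReal_inv_of_pos hpos, ofReal_norm]

theorem lintegral_diskMeasure_radial_mul_enorm_one_sub (t : ℝ) {φ : ℝ → ℝ≥0∞} (hφ : Measurable φ)
    {w : ℂ} (hw : ‖w‖ ≤ 1) :
    ∫⁻ ζ, φ ‖ζ‖ * ‖1 - w * conj ζ‖ₑ⁻¹ ^ 2 ∂(diskMeasure t)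
      = ∫⁻ r, φ r * ENNReal.ofReal (2 * π / (1 - ‖w‖ ^ 2 * r ^ 2)) ∂(radialMeasure t) := by
  have hconj : Measurable (fun z : ℂ => conj z) := Complex.continuous_conj.measurable
  rw [lintegral_diskMeasure_polar _ (by fun_prop)]
  refine lintegral_congr_ae ?_
  filter_upwards [ae_radialMeasure_mem t] with r hr
  simp only [norm_circleMap_zero_of_nonneg hr.1.le]
  have hwr : ‖w‖ * r < 1 := mul_lt_one_of_nonneg_of_lt_one_right hw hr.1.le hr.2
  rw [lintegral_const_mul _ (by unfold circleMap; fun_prop),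
    setLIntegral_enorm_one_sub_circleMap hr.1 hwr]

/-- The function `∑ (j + c) x ^ j` of the unit disk, in closed form. -/
noncomputable def symbol (c : ℝ) (x : ℂ) : ℂ := (c + (1 - c) * x) / (1 - x) ^ 2

/-- The Bergman kernel of the punctured unit disk with weight `|w| ^ (2c - 2 - 2m)`, where
`0 < c ≤ 1`: the monomials of the weighted Bergman space are the `w ^ j` with `m ≤ j`. -/
noncomputable def diskKernel (c : ℝ) (m : ℤ) (w ζ : ℂ) : ℂ :=
  (π : ℂ)⁻¹ * (w * conj ζ) ^ m * symbol c (w * conj ζ)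

theorem norm_symbol_le {c : ℝ} (hc : c ∈ Icc (0 : ℝ) 1) {x : ℂ} (hx : ‖x‖ ≤ 1) :
    ‖symbol c x‖ ≤ ‖1 - x‖⁻¹ ^ 2 := by
  have hnum : ‖(c + (1 - c) * x : ℂ)‖ ≤ 1 :=
    calc ‖(c + (1 - c) * x : ℂ)‖ ≤ ‖(c : ℂ)‖ + ‖((1 - c : ℝ) : ℂ) * x‖ := by
          push_cast; exact norm_add_le _ _
      _ ≤ c + (1 - c) * 1 := by
          rw [norm_mul, Complex.norm_of_nonneg hc.1, Complex.norm_of_nonneg (sub_nonneg.2 hc.2)]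
          gcongr
          exact sub_nonneg.2 hc.2
      _ = 1 := by ring
  rw [symbol, norm_div, norm_pow, inv_pow, div_eq_mul_inv]
  exact mul_le_of_le_one_left (by positivity) hnum

theorem norm_symbol_le_of_norm_le {c : ℝ} (hc : c ∈ Icc (0 : ℝ) 1) {x : ℂ} {ρ : ℝ}
    (hx : ‖x‖ ≤ ρ) (hρ : ρ < 1) : ‖symbol c x‖ ≤ (1 - ρ)⁻¹ ^ 2 := by
  refine (norm_symbol_le hc (hx.trans hρ.le)).trans ?_
  have hle : 1 - ρ ≤ ‖1 - x‖ := by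
    have := norm_sub_norm_le (1 : ℂ) x
    rw [norm_one] at this
    linarith
  exact pow_le_pow_left₀ (by positivity) (inv_anti₀ (sub_pos.2 hρ) hle) 2

theorem symbol_conj (c : ℝ) (x : ℂ) : symbol c (conj x) = conj (symbol c x) := by
  simp [symbol]

@[fun_prop]
theorem measurable_symbol (c : ℝ) : Measurable (symbol c) := by unfold symbol; fun_prop

theorem measurable_diskKernel (c : ℝ) (m : ℤ) :
    Measurable fun p : ℂ × ℂ => diskKernel c m p.1 p.2 := by
  have h : Measurable fun p : ℂ × ℂ => p.1 * conj p.2 :=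
    measurable_fst.mul (Complex.continuous_conj.measurable.comp measurable_snd)
  exact ((h.pow_const m).const_mul _).mul ((measurable_symbol c).comp h)

theorem measurable_diskKernel_right (c : ℝ) (m : ℤ) (w : ℂ) : Measurable (diskKernel c m w) :=
  Measurable.of_uncurry_left (f := diskKernel c m) (measurable_diskKernel c m)

theorem differentiableOn_symbol (c : ℝ) : DifferentiableOn ℂ (symbol c) (ball 0 1) :=
  DifferentiableOn.div (by fun_prop) (by fun_prop) fun _ hx =>
    pow_ne_zero 2 (one_sub_ne_zero_of_norm_lt_one (mem_ball_zero_iff.1 hx))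

theorem symbol_mul_conj_eq {c : ℝ} {w ζ : ℂ} {r : ℝ} (hr : 0 < r) (hζ : ζ ∈ sphere (0 : ℂ) r) :
    symbol c (w * conj ζ) = ζ * (c * ζ + (1 - c) * (r ^ 2 * w)) / (ζ - r ^ 2 * w) ^ 2 := by
  have hζ0 : ζ ≠ 0 := ne_of_mem_sphere hζ hr.ne'
  have hconj : conj ζ = r ^ 2 / ζ := by
    rw [eq_div_iff hζ0, Complex.conj_mul', mem_sphere_zero_iff_norm.1 hζ]
  have harg : w * conj ζ = r ^ 2 * w / ζ := by rw [hconj]; ring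
  rw [symbol, harg, one_sub_div hζ0]
  field_simp

theorem circleAverage_symbol_mul {c : ℝ} {g : ℂ → ℂ} (hg : DifferentiableOn ℂ g (ball 0 1))
    {w : ℂ} (hw : w ∈ ball (0 : ℂ) 1) {r : ℝ} (hr : r ∈ Ioo (0 : ℝ) 1) :
    Real.circleAverage (fun ζ => symbol c (w * conj ζ) * g ζ) 0 r
      = deriv g (r ^ 2 * w) * (r ^ 2 * w) + c * g (r ^ 2 * w) := by
  set v : ℂ := r ^ 2 * w
  have hvr : v ∈ ball (0 : ℂ) r := by
    rw [mem_ball_zero_iff] at hw ⊢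
    rw [norm_mul, norm_pow, Complex.norm_of_nonneg hr.1.le]
    nlinarith [norm_nonneg w, hr.1, hr.2, mul_pos hr.1 hr.1]
  have hderiv : deriv (fun ζ => g ζ * (c * ζ + (1 - c) * v)) v = deriv g v * v + c * g v := by
    have hgv : HasDerivAt g (deriv g v) v :=
      (hg.differentiableAt (isOpen_ball.mem_nhds (ball_subset_ball hr.2.le hvr))).hasDerivAt
    have hlin : HasDerivAt (fun ζ : ℂ => c * ζ + (1 - c) * v) (c : ℂ) v := by
      simpa using ((hasDerivAt_id v).const_mul (c : ℂ)).add_const ((1 - c) * v)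
    exact (hgv.fun_mul hlin).deriv.trans (by ring)
  rw [← hderiv, ← Complex.two_pi_I_inv_smul_circleIntegral_sub_sq_inv_smul_of_differentiable
    isOpen_ball (closedBall_subset_ball hr.2) (hg.fun_mul (by fun_prop)) hvr,
    Real.circleAverage_eq_circleIntegral hr.1.ne']
  congr 1
  refine circleIntegral.integral_congr hr.1.le fun ζ hζ => ?_
  have hζ0 : ζ ≠ 0 := ne_of_mem_sphere hζ hr.1.ne'
  simp only [smul_eq_mul, symbol_mul_conj_eq hr.1 hζ, sub_zero, v]
  field_simp

theorem integrable_symbol_mul {c : ℝ} (hc : c ∈ Icc (0 : ℝ) 1) {t : ℝ} {g : ℂ → ℂ}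
    (hg : Integrable g (diskMeasure t)) {w : ℂ} (hw : w ∈ ball (0 : ℂ) 1) :
    Integrable (fun ζ => symbol c (w * conj ζ) * g ζ) (diskMeasure t) := by
  have hmeas : Measurable fun ζ => symbol c (w * conj ζ) :=
    (measurable_symbol c).comp (Complex.continuous_conj.measurable.const_mul w)
  refine hg.bdd_mul (c := (1 - ‖w‖)⁻¹ ^ 2) hmeas.aestronglyMeasurable ?_
  filter_upwards [ae_diskMeasure_mem t] with ζ hζ
  refine norm_symbol_le_of_norm_le hc ?_ (mem_ball_zero_iff.1 hw)
  rw [norm_mul, RCLike.norm_conj]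
  exact mul_le_of_le_one_right (norm_nonneg _) (mem_ball_zero_iff.1 hζ.1).le

theorem integral_Ioo_rpow_mul_deriv {c : ℝ} (hc : 0 < c) {g : ℂ → ℂ}
    (hg : DifferentiableOn ℂ g (ball 0 1)) {w : ℂ} (hw : w ∈ ball (0 : ℂ) 1) :
    ∫ r in Ioo (0 : ℝ) 1, r ^ (2 * c - 1) •
      (2 * (deriv g (r ^ 2 * w) * (r ^ 2 * w) + c * g (r ^ 2 * w))) = g w := by
  have hmem : MapsTo (fun r : ℝ => (r ^ 2 * w : ℂ)) (Icc 0 1) (ball (0 : ℂ) 1) := fun r hr => by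
    rw [mem_ball_zero_iff] at hw ⊢
    rw [norm_mul, norm_pow, Complex.norm_of_nonneg hr.1]
    exact mul_lt_one_of_nonneg_of_lt_one_right (pow_le_one₀ hr.1 hr.2) (norm_nonneg _) hw
  have hcg : ContinuousOn (fun r : ℝ => g (r ^ 2 * w)) (Icc 0 1) :=
    hg.continuousOn.comp (by fun_prop) hmem
  have hcd : ContinuousOn (fun r : ℝ => deriv g (r ^ 2 * w)) (Icc 0 1) :=
    (hg.deriv isOpen_ball).continuousOn.comp (by fun_prop) hmem
  have hderiv : ∀ r ∈ Ioo (0 : ℝ) 1, HasDerivAt (fun r : ℝ => r ^ (2 * c) • g (r ^ 2 * w))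
      (r ^ (2 * c - 1) • (2 * (deriv g (r ^ 2 * w) * (r ^ 2 * w) + c * g (r ^ 2 * w)))) r := by
    intro r hr
    have hgr : HasDerivAt g (deriv g (r ^ 2 * w)) (r ^ 2 * w) :=
      (hg.differentiableAt (isOpen_ball.mem_nhds (hmem ⟨hr.1.le, hr.2.le⟩))).hasDerivAt
    have hsq : HasDerivAt (fun r : ℝ => ((r : ℂ) ^ 2 * w)) (2 * r * w) r := by
      simpa using (((hasDerivAt_id (r : ℂ)).pow 2).mul_const w).comp_ofReal
    refine ((Real.hasDerivAt_rpow_const (p := 2 * c) (Or.inl hr.1.ne')).fun_smul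
      (hgr.scomp r hsq)).congr_deriv ?_
    have hrpow : r ^ (2 * c) = r ^ (2 * c - 1) * r := by
      rw [← Real.rpow_add_one hr.1.ne', sub_add_cancel]
    simp only [Function.comp_apply, Complex.real_smul, smul_eq_mul, hrpow]
    push_cast
    ring
  have hint : IntervalIntegrable (fun r : ℝ => r ^ (2 * c - 1) •
      (2 * (deriv g (r ^ 2 * w) * (r ^ 2 * w) + c * g (r ^ 2 * w)))) volume 0 1 := by
    refine (intervalIntegral.intervalIntegrable_rpow' (by linarith)).smul_continuousOn ?_
    rw [uIcc_of_le zero_le_one]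
    exact continuousOn_const.mul ((hcd.mul (by fun_prop)).add (continuousOn_const.mul hcg))
  rw [← integral_Ioc_eq_integral_Ioo, ← intervalIntegral.integral_of_le zero_le_one,
    intervalIntegral.integral_eq_sub_of_hasDerivAt_of_le zero_le_one
      ((Real.continuous_rpow_const (by linarith)).continuousOn.fun_smul hcg) hderiv hint,
    Real.zero_rpow (by linarith)]
  simp

theorem integral_symbol_mul {c : ℝ} (hc : c ∈ Ioc (0 : ℝ) 1) {g : ℂ → ℂ}
    (hg : DifferentiableOn ℂ g (ball 0 1)) (hgi : Integrable g (diskMeasure (2 * c - 2)))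
    {w : ℂ} (hw : w ∈ ball (0 : ℂ) 1) :
    ∫ ζ, symbol c (w * conj ζ) * g ζ ∂(diskMeasure (2 * c - 2)) = π * g w := by
  rw [integral_diskMeasure_polar (integrable_symbol_mul (Ioc_subset_Icc_self hc) hgi hw),
    integral_radialMeasure, ← integral_Ioo_rpow_mul_deriv hc.1 hg hw, ← integral_const_mul]
  refine setIntegral_congr_fun measurableSet_Ioo fun r hr => ?_
  simp only [circleAverage_symbol_mul hg hw hr, Complex.real_smul,
    show 2 * c - 2 + 1 = 2 * c - 1 by ring]
  push_cast
  ring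

theorem integral_diskKernel_one_zero_mul {g : ℂ → ℂ} (hg : DifferentiableOn ℂ g (ball 0 1))
    (hgi : Integrable g (diskMeasure 0)) {w : ℂ} (hw : w ∈ ball (0 : ℂ) 1) :
    ∫ ζ, diskKernel 1 0 w ζ * g ζ ∂(diskMeasure 0) = g w := by
  have hπ : (π : ℂ) ≠ 0 := Complex.ofReal_ne_zero.2 Real.pi_ne_zero
  have hrep := integral_symbol_mul ⟨one_pos, le_rfl⟩ hg (by simpa using hgi) hw
  rw [mul_one, sub_self] at hrep
  simp only [diskKernel, zpow_zero, mul_one, mul_assoc, integral_const_mul, hrep,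
    inv_mul_cancel_left₀ hπ]

/-! ### Square-integrable holomorphic functions on the punctured disk -/

theorem ball_half_norm_subset {z : ℂ} :
    ball z (‖z‖ / 2) ⊆ ball 0 (2 * ‖z‖) \ {0} := fun w hw => by
  have hwz : ‖w - z‖ < ‖z‖ / 2 := mem_ball_iff_norm.1 hw
  have hnorm := norm_nonneg z
  refine ⟨?_, ?_⟩
  · rw [mem_ball_zero_iff]
    linarith [norm_sub_norm_le w z]
  · rintro rfl
    rw [zero_sub, norm_neg] at hwz
    linarith

theorem enorm_mul_sq_le_setLIntegral {g : ℂ → ℂ} {z : ℂ}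
    (hg : DifferentiableOn ℂ g (ball 0 (2 * ‖z‖) \ {0})) :
    ‖z * g z‖ₑ ^ 2 ≤ 4 * ∫⁻ w in ball 0 (2 * ‖z‖), ‖g w‖ₑ ^ 2 := by
  rcases eq_or_ne z 0 with rfl | hz
  · simp
  have hz0 : 0 < ‖z‖ := norm_pos_iff.2 hz
  have hmean := volume_ball_mul_enorm_le_setLIntegral (half_pos hz0)
    ((hg.mono ball_half_norm_subset).fun_pow 2)
  have hvol : ‖z‖ₑ ^ 2 ≤ 4 * volume (ball z (‖z‖ / 2)) := by
    have hfour : (4 : ℝ≥0∞) * ENNReal.ofReal (‖z‖ / 2) ^ 2 = ‖z‖ₑ ^ 2 := by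
      rw [← ofReal_norm, ← ENNReal.ofReal_pow (by positivity), ← ENNReal.ofReal_pow (by positivity),
        show (4 : ℝ≥0∞) = ENNReal.ofReal 4 by simp, ← ENNReal.ofReal_mul (by norm_num)]
      ring_nf
    have hπ : (1 : ℝ≥0) ≤ NNReal.pi := by
      rw [← NNReal.coe_le_coe, NNReal.coe_one, NNReal.coe_real_pi]
      linarith [Real.pi_gt_three]
    rw [Complex.volume_ball, ← mul_assoc, hfour]
    exact le_mul_of_one_le_right' (by exact_mod_cast hπ)
  calc ‖z * g z‖ₑ ^ 2 = ‖z‖ₑ ^ 2 * ‖g z ^ 2‖ₑ := by rw [enorm_mul, mul_pow, enorm_pow]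
    _ ≤ 4 * (volume (ball z (‖z‖ / 2)) * ‖g z ^ 2‖ₑ) := by
        rw [← mul_assoc]; gcongr
    _ ≤ 4 * ∫⁻ w in ball z (‖z‖ / 2), ‖g w ^ 2‖ₑ := by gcongr
    _ ≤ 4 * ∫⁻ w in ball 0 (2 * ‖z‖), ‖g w‖ₑ ^ 2 := by
        simp only [enorm_pow]
        gcongr
        exact ball_half_norm_subset.trans sdiff_subset

theorem tendsto_mul_nhdsNE_zero_of_lintegral_lt_top {g : ℂ → ℂ}
    (hg : DifferentiableOn ℂ g (ball 0 1 \ {0})) (hi : ∫⁻ w in ball 0 1, ‖g w‖ₑ ^ 2 < ∞) :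
    Tendsto (fun z => z * g z) (𝓝[≠] 0) (𝓝 0) := by
  have hsmall : ∀ᶠ z : ℂ in 𝓝[≠] 0, 2 * ‖z‖ < 1 :=
    nhdsWithin_le_nhds ((Continuous.tendsto (by fun_prop) 0).eventually_lt_const (by simp))
  have hvol : Tendsto (fun z : ℂ => volume (ball (0 : ℂ) (2 * ‖z‖))) (𝓝[≠] 0) (𝓝 0) := by
    have hcont : Continuous fun z : ℂ => ENNReal.ofReal (2 * ‖z‖) ^ 2 * NNReal.pi :=
      (ENNReal.continuous_mul_const ENNReal.coe_ne_top).comp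
        ((ENNReal.continuous_pow 2).comp (ENNReal.continuous_ofReal.comp (by fun_prop)))
    have hzero := hcont.tendsto 0
    rw [norm_zero, mul_zero, ENNReal.ofReal_zero, zero_pow two_ne_zero, zero_mul] at hzero
    simp only [Complex.volume_ball]
    exact hzero.mono_left nhdsWithin_le_nhds
  have hint : Tendsto (fun z : ℂ => 4 * ∫⁻ w in ball 0 (2 * ‖z‖), ‖g w‖ₑ ^ 2
      ∂(volume.restrict (ball 0 1))) (𝓝[≠] 0) (𝓝 0) := by
    have hlim := tendsto_setLIntegral_zero hi.ne
      (tendsto_of_tendsto_of_tendsto_of_le_of_le tendsto_const_nhds hvol (fun _ => zero_le)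
        fun z => Measure.restrict_apply_le _ _)
    simpa using ENNReal.Tendsto.const_mul hlim (a := 4) (Or.inr (by simp))
  have hsq : Tendsto (fun z => ‖(z * g z) ^ 2‖ₑ) (𝓝[≠] 0) (𝓝 0) := by
    refine tendsto_of_tendsto_of_tendsto_of_le_of_le' tendsto_const_nhds hint
      (Eventually.of_forall fun _ => zero_le) (hsmall.mono fun z hz => ?_)
    have hsub : ball (0 : ℂ) (2 * ‖z‖) ⊆ ball 0 1 := ball_subset_ball hz.le
    rw [enorm_pow, Measure.restrict_restrict measurableSet_ball, inter_eq_left.2 hsub]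
    exact enorm_mul_sq_le_setLIntegral (hg.mono (sdiff_subset_sdiff_left hsub))
  have hsqrt := ((tendsto_zero_iff_enorm_tendsto_zero.2 hsq).norm).sqrt
  simp only [norm_zero, Real.sqrt_zero, norm_pow, Real.sqrt_sq (norm_nonneg _)] at hsqrt
  exact tendsto_zero_iff_norm_tendsto_zero.2 hsqrt

theorem exists_differentiableOn_ball_of_lintegral_lt_top {g : ℂ → ℂ}
    (hg : DifferentiableOn ℂ g (ball 0 1 \ {0})) (hi : ∫⁻ w in ball 0 1, ‖g w‖ₑ ^ 2 < ∞) :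
    ∃ h : ℂ → ℂ, DifferentiableOn ℂ h (ball 0 1) ∧ ∀ w ≠ 0, h w = g w := by
  refine ⟨_, Complex.differentiableOn_update_limUnder_of_isLittleO
    (isOpen_ball.mem_nhds (mem_ball_self one_pos)) hg ?_, fun w hw => Function.update_of_ne hw _ _⟩
  have hconst : Tendsto (fun z : ℂ => z * g 0) (𝓝[≠] 0) (𝓝 0) := by
    simpa using ((continuous_mul_const (g 0)).tendsto 0).mono_left nhdsWithin_le_nhds
  have hlim : Tendsto (fun z : ℂ => z * (g z - g 0)) (𝓝[≠] 0) (𝓝 0) := by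
    simpa [mul_sub] using (tendsto_mul_nhdsNE_zero_of_lintegral_lt_top hg hi).sub hconst
  refine (Asymptotics.isLittleO_iff_tendsto' ?_).2 (hlim.congr fun z => ?_)
  · filter_upwards [eventually_mem_nhdsWithin] with z hz hinv
    rw [sub_zero, inv_eq_zero] at hinv
    exact absurd hinv hz
  · rw [sub_zero, div_inv_eq_mul, mul_comm]

theorem diskMeasure_add (t a : ℝ) :
    diskMeasure (t + a) = (diskMeasure t).withDensity fun w => ENNReal.ofReal (‖w‖ ^ a) := by
  rw [diskMeasure, diskMeasure, ← withDensity_mul _ (by fun_prop) (by fun_prop)]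
  refine withDensity_congr_ae (ae_restrict_of_ae ((Measure.ae_ne volume 0).mono fun w hw => ?_))
  simp only [Pi.mul_apply, ← ENNReal.ofReal_mul (Real.rpow_nonneg (norm_nonneg w) t),
    Real.rpow_add (norm_pos_iff.2 hw)]

theorem lintegral_diskMeasure_add (t a : ℝ) (F : ℂ → ℝ≥0∞) :
    ∫⁻ w, F w ∂(diskMeasure (t + a)) = ∫⁻ w, ENNReal.ofReal (‖w‖ ^ a) * F w ∂(diskMeasure t) := by
  rw [diskMeasure_add,
    lintegral_withDensity_eq_lintegral_mul_non_measurable _ (by fun_prop) (by simp)]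
  rfl

theorem integral_diskMeasure_add {E : Type*} [NormedAddCommGroup E] [NormedSpace ℝ E] (t a : ℝ)
    (F : ℂ → E) :
    ∫ w, F w ∂(diskMeasure (t + a)) = ∫ w, ‖w‖ ^ a • F w ∂(diskMeasure t) := by
  rw [diskMeasure_add, integral_withDensity_eq_integral_toReal_smul (by fun_prop) (by simp)]
  simp only [ENNReal.toReal_ofReal (Real.rpow_nonneg (norm_nonneg _) _)]

theorem norm_rpow_neg_two_mul_intCast (m : ℤ) (ζ : ℂ) :
    ‖ζ‖ ^ (-2 * m : ℝ) = ‖ζ ^ (-m)‖ ^ 2 := by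
  rw [norm_zpow, ← zpow_natCast, ← zpow_mul, ← Real.rpow_intCast]
  push_cast
  ring_nf

theorem lintegral_enorm_zpow_mul_sq (t : ℝ) (m : ℤ) (g : ℂ → ℂ) :
    ∫⁻ ζ, ‖ζ ^ (-m) * g ζ‖ₑ ^ 2 ∂(diskMeasure t)
      = ∫⁻ ζ, ‖g ζ‖ₑ ^ 2 ∂(diskMeasure (t - 2 * m)) := by
  rw [sub_eq_add_neg, ← neg_mul, lintegral_diskMeasure_add]
  refine lintegral_congr fun ζ => ?_
  rw [norm_rpow_neg_two_mul_intCast, enorm_mul, mul_pow, ENNReal.ofReal_pow (norm_nonneg _),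
    ofReal_norm]

theorem setLIntegral_ball_le_lintegral_diskMeasure {t : ℝ} (ht : t ≤ 0) (F : ℂ → ℝ≥0∞) :
    ∫⁻ ζ in ball 0 1, F ζ ≤ ∫⁻ ζ, F ζ ∂(diskMeasure t) := by
  rw [lintegral_diskMeasure]
  refine lintegral_mono_ae ?_
  filter_upwards [ae_restrict_mem measurableSet_ball,
    ae_restrict_of_ae (Measure.ae_ne volume (0 : ℂ))] with ζ hζ hζ0
  refine le_mul_of_one_le_left' (ENNReal.one_le_ofReal.2 ?_)
  exact Real.one_le_rpow_of_pos_of_le_one_of_nonpos (norm_pos_iff.2 hζ0)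
    (mem_ball_zero_iff.1 hζ).le ht

theorem exists_eq_zpow_mul {c : ℝ} (hc : c ∈ Ioc (0 : ℝ) 1) {m : ℤ} {g : ℂ → ℂ}
    (hg : DifferentiableOn ℂ g (ball 0 1 \ {0}))
    (hgi : ∫⁻ ζ, ‖g ζ‖ₑ ^ 2 ∂(diskMeasure (2 * c - 2 - 2 * m)) < ∞) :
    ∃ h : ℂ → ℂ, DifferentiableOn ℂ h (ball 0 1) ∧ Integrable h (diskMeasure (2 * c - 2)) ∧
      ∀ ζ ≠ 0, g ζ = ζ ^ m * h ζ := by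
  have := isFiniteMeasure_diskMeasure (t := 2 * c - 2) (by linarith [hc.1])
  rw [← lintegral_enorm_zpow_mul_sq] at hgi
  have hzpow : DifferentiableOn ℂ (fun ζ : ℂ => ζ ^ (-m)) (ball 0 1 \ {0}) := fun ζ hζ =>
    (differentiableAt_zpow.2 (Or.inl hζ.2)).differentiableWithinAt
  obtain ⟨h, hh, hhg⟩ := exists_differentiableOn_ball_of_lintegral_lt_top (hzpow.fun_mul hg)
    ((setLIntegral_ball_le_lintegral_diskMeasure (by linarith [hc.2]) _).trans_lt hgi)
  have hmeas : AEStronglyMeasurable h (diskMeasure (2 * c - 2)) :=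
    (hh.continuousOn.aestronglyMeasurable measurableSet_ball).mono_ac
      (withDensity_absolutelyContinuous _ _)
  have hL2 : MemLp h 2 (diskMeasure (2 * c - 2)) := by
    refine (memLp_two_iff hmeas).2 (hgi.trans_eq' (lintegral_congr_ae ?_))
    exact (ae_diskMeasure_mem _).mono fun ζ hζ => by simp only [hhg ζ hζ.2]
  refine ⟨h, hh, hL2.integrable (by norm_num), fun ζ hζ => ?_⟩
  rw [hhg ζ hζ, zpow_neg, mul_inv_cancel_left₀ (zpow_ne_zero m hζ)]

theorem norm_rpow_smul_diskKernel_mul (c : ℝ) (m : ℤ) (w : ℂ) {ζ : ℂ} (hζ : ζ ≠ 0) (x : ℂ) :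
    ‖ζ‖ ^ (-2 * m : ℝ) • (diskKernel c m w ζ * (ζ ^ m * x))
      = (π : ℂ)⁻¹ * w ^ m * (symbol c (w * conj ζ) * x) := by
  have hcancel : ((‖ζ‖ ^ (-2 * m : ℝ) : ℝ) : ℂ) * (conj ζ ^ m * ζ ^ m) = 1 := by
    rw [← mul_zpow, Complex.conj_mul', ← Complex.ofReal_pow, ← Complex.ofReal_zpow,
      ← Complex.ofReal_mul, norm_rpow_neg_two_mul_intCast, norm_zpow, ← Complex.ofReal_one,
      zpow_neg, inv_pow, ← zpow_natCast, ← zpow_natCast, ← zpow_mul, ← zpow_mul, mul_comm m,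
      inv_mul_cancel₀ (zpow_ne_zero _ (norm_ne_zero_iff.2 hζ))]
  calc ‖ζ‖ ^ (-2 * m : ℝ) • (diskKernel c m w ζ * (ζ ^ m * x))
      = ((‖ζ‖ ^ (-2 * m : ℝ) : ℝ) : ℂ) * (conj ζ ^ m * ζ ^ m)
          * ((π : ℂ)⁻¹ * w ^ m * (symbol c (w * conj ζ) * x)) := by
        rw [Complex.real_smul, diskKernel, mul_zpow]
        ring
    _ = _ := by rw [hcancel, one_mul]

theorem integral_diskKernel_mul {c : ℝ} (hc : c ∈ Ioc (0 : ℝ) 1) (m : ℤ) {g : ℂ → ℂ}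
    (hg : DifferentiableOn ℂ g (ball 0 1 \ {0}))
    (hgi : ∫⁻ ζ, ‖g ζ‖ₑ ^ 2 ∂(diskMeasure (2 * c - 2 - 2 * m)) < ∞)
    {w : ℂ} (hw : w ∈ ball (0 : ℂ) 1) (hw0 : w ≠ 0) :
    ∫ ζ, diskKernel c m w ζ * g ζ ∂(diskMeasure (2 * c - 2 - 2 * m)) = g w := by
  obtain ⟨h, hh, hhi, hgh⟩ := exists_eq_zpow_mul hc hg hgi
  have hπ : (π : ℂ) ≠ 0 := Complex.ofReal_ne_zero.2 Real.pi_ne_zero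
  have htwist : ∀ᵐ ζ ∂(diskMeasure (2 * c - 2)), ‖ζ‖ ^ (-2 * m : ℝ) • (diskKernel c m w ζ * g ζ)
      = (π : ℂ)⁻¹ * w ^ m * (symbol c (w * conj ζ) * h ζ) :=
    (ae_diskMeasure_mem _).mono fun ζ hζ => by
      rw [hgh ζ hζ.2, norm_rpow_smul_diskKernel_mul c m w hζ.2]
  rw [sub_eq_add_neg, ← neg_mul, integral_diskMeasure_add, integral_congr_ae htwist,
    integral_const_mul, integral_symbol_mul hc hh hhi hw, hgh w hw0]
  field_simp

/-! ### The Hartogs triangle in product coordinates -/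

theorem lintegral_eq_mul_lintegral_mul_right {a : ℂ} (ha : a ≠ 0) {F : ℂ → ℝ≥0∞}
    (hF : Measurable F) : ∫⁻ z, F z = ENNReal.ofReal (‖a‖ ^ 2) * ∫⁻ w, F (w * a) := by
  have hr : 0 < ‖a‖ := norm_pos_iff.2 ha
  have hr0 : (‖a‖ : ℂ) ≠ 0 := Complex.ofReal_ne_zero.2 hr.ne'
  let u : Circle := ⟨a / ‖a‖, by simp [Submonoid.unitSphere, hr.ne']⟩
  have hrot (w : ℂ) : F (w * a) = F (rotation u (‖a‖ • w)) := by
    rw [rotation_apply, Complex.real_smul, ← mul_assoc, div_mul_cancel₀ a hr0, mul_comm]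
  have hscale : ∫⁻ w, F (w * a)
      = ∫⁻ w, F (rotation u w) ∂(Measure.map (‖a‖ • ·) volume) := by
    rw [lintegral_map (f := fun w => F (rotation u w)) (by fun_prop) (by fun_prop)]
    exact lintegral_congr hrot
  rw [hscale, Measure.map_addHaar_smul _ hr.ne', lintegral_smul_measure,
    (rotation u).measurePreserving.lintegral_comp hF, smul_eq_mul, ← mul_assoc,
    Complex.finrank_real_complex, ← ENNReal.ofReal_mul (by positivity),
    abs_of_nonneg (by positivity), mul_inv_cancel₀ (by positivity), ENNReal.ofReal_one, one_mul]

theorem setLIntegral_ball_zero_norm {a : ℂ} (ha : a ≠ 0) {F : ℂ → ℝ≥0∞} (hF : Measurable F) :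
    ∫⁻ z in ball 0 ‖a‖, F z = ENNReal.ofReal (‖a‖ ^ 2) * ∫⁻ w in ball 0 1, F (w * a) := by
  have hball : (fun w => w * a) ⁻¹' ball 0 ‖a‖ = ball 0 1 := by
    ext w
    simpa using mul_lt_iff_lt_one_left (norm_pos_iff.2 ha)
  rw [← lintegral_indicator measurableSet_ball,
    lintegral_eq_mul_lintegral_mul_right ha (hF.indicator measurableSet_ball),
    ← lintegral_indicator measurableSet_ball, ← hball]
  rfl

/-- The space `(ℍ, |z₂|^{s'} dV)`. -/
noncomputable abbrev hartogsMeasure (s' : ℝ) : Measure (ℂ × ℂ) :=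
  weightedVolume hartogsTriangle (hartogsWeight s')

/-- The biholomorphism from `𝔻 × (𝔻 \ {0})` onto the Hartogs triangle. -/
def hartogsMap (w : ℂ × ℂ) : ℂ × ℂ := (w.1 * w.2, w.2)

/-- The inverse of `hartogsMap`, taking the Hartogs triangle to `𝔻 × (𝔻 \ {0})`. -/
noncomputable def hartogsCoord (z : ℂ × ℂ) : ℂ × ℂ := (z.1 / z.2, z.2)

@[fun_prop]
theorem measurable_hartogsMap : Measurable hartogsMap := by unfold hartogsMap; fun_prop

@[fun_prop]
theorem measurable_hartogsCoord : Measurable hartogsCoord := by unfold hartogsCoord; fun_prop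

theorem hartogsCoord_hartogsMap {w : ℂ × ℂ} (hw : w.2 ≠ 0) : hartogsCoord (hartogsMap w) = w := by
  simp [hartogsCoord, hartogsMap, hw]

theorem hartogsMap_hartogsCoord {z : ℂ × ℂ} (hz : z.2 ≠ 0) : hartogsMap (hartogsCoord z) = z := by
  simp [hartogsCoord, hartogsMap, hz]

theorem hartogsCoord_mem {z : ℂ × ℂ} (hz : z ∈ hartogsTriangle) :
    hartogsCoord z ∈ ball (0 : ℂ) 1 ×ˢ (ball (0 : ℂ) 1 \ {0}) := by
  have hpos : 0 < ‖z.2‖ := (norm_nonneg _).trans_lt hz.1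
  refine ⟨?_, mem_ball_zero_iff.2 hz.2, norm_pos_iff.1 hpos⟩
  simpa [hartogsCoord] using (div_lt_one hpos).2 hz.1

theorem hartogsMap_mem {w : ℂ × ℂ} (hw : w ∈ ball (0 : ℂ) 1 ×ˢ (ball (0 : ℂ) 1 \ {0})) :
    hartogsMap w ∈ hartogsTriangle := by
  refine ⟨?_, mem_ball_zero_iff.1 hw.2.1⟩
  simpa [hartogsMap] using
    mul_lt_of_lt_one_left (norm_pos_iff.2 hw.2.2) (mem_ball_zero_iff.1 hw.1)

theorem mk_mem_hartogsTriangle_iff {a b : ℂ} :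
    (a, b) ∈ hartogsTriangle ↔ a ∈ ball (0 : ℂ) ‖b‖ ∧ b ∈ ball (0 : ℂ) 1 := by
  simp [hartogsTriangle]

theorem ae_hartogsMeasure_mem (s' : ℝ) : ∀ᵐ z ∂(hartogsMeasure s'), z ∈ hartogsTriangle :=
  (withDensity_absolutelyContinuous _ _).ae_le
    (ae_restrict_mem isOpen_hartogsTriangle.measurableSet)

theorem lintegral_hartogsMeasure_eq_setLIntegral (s' : ℝ) {F : ℂ × ℂ → ℝ≥0∞}
    (hF : Measurable F) : ∫⁻ z, F z ∂(hartogsMeasure s')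
      = ∫⁻ b in ball 0 1, ENNReal.ofReal (‖b‖ ^ s') * ∫⁻ a in ball 0 ‖b‖, F (a, b) := by
  have hw : Measurable fun z : ℂ × ℂ => ENNReal.ofReal (hartogsWeight s' z) := by
    unfold hartogsWeight; fun_prop
  have hms := isOpen_hartogsTriangle.measurableSet
  rw [hartogsMeasure, weightedVolume, lintegral_withDensity_eq_lintegral_mul _ hw hF,
    ← lintegral_indicator hms, Measure.volume_eq_prod,
    lintegral_prod_symm' _ ((hw.mul hF).indicator hms), ← lintegral_indicator measurableSet_ball]
  refine lintegral_congr fun b => ?_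
  by_cases hb : b ∈ ball (0 : ℂ) 1
  · rw [indicator_of_mem hb, ← lintegral_const_mul' _ _ ENNReal.ofReal_ne_top,
      ← lintegral_indicator measurableSet_ball]
    refine lintegral_congr fun a => indicator_eq_indicator ?_ rfl
    simp only [mk_mem_hartogsTriangle_iff, hb, and_true]
  · simp only [indicator, mk_mem_hartogsTriangle_iff, hb,
      and_false, if_false, lintegral_zero]

theorem lintegral_hartogsMeasure (s' : ℝ) {F : ℂ × ℂ → ℝ≥0∞} (hF : Measurable F) :
    ∫⁻ z, F z ∂(hartogsMeasure s')
      = ∫⁻ b, ∫⁻ a, F (hartogsMap (a, b)) ∂(diskMeasure 0) ∂(diskMeasure (s' + 2)) := by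
  rw [lintegral_hartogsMeasure_eq_setLIntegral s' hF, lintegral_diskMeasure, diskMeasure_zero]
  refine lintegral_congr_ae (ae_restrict_of_ae ?_)
  filter_upwards [Measure.ae_ne volume (0 : ℂ)] with b hb
  rw [setLIntegral_ball_zero_norm hb (F := fun z => F (z, b)) (by fun_prop),
    Real.rpow_add (norm_pos_iff.2 hb), Real.rpow_two, ENNReal.ofReal_mul (by positivity), mul_assoc]
  rfl

theorem measurePreserving_hartogsMap (s' : ℝ) :
    MeasurePreserving hartogsMap ((diskMeasure 0).prod (diskMeasure (s' + 2)))
      (hartogsMeasure s') := by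
  refine ⟨measurable_hartogsMap, Measure.ext_of_lintegral _ fun F hF => ?_⟩
  rw [lintegral_map hF measurable_hartogsMap, lintegral_hartogsMeasure _ hF,
    lintegral_prod_symm' (fun w => F (hartogsMap w)) (hF.comp measurable_hartogsMap)]

theorem ae_prod_diskMeasure_mem (t t' : ℝ) : ∀ᵐ w ∂((diskMeasure t).prod (diskMeasure t')),
    w ∈ (ball (0 : ℂ) 1 \ {0}) ×ˢ (ball (0 : ℂ) 1 \ {0}) := by
  filter_upwards [Measure.quasiMeasurePreserving_fst.ae (ae_diskMeasure_mem t),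
    Measure.quasiMeasurePreserving_snd.ae (ae_diskMeasure_mem t')] with w hw₁ hw₂
  exact ⟨hw₁, hw₂⟩

theorem measurePreserving_hartogsCoord (s' : ℝ) :
    MeasurePreserving hartogsCoord (hartogsMeasure s')
      ((diskMeasure 0).prod (diskMeasure (s' + 2))) := by
  refine ⟨measurable_hartogsCoord, ?_⟩
  have hid : hartogsCoord ∘ hartogsMap =ᵐ[(diskMeasure 0).prod (diskMeasure (s' + 2))] id :=
    (ae_prod_diskMeasure_mem 0 (s' + 2)).mono fun w hw => hartogsCoord_hartogsMap hw.2.2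
  rw [← (measurePreserving_hartogsMap s').map_eq,
    Measure.map_map measurable_hartogsCoord measurable_hartogsMap, Measure.map_congr hid,
    Measure.map_id]

/-! ### The Bergman kernel of the Hartogs triangle -/

theorem memLp_zpow_iff {m : ℤ} {t p : ℝ} (hp : 0 < p) :
    MemLp (fun ζ : ℂ => ζ ^ m) (ENNReal.ofReal p) (diskMeasure t) ↔ -2 < t + p * m := by
  have hmeas : Measurable fun ζ : ℂ => ζ ^ m := measurable_id.pow_const m
  rw [MemLp, and_iff_right hmeas.aestronglyMeasurable,
    eLpNorm_lt_top_iff_lintegral_rpow_enorm_lt_top (by simpa using hp) ENNReal.ofReal_ne_top,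
    ENNReal.toReal_ofReal hp.le, ← lintegral_norm_rpow_lt_top_iff]
  refine iff_of_eq (congrArg (· < ∞) (lintegral_congr fun ζ => ?_))
  rw [← ofReal_norm, ENNReal.ofReal_rpow_of_nonneg (norm_nonneg _) hp.le, norm_zpow,
    ← Real.rpow_intCast, ← Real.rpow_mul (norm_nonneg _), mul_comm]

theorem norm_diskKernel_le_norm_symbol (c : ℝ) (m : ℤ) (w ζ : ℂ) :
    ‖diskKernel c m w ζ‖ ≤ ‖w ^ m‖ * ‖ζ ^ m‖ * ‖symbol c (w * conj ζ)‖ := by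
  have hπ : ‖(π : ℂ)⁻¹‖ ≤ 1 := by
    rw [norm_inv, Complex.norm_of_nonneg Real.pi_pos.le]
    exact inv_le_one_of_one_le₀ (by linarith [Real.pi_gt_three])
  simp only [diskKernel, norm_mul, norm_zpow, mul_zpow, RCLike.norm_conj]
  exact mul_le_mul_of_nonneg_right (mul_le_of_le_one_left (by positivity) hπ) (norm_nonneg _)

theorem norm_diskKernel_le {c : ℝ} (hc : c ∈ Icc (0 : ℝ) 1) (m : ℤ) (w : ℂ) {ζ : ℂ} (hw : ‖w‖ < 1)
    (hζ : ‖ζ‖ ≤ 1) : ‖diskKernel c m w ζ‖ ≤ ‖w ^ m‖ * (1 - ‖w‖)⁻¹ ^ 2 * ‖ζ ^ m‖ := by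
  have hsymbol : ‖symbol c (w * conj ζ)‖ ≤ (1 - ‖w‖)⁻¹ ^ 2 := by
    refine norm_symbol_le_of_norm_le hc ?_ hw
    rw [norm_mul, RCLike.norm_conj]
    exact mul_le_of_le_one_right (norm_nonneg _) hζ
  calc ‖diskKernel c m w ζ‖ ≤ ‖w ^ m‖ * ‖ζ ^ m‖ * ‖symbol c (w * conj ζ)‖ :=
        norm_diskKernel_le_norm_symbol c m w ζ
    _ ≤ ‖w ^ m‖ * ‖ζ ^ m‖ * (1 - ‖w‖)⁻¹ ^ 2 := by gcongr
    _ = ‖w ^ m‖ * (1 - ‖w‖)⁻¹ ^ 2 * ‖ζ ^ m‖ := by ring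

theorem memLp_diskKernel {c : ℝ} (hc : c ∈ Ioc (0 : ℝ) 1) (m : ℤ) {w : ℂ}
    (hw : w ∈ ball (0 : ℂ) 1) :
    MemLp (diskKernel c m w) 2 (diskMeasure (2 * c - 2 - 2 * m)) := by
  have hzpow : MemLp (fun ζ : ℂ => ζ ^ m) 2 (diskMeasure (2 * c - 2 - 2 * m)) := by
    simpa using (memLp_zpow_iff (m := m) (t := 2 * c - 2 - 2 * m) two_pos).2
      (by linarith [hc.1])
  refine hzpow.of_le_mul (c := ‖w ^ m‖ * (1 - ‖w‖)⁻¹ ^ 2)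
    (measurable_diskKernel_right c m w).aestronglyMeasurable ?_
  filter_upwards [ae_diskMeasure_mem (2 * c - 2 - 2 * m)] with ζ hζ
  exact norm_diskKernel_le (Ioc_subset_Icc_self hc) m w (mem_ball_zero_iff.1 hw)
    (mem_ball_zero_iff.1 hζ.1).le

theorem memLp_diskKernel_one_zero {w : ℂ} (hw : w ∈ ball (0 : ℂ) 1) :
    MemLp (diskKernel 1 0 w) 2 (diskMeasure 0) := by
  simpa using memLp_diskKernel (right_mem_Ioc.2 one_pos) 0 hw

theorem diskKernel_conj (c : ℝ) (m : ℤ) (w ζ : ℂ) :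
    conj (diskKernel c m w ζ) = diskKernel c m ζ w := by
  simp only [diskKernel, map_mul, map_inv₀, map_zpow₀, Complex.conj_ofReal, ← symbol_conj,
    Complex.conj_conj, mul_comm (conj w)]

theorem differentiableAt_diskKernel (c : ℝ) {m : ℤ} {w ζ : ℂ} (hw : w ∈ ball (0 : ℂ) 1)
    (hζ : ζ ∈ ball (0 : ℂ) 1) (h : w * conj ζ ≠ 0 ∨ 0 ≤ m) :
    DifferentiableAt ℂ (fun w => diskKernel c m w ζ) w := by
  have hsymbol : DifferentiableAt ℂ (symbol c) (w * conj ζ) :=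
    (differentiableOn_symbol c).differentiableAt
      (isOpen_ball.mem_nhds (mem_ball_zero_iff.2 (norm_mul_conj_lt_one hw hζ)))
  unfold diskKernel
  refine DifferentiableAt.fun_mul (DifferentiableAt.const_mul ?_ _) ?_
  · exact DifferentiableAt.zpow (by fun_prop) h
  · exact hsymbol.comp w (f := fun w => w * conj ζ) (by fun_prop)

/-- The Bergman kernel of the Hartogs triangle with weight `|z₂|^{s'}`, where
`s' + 2 = 2c - 2 - 2m`. The real Jacobian `|w₂|²` of `hartogsMap` is absorbed into the weight, so in
the coordinates `(z₁ / z₂, z₂)` the kernel is a product of disk kernels. -/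
noncomputable def hartogsKernel (c : ℝ) (m : ℤ) (z ζ : ℂ × ℂ) : ℂ :=
  diskKernel 1 0 (hartogsCoord z).1 (hartogsCoord ζ).1 *
    diskKernel c m (hartogsCoord z).2 (hartogsCoord ζ).2

theorem measurable_hartogsKernel (c : ℝ) (m : ℤ) :
    Measurable fun p : (ℂ × ℂ) × (ℂ × ℂ) => hartogsKernel c m p.1 p.2 :=
  ((measurable_diskKernel 1 0).comp
    (f := fun p : (ℂ × ℂ) × (ℂ × ℂ) => ((hartogsCoord p.1).1, (hartogsCoord p.2).1))
    (by fun_prop)).mul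
  ((measurable_diskKernel c m).comp
    (f := fun p : (ℂ × ℂ) × (ℂ × ℂ) => ((hartogsCoord p.1).2, (hartogsCoord p.2).2))
    (by fun_prop))

theorem hartogsKernel_conj (c : ℝ) (m : ℤ) (z ζ : ℂ × ℂ) :
    conj (hartogsKernel c m z ζ) = hartogsKernel c m ζ z := by
  simp only [hartogsKernel, map_mul, diskKernel_conj]

theorem memLp_hartogsKernel {c : ℝ} (hc : c ∈ Ioc (0 : ℝ) 1) {m : ℤ} {s' : ℝ}
    (hs : s' + 2 = 2 * c - 2 - 2 * m) {z : ℂ × ℂ} (hz : z ∈ hartogsTriangle) :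
    MemLp (hartogsKernel c m z) 2 (hartogsMeasure s') := by
  have hprod := memLp_prod_mul two_ne_zero ENNReal.ofNat_ne_top
    (memLp_diskKernel_one_zero (hartogsCoord_mem hz).1)
    (memLp_diskKernel hc m (hartogsCoord_mem hz).2.1)
  rw [← hs] at hprod
  exact hprod.comp_measurePreserving (measurePreserving_hartogsCoord s')

theorem differentiableOn_hartogsKernel (c : ℝ) (m : ℤ) {ζ : ℂ × ℂ} (hζ : ζ ∈ hartogsTriangle) :
    DifferentiableOn ℂ (fun z => hartogsKernel c m z ζ) hartogsTriangle := by
  intro z hz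
  obtain ⟨hz₁, hz₂, hz0⟩ := hartogsCoord_mem hz
  obtain ⟨hζ₁, hζ₂, hζ0⟩ := hartogsCoord_mem hζ
  have hcoord : DifferentiableAt ℂ hartogsCoord z := by
    unfold hartogsCoord
    simp only [div_eq_mul_inv]
    have hz0 : z.2 ≠ 0 := hz0
    exact (differentiableAt_fst.fun_mul (differentiableAt_snd.fun_inv hz0)).prodMk
      differentiableAt_snd
  refine (DifferentiableAt.fun_mul ?_ ?_).differentiableWithinAt
  · exact (differentiableAt_diskKernel 1 hz₁ hζ₁ (.inr le_rfl)).comp z hcoord.fst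
  · exact (differentiableAt_diskKernel c hz₂ hζ₂ (.inl (mul_ne_zero hz0
      ((map_ne_zero _).2 hζ0)))).comp z hcoord.snd

section ReproducingProperty

variable {s' : ℝ} {F : ℂ × ℂ → ℂ}

theorem differentiableOn_comp_hartogsMap_left (hF : DifferentiableOn ℂ F hartogsTriangle) {b : ℂ}
    (hb : b ∈ ball (0 : ℂ) 1 \ {0}) :
    DifferentiableOn ℂ (fun a => F (hartogsMap (a, b))) (ball 0 1) :=
  hF.comp (by unfold hartogsMap; fun_prop) fun _ ha => hartogsMap_mem ⟨ha, hb⟩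

theorem differentiableOn_comp_hartogsMap_right (hF : DifferentiableOn ℂ F hartogsTriangle) {a : ℂ}
    (ha : a ∈ ball (0 : ℂ) 1) :
    DifferentiableOn ℂ (fun b => F (hartogsMap (a, b))) (ball 0 1 \ {0}) :=
  hF.comp (by unfold hartogsMap; fun_prop) fun _ hb => hartogsMap_mem ⟨ha, hb⟩

theorem ae_integrable_comp_hartogsMap (hF : MemLp F 2 (hartogsMeasure s')) :
    ∀ᵐ b ∂(diskMeasure (s' + 2)), Integrable (fun a => F (hartogsMap (a, b))) (diskMeasure 0) := by
  have := isFiniteMeasure_diskMeasure (t := 0) (by norm_num)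
  have hG := hF.comp_measurePreserving (measurePreserving_hartogsMap s')
  have hsq := (memLp_two_iff hG.1).1 hG
  have hmeas : AEMeasurable (fun w => ‖F (hartogsMap w)‖ₑ ^ 2)
      ((diskMeasure 0).prod (diskMeasure (s' + 2))) := hG.1.enorm.pow_const 2
  simp only [Function.comp_apply, lintegral_prod_symm _ hmeas] at hsq
  filter_upwards [ae_lt_top' hmeas.prod_swap.lintegral_prod_right' hsq.ne,
    hG.1.prod_swap.prodMk_left] with b hb hbm
  exact ((memLp_two_iff hbm).2 hb).integrable one_le_two

theorem ae_integral_diskKernel_one_zero_mul_comp_hartogsMap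
    (hF : DifferentiableOn ℂ F hartogsTriangle) (hF2 : MemLp F 2 (hartogsMeasure s')) {w : ℂ}
    (hw : w ∈ ball (0 : ℂ) 1) :
    ∀ᵐ b ∂(diskMeasure (s' + 2)),
      ∫ a, diskKernel 1 0 w a * F (hartogsMap (a, b)) ∂(diskMeasure 0) = F (hartogsMap (w, b)) := by
  filter_upwards [ae_integrable_comp_hartogsMap hF2, ae_diskMeasure_mem (s' + 2)] with b hFb hb
  exact integral_diskKernel_one_zero_mul (differentiableOn_comp_hartogsMap_left hF hb) hFb hw

theorem lintegral_enorm_comp_hartogsMap_sq_lt_top (hF : DifferentiableOn ℂ F hartogsTriangle)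
    (hF2 : MemLp F 2 (hartogsMeasure s')) {w : ℂ} (hw : w ∈ ball (0 : ℂ) 1) :
    ∫⁻ b, ‖F (hartogsMap (w, b))‖ₑ ^ 2 ∂(diskMeasure (s' + 2)) < ∞ := by
  refine lt_of_eq_of_lt (lintegral_congr_ae ?_)
    (lintegral_enorm_integral_mul_sq_lt_top (memLp_diskKernel_one_zero hw)
      (hF2.comp_measurePreserving (measurePreserving_hartogsMap s')))
  filter_upwards [ae_integral_diskKernel_one_zero_mul_comp_hartogsMap hF hF2 hw] with b hb
  rw [← hb]
  rfl

theorem integral_hartogsKernel_mul {c : ℝ} (hc : c ∈ Ioc (0 : ℝ) 1) {m : ℤ}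
    (hs : s' + 2 = 2 * c - 2 - 2 * m) (hF : DifferentiableOn ℂ F hartogsTriangle)
    (hF2 : MemLp F 2 (hartogsMeasure s')) {z : ℂ × ℂ} (hz : z ∈ hartogsTriangle) :
    ∫ ζ, hartogsKernel c m z ζ * F ζ ∂(hartogsMeasure s') = F z := by
  obtain ⟨hz₁, hz₂, hz0⟩ := hartogsCoord_mem hz
  have hΦ := measurePreserving_hartogsMap s'
  have hint : Integrable (fun ζ => hartogsKernel c m z ζ * F ζ) (hartogsMeasure s') :=
    (memLp_hartogsKernel hc hs hz).integrable_mul hF2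
  have hfst : ∀ᵐ b ∂(diskMeasure (s' + 2)),
      ∫ a, hartogsKernel c m z (hartogsMap (a, b)) * F (hartogsMap (a, b)) ∂(diskMeasure 0)
        = diskKernel c m (hartogsCoord z).2 b * F (hartogsMap ((hartogsCoord z).1, b)) := by
    filter_upwards [ae_integral_diskKernel_one_zero_mul_comp_hartogsMap hF hF2 hz₁,
      ae_diskMeasure_mem (s' + 2)] with b hb hbm
    rw [← hb, ← integral_const_mul]
    refine integral_congr_ae (Eventually.of_forall fun a => ?_)
    simp only [hartogsKernel, hartogsCoord_hartogsMap (w := (a, b)) hbm.2]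
    ring
  have hsnd := lintegral_enorm_comp_hartogsMap_sq_lt_top hF hF2 hz₁
  rw [hs] at hsnd
  calc ∫ ζ, hartogsKernel c m z ζ * F ζ ∂(hartogsMeasure s')
      = ∫ b, ∫ a, hartogsKernel c m z (hartogsMap (a, b)) * F (hartogsMap (a, b))
          ∂(diskMeasure 0) ∂(diskMeasure (s' + 2)) := by
        rw [← hΦ.map_eq, integral_map hΦ.measurable.aemeasurable (by rw [hΦ.map_eq]; exact hint.1)]
        exact integral_prod_symm _ ((hΦ.integrable_comp hint.1).2 hint)
    _ = F (hartogsMap (hartogsCoord z)) := by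
        rw [integral_congr_ae hfst, hs]
        exact integral_diskKernel_mul hc m (differentiableOn_comp_hartogsMap_right hF hz₁) hsnd
          hz₂ hz0
    _ = F z := by rw [hartogsMap_hartogsCoord (z := z) hz0]

end ReproducingProperty

theorem integral_conj_mul_eq_zero_of_mem_orthogonal {Ω : Set (ℂ × ℂ)} {μ : ℂ × ℂ → ℝ}
    {g : Lp ℂ 2 (weightedVolume Ω μ)} (hg : g ∈ (bergmanSpace Ω μ)ᗮ) {h : ℂ × ℂ → ℂ}
    (hh : DifferentiableOn ℂ h Ω) (hh2 : MemLp h 2 (weightedVolume Ω μ)) :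
    ∫ z, conj (h z) * g z ∂(weightedVolume Ω μ) = 0 := by
  have hinner := hg _ ⟨h, hh, hh2.coeFn_toLp⟩
  rw [L2.inner_def] at hinner
  rw [← hinner]
  refine integral_congr_ae ?_
  filter_upwards [hh2.coeFn_toLp] with z hz
  rw [hz, RCLike.inner_apply']

theorem bergmanProjection_ae_eq {c : ℝ} (hc : c ∈ Ioc (0 : ℝ) 1) {m : ℤ} {s' : ℝ}
    (hs : s' + 2 = 2 * c - 2 - 2 * m) (f : Lp ℂ 2 (hartogsMeasure s')) :
    bergmanProjection hartogsTriangle (hartogsWeight s') f =ᵐ[hartogsMeasure s']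
      fun z => ∫ ζ, hartogsKernel c m z ζ * f ζ ∂(hartogsMeasure s') := by
  let A := bergmanSpace hartogsTriangle (hartogsWeight s')
  let P := A.starProjection f
  obtain ⟨h, hh, hPh⟩ : P ∈ A := Submodule.starProjection_apply_mem _ _
  have horth : f - P ∈ Aᗮ := Submodule.sub_starProjection_mem_orthogonal _
  filter_upwards [hPh, ae_hartogsMeasure_mem s'] with z hPz hz
  have hK := memLp_hartogsKernel hc hs hz
  have hK' : MemLp (fun ζ => hartogsKernel c m ζ z) 2 (hartogsMeasure s') := by
    simp only [← hartogsKernel_conj c m z]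
    exact hK.star
  have hzero := integral_conj_mul_eq_zero_of_mem_orthogonal horth
    (differentiableOn_hartogsKernel c m hz) hK'
  simp only [hartogsKernel_conj] at hzero
  calc bergmanProjection hartogsTriangle (hartogsWeight s') f z = h z := hPz
    _ = ∫ ζ, hartogsKernel c m z ζ * h ζ ∂(hartogsMeasure s') :=
        (integral_hartogsKernel_mul hc hs hh ((memLp_congr_ae hPh).1 (Lp.memLp P)) hz).symm
    _ = ∫ ζ, hartogsKernel c m z ζ * P ζ ∂(hartogsMeasure s') :=
        integral_congr_ae (hPh.mono fun ζ hζ => by simp only [hζ])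
    _ = ∫ ζ, hartogsKernel c m z ζ * P ζ ∂(hartogsMeasure s')
          + ∫ ζ, hartogsKernel c m z ζ * (f - P : Lp ℂ 2 (hartogsMeasure s')) ζ
              ∂(hartogsMeasure s') := by rw [hzero, add_zero]
    _ = ∫ ζ, hartogsKernel c m z ζ * f ζ ∂(hartogsMeasure s') := by
        refine (integral_add (hK.integrable_mul (Lp.memLp P))
          (hK.integrable_mul (Lp.memLp (f - P)))).symm.trans (integral_congr_ae ?_)
        refine ((Lp.coeFn_sub f P).mono fun ζ hζ => ?_)
        simp only [Pi.mul_apply, hζ, Pi.sub_apply, mul_sub, add_sub_cancel]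

/-! ### Forelli–Rudin estimates and sufficiency -/

theorem setLIntegral_Ioo_one_sub (f : ℝ → ℝ≥0∞) :
    ∫⁻ r in Ioo (0 : ℝ) 1, f (1 - r) = ∫⁻ x in Ioo (0 : ℝ) 1, f x := by
  have hpre : (fun r : ℝ => 1 - r) ⁻¹' Ioo 0 1 = Ioo 0 1 := by simp
  have hpres : MeasurePreserving (fun r : ℝ => 1 - r) volume volume :=
    Measure.measurePreserving_sub_left volume 1
  have hemb : MeasurableEmbedding (fun r : ℝ => 1 - r) :=
    (MeasurableEquiv.subLeft (1 : ℝ)).measurableEmbedding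
  simpa only [hpre] using hpres.setLIntegral_comp_preimage_emb hemb f (Ioo 0 1)

theorem setLIntegral_Ioc_ofReal_rpow {a δ : ℝ} (ha : -1 < a) (hδ : 0 ≤ δ) :
    ∫⁻ x in Ioc 0 δ, ENNReal.ofReal (x ^ a) = ENNReal.ofReal (δ ^ (a + 1) / (a + 1)) := by
  rw [← ofReal_integral_eq_lintegral_ofReal
      (intervalIntegral.intervalIntegrable_rpow' (a := 0) (b := δ) ha).1
      ((ae_restrict_mem measurableSet_Ioc).mono fun x hx => Real.rpow_nonneg hx.1.le _),
    ← intervalIntegral.integral_of_le hδ, integral_rpow (.inl ha),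
    Real.zero_rpow (by linarith), sub_zero]

theorem setLIntegral_Ioi_ofReal_rpow {a δ : ℝ} (ha : a < -1) (hδ : 0 < δ) :
    ∫⁻ x in Ioi δ, ENNReal.ofReal (x ^ a) = ENNReal.ofReal (-δ ^ (a + 1) / (a + 1)) := by
  rw [← ofReal_integral_eq_lintegral_ofReal (integrableOn_Ioi_rpow_of_lt ha hδ)
      ((ae_restrict_mem measurableSet_Ioi).mono fun x hx => Real.rpow_nonneg (hδ.trans hx).le _),
    integral_Ioi_rpow_of_lt ha hδ]

theorem lintegral_rpow_div_max_le {ε δ : ℝ} (hε : ε ∈ Ioo (0 : ℝ) 1) (hδ : 0 < δ) :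
    ∫⁻ x in Ioo (0 : ℝ) 1, ENNReal.ofReal (x ^ (-ε) / max δ x)
      ≤ ENNReal.ofReal ((1 / (1 - ε) + 1 / ε) * δ ^ (-ε)) := by
  obtain ⟨hε0, hε1⟩ := hε
  have : 0 < 1 - ε := by linarith
  have hnear : ∫⁻ x in Ioc 0 δ, ENNReal.ofReal (x ^ (-ε) / max δ x)
      ≤ ENNReal.ofReal (1 / (1 - ε) * δ ^ (-ε)) :=
    calc ∫⁻ x in Ioc 0 δ, ENNReal.ofReal (x ^ (-ε) / max δ x)
        ≤ ∫⁻ x in Ioc 0 δ, ENNReal.ofReal (x ^ (-ε)) * ENNReal.ofReal δ⁻¹ := by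
          refine setLIntegral_mono' measurableSet_Ioc fun x hx => ?_
          have := Real.rpow_nonneg hx.1.le (-ε)
          rw [← ENNReal.ofReal_mul this, ← div_eq_mul_inv]
          gcongr
          exact le_max_left _ _
      _ = ENNReal.ofReal (1 / (1 - ε) * δ ^ (-ε)) := by
          rw [lintegral_mul_const' _ _ ENNReal.ofReal_ne_top,
            setLIntegral_Ioc_ofReal_rpow (by linarith) hδ.le, neg_add_eq_sub,
            ← ENNReal.ofReal_mul (by positivity), Real.rpow_sub hδ, Real.rpow_one,
            Real.rpow_neg hδ.le]
          congr 1
          field_simp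
  have hfar : ∫⁻ x in Ioi δ, ENNReal.ofReal (x ^ (-ε) / max δ x)
      ≤ ENNReal.ofReal (1 / ε * δ ^ (-ε)) :=
    calc ∫⁻ x in Ioi δ, ENNReal.ofReal (x ^ (-ε) / max δ x)
        ≤ ∫⁻ x in Ioi δ, ENNReal.ofReal (x ^ (-ε - 1)) := by
          refine setLIntegral_mono' measurableSet_Ioi fun x hx => le_of_eq ?_
          rw [Real.rpow_sub_one (hδ.trans hx).ne', max_eq_right (le_of_lt hx)]
      _ = ENNReal.ofReal (1 / ε * δ ^ (-ε)) := by
          rw [setLIntegral_Ioi_ofReal_rpow (by linarith) hδ, sub_add_cancel, neg_div_neg_eq,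
            one_div_mul_eq_div]
  have hsplit : Ioo (0 : ℝ) 1 ⊆ Ioc 0 δ ∪ Ioi δ := fun x hx => by
    rw [Ioc_union_Ioi_eq_Ioi hδ.le]
    exact hx.1
  rw [add_mul, ENNReal.ofReal_add (by positivity) (by positivity)]
  exact (lintegral_mono_set hsplit).trans
    ((lintegral_union_le _ _ _).trans (add_le_add hnear hfar))

theorem rpow_mul_one_sub_rpow_div_le {u ε ρ r : ℝ} (hu : 0 < u) (hε : ε ∈ Ioo (0 : ℝ) 1)
    (hρ : ρ ∈ Ico (0 : ℝ) 1) (hr : r ∈ Ioo (0 : ℝ) 1) :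
    r ^ (u - 1) * (1 - r) ^ (-ε) / (1 - ρ ^ 2 * r ^ 2)
      ≤ 4 * r ^ (u - 1) + 2 * ((1 - r) ^ (-ε) / max (1 - ρ) (1 - r)) := by
  obtain ⟨hr0, hr1⟩ := hr
  obtain ⟨hρ0, hρ1⟩ := hρ
  have hε1 := hε.2
  have hr1' : 0 < 1 - r := by linarith
  have hρr : ρ * r ≤ ρ := mul_le_of_le_one_right hρ0 hr1.le
  have hρr' : ρ * r ≤ r := mul_le_of_le_one_left hr0.le hρ1.le
  have hden : max (1 - ρ) (1 - r) ≤ 1 - ρ ^ 2 * r ^ 2 := by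
    refine max_le ?_ ?_ <;> nlinarith [mul_nonneg hρ0 hr0.le]
  have : 0 < max (1 - ρ) (1 - r) := lt_max_of_lt_right hr1'
  -- Away from `1` the factors singular at `1` are bounded, and away from `0` the power is.
  rcases le_total r (1 / 2) with h | h
  · have hpow : (1 - r) ^ (-ε) ≤ 2 :=
      calc (1 - r) ^ (-ε) ≤ (1 - r) ^ (-1 : ℝ) :=
            Real.rpow_le_rpow_of_exponent_ge hr1' (by linarith) (by linarith)
        _ ≤ 2 := by
            rw [Real.rpow_neg_one, inv_le_comm₀ hr1' two_pos]
            linarith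
    have hden' : (1 / 2 : ℝ) ≤ 1 - ρ ^ 2 * r ^ 2 :=
      le_trans (by linarith [le_max_right (1 - ρ) (1 - r)]) hden
    calc r ^ (u - 1) * (1 - r) ^ (-ε) / (1 - ρ ^ 2 * r ^ 2) ≤ r ^ (u - 1) * 2 / (1 / 2) := by
          gcongr
      _ = 4 * r ^ (u - 1) := by ring
      _ ≤ _ := le_add_of_nonneg_right (by positivity)
  · have hpow : r ^ (u - 1) ≤ 2 :=
      calc r ^ (u - 1) ≤ r ^ (-1 : ℝ) :=
            Real.rpow_le_rpow_of_exponent_ge hr0 hr1.le (by linarith)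
        _ ≤ 2 := by
            rw [Real.rpow_neg_one, inv_le_comm₀ hr0 two_pos]
            linarith
    calc r ^ (u - 1) * (1 - r) ^ (-ε) / (1 - ρ ^ 2 * r ^ 2)
        ≤ 2 * (1 - r) ^ (-ε) / max (1 - ρ) (1 - r) := by gcongr
      _ = 2 * ((1 - r) ^ (-ε) / max (1 - ρ) (1 - r)) := mul_div_assoc _ _ _
      _ ≤ _ := le_add_of_nonneg_left (by positivity)

theorem lintegral_forelliRudin_le {u ε ρ : ℝ} (hu : 0 < u) (hε : ε ∈ Ioo (0 : ℝ) 1)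
    (hρ : ρ ∈ Ico (0 : ℝ) 1) :
    ∫⁻ r in Ioo (0 : ℝ) 1, ENNReal.ofReal (r ^ (u - 1) * (1 - r) ^ (-ε) / (1 - ρ ^ 2 * r ^ 2))
      ≤ ENNReal.ofReal (4 / u + 2 * (1 / (1 - ε) + 1 / ε)) * ENNReal.ofReal ((1 - ρ) ^ (-ε)) := by
  have hδ : 0 < 1 - ρ := by linarith [hρ.2]
  have hδ1 : 1 ≤ (1 - ρ) ^ (-ε) :=
    Real.one_le_rpow_of_pos_of_le_one_of_nonpos hδ (by linarith [hρ.1]) (by linarith [hε.1])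
  have hε0 := hε.1
  have hε1 : 0 < 1 - ε := by linarith [hε.2]
  have hpow : ∫⁻ r in Ioo (0 : ℝ) 1, ENNReal.ofReal (r ^ (u - 1)) = ENNReal.ofReal (1 / u) := by
    rw [restrict_Ioo_eq_restrict_Ioc, setLIntegral_Ioc_ofReal_rpow (by linarith) zero_le_one,
      Real.one_rpow, sub_add_cancel]
  have hmax : ∫⁻ r in Ioo (0 : ℝ) 1, ENNReal.ofReal ((1 - r) ^ (-ε) / max (1 - ρ) (1 - r))
      ≤ ENNReal.ofReal ((1 / (1 - ε) + 1 / ε) * (1 - ρ) ^ (-ε)) :=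
    (setLIntegral_Ioo_one_sub fun x => ENNReal.ofReal (x ^ (-ε) / max (1 - ρ) x)).trans_le
      (lintegral_rpow_div_max_le hε hδ)
  calc _ ≤ ∫⁻ r in Ioo (0 : ℝ) 1, (ENNReal.ofReal 4 * ENNReal.ofReal (r ^ (u - 1))
        + ENNReal.ofReal 2 * ENNReal.ofReal ((1 - r) ^ (-ε) / max (1 - ρ) (1 - r))) := by
        refine setLIntegral_mono' measurableSet_Ioo fun r hr => ?_
        rw [← ENNReal.ofReal_mul two_pos.le, ← ENNReal.ofReal_mul four_pos.le]
        exact (ENNReal.ofReal_le_ofReal (rpow_mul_one_sub_rpow_div_le hu hε hρ hr)).trans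
          ENNReal.ofReal_add_le
    _ ≤ ENNReal.ofReal 4 * ENNReal.ofReal (1 / u) + ENNReal.ofReal 2 *
        ENNReal.ofReal ((1 / (1 - ε) + 1 / ε) * (1 - ρ) ^ (-ε)) := by
        rw [lintegral_add_left (by fun_prop), lintegral_const_mul' _ _ ENNReal.ofReal_ne_top,
          lintegral_const_mul' _ _ ENNReal.ofReal_ne_top, hpow]
        gcongr
    _ = ENNReal.ofReal (4 / u + 2 * ((1 / (1 - ε) + 1 / ε) * (1 - ρ) ^ (-ε))) := by
        rw [← ENNReal.ofReal_mul two_pos.le, ← ENNReal.ofReal_mul four_pos.le,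
          ← ENNReal.ofReal_add (by positivity) (by positivity), mul_one_div]
    _ ≤ _ := by
        rw [← ENNReal.ofReal_mul (by positivity)]
        refine ENNReal.ofReal_le_ofReal ?_
        have : 4 / u ≤ 4 / u * (1 - ρ) ^ (-ε) := le_mul_of_one_le_right (by positivity) hδ1
        linarith

/-- The test functions for the Schur test on the disk, singular on the unit circle and at `0`. -/
noncomputable def schurWeight (ε b : ℝ) (w : ℂ) : ℝ≥0∞ :=
  ENNReal.ofReal ((1 - ‖w‖) ^ (-ε) * ‖w‖ ^ (-b))

@[fun_prop]
theorem measurable_schurWeight (ε b : ℝ) : Measurable (schurWeight ε b) := by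
  unfold schurWeight; fun_prop

theorem schurWeight_rpow (ε b : ℝ) {q : ℝ} (hq : 0 ≤ q) {w : ℂ} (hw : w ∈ ball (0 : ℂ) 1) :
    schurWeight ε b w ^ q = schurWeight (ε * q) (b * q) w := by
  have h : 0 ≤ 1 - ‖w‖ := by rw [mem_ball_zero_iff] at hw; linarith
  have hε := Real.rpow_nonneg h (-ε)
  have hb := Real.rpow_nonneg (norm_nonneg w) (-b)
  rw [schurWeight, schurWeight, ENNReal.ofReal_rpow_of_nonneg (mul_nonneg hε hb) hq,
    Real.mul_rpow hε hb, ← Real.rpow_mul h, ← Real.rpow_mul (norm_nonneg w), neg_mul, neg_mul]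

theorem schurWeight_ne_zero (ε b : ℝ) {w : ℂ} (hw : w ∈ ball (0 : ℂ) 1 \ {0}) :
    schurWeight ε b w ≠ 0 := by
  have : 0 < 1 - ‖w‖ := by linarith [mem_ball_zero_iff.1 hw.1]
  have : 0 < ‖w‖ := norm_pos_iff.2 hw.2
  rw [schurWeight, Ne, ENNReal.ofReal_eq_zero, not_le]
  positivity

theorem enorm_diskKernel_le {c : ℝ} (hc : c ∈ Icc (0 : ℝ) 1) {m : ℤ} {b : ℝ} (hb : -m ≤ b)
    {w ζ : ℂ} (hw : w ∈ ball (0 : ℂ) 1 \ {0}) (hζ : ζ ∈ ball (0 : ℂ) 1) :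
    ‖diskKernel c m w ζ‖ₑ
      ≤ ENNReal.ofReal (‖w‖ ^ (-b)) * ENNReal.ofReal (‖ζ‖ ^ (m : ℝ))
        * ‖1 - w * conj ζ‖ₑ⁻¹ ^ 2 := by
  have hlt := norm_mul_conj_lt_one hw.1 hζ
  have hpos : 0 < ‖1 - w * conj ζ‖ := norm_pos_iff.2 (one_sub_ne_zero_of_norm_lt_one hlt)
  have hpow : ‖w ^ m‖ ≤ ‖w‖ ^ (-b) := by
    rw [norm_zpow, ← Real.rpow_intCast]
    exact Real.rpow_le_rpow_of_exponent_ge (norm_pos_iff.2 hw.2) (mem_ball_zero_iff.1 hw.1).le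
      (by linarith)
  rw [← ofReal_norm, ← ofReal_norm, ← ENNReal.ofReal_inv_of_pos hpos,
    ← ENNReal.ofReal_pow (by positivity), ← ENNReal.ofReal_mul (by positivity),
    ← ENNReal.ofReal_mul (by positivity), Real.rpow_intCast, ← norm_zpow]
  refine ENNReal.ofReal_le_ofReal ((norm_diskKernel_le_norm_symbol c m w ζ).trans ?_)
  gcongr
  exact norm_symbol_le hc hlt.le

theorem lintegral_radialMeasure_schurWeight (x t m ε b : ℝ) :
    ∫⁻ r, ENNReal.ofReal (r ^ m * ((1 - r) ^ (-ε) * r ^ (-b)))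
        * ENNReal.ofReal (2 * π / (1 - x ^ 2 * r ^ 2)) ∂(radialMeasure t)
      = ENNReal.ofReal (2 * π) * ∫⁻ r in Ioo (0 : ℝ) 1,
          ENNReal.ofReal (r ^ (t + m - b + 1) * (1 - r) ^ (-ε) / (1 - x ^ 2 * r ^ 2)) := by
  rw [lintegral_radialMeasure, ← lintegral_const_mul' _ _ ENNReal.ofReal_ne_top]
  refine setLIntegral_congr_fun measurableSet_Ioo fun r hr => ?_
  have : 0 < 1 - r := by linarith [hr.2]
  have := hr.1
  rw [← ENNReal.ofReal_mul (by positivity), ← ENNReal.ofReal_mul (by positivity),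
    ← ENNReal.ofReal_mul (by positivity), show t + m - b + 1 = (t + 1) + m + -b by ring,
    Real.rpow_add hr.1 (t + 1 + m), Real.rpow_add hr.1 (t + 1)]
  ring_nf

theorem lintegral_diskKernel_mul_schurWeight_le {c : ℝ} (hc : c ∈ Ioc (0 : ℝ) 1) {m : ℤ}
    {ε b : ℝ} (hε : ε ∈ Ioo (0 : ℝ) 1) (hb : b ∈ Ico (-m : ℝ) (2 * c - m)) :
    ∃ C : ℝ≥0, ∀ w ∈ ball (0 : ℂ) 1 \ {0},
      ∫⁻ ζ, ‖diskKernel c m w ζ‖ₑ * schurWeight ε b ζ ∂(diskMeasure (2 * c - 2 - 2 * m))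
        ≤ C * schurWeight ε b w := by
  let t := 2 * c - 2 - 2 * m
  let u := 2 * c - m - b
  have hu : 0 < u := by linarith [hb.2]
  let φ : ℝ → ℝ≥0∞ := fun r => ENNReal.ofReal (r ^ (m : ℝ) * ((1 - r) ^ (-ε) * r ^ (-b)))
  have hφ : Measurable φ := by fun_prop
  refine ⟨Real.toNNReal (2 * π) * Real.toNNReal (4 / u + 2 * (1 / (1 - ε) + 1 / ε)),
    fun w hw => ?_⟩
  have hw1 : ‖w‖ < 1 := mem_ball_zero_iff.1 hw.1
  calc ∫⁻ ζ, ‖diskKernel c m w ζ‖ₑ * schurWeight ε b ζ ∂(diskMeasure t)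
      ≤ ∫⁻ ζ, ENNReal.ofReal (‖w‖ ^ (-b)) * (φ ‖ζ‖ * ‖1 - w * conj ζ‖ₑ⁻¹ ^ 2)
          ∂(diskMeasure t) := by
        refine lintegral_mono_ae ?_
        filter_upwards [ae_diskMeasure_mem t] with ζ hζ
        refine (mul_le_mul_left
          (enorm_diskKernel_le (Ioc_subset_Icc_self hc) hb.1 hw hζ.1) _).trans_eq ?_
        simp only [φ, schurWeight]
        rw [ENNReal.ofReal_mul (p := ‖ζ‖ ^ (m : ℝ)) (by positivity)]
        ring
    _ = ENNReal.ofReal (‖w‖ ^ (-b)) * (ENNReal.ofReal (2 * π) * ∫⁻ r in Ioo (0 : ℝ) 1,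
          ENNReal.ofReal (r ^ (u - 1) * (1 - r) ^ (-ε) / (1 - ‖w‖ ^ 2 * r ^ 2))) := by
        rw [lintegral_const_mul' _ _ ENNReal.ofReal_ne_top,
          lintegral_diskMeasure_radial_mul_enorm_one_sub _ hφ hw1.le,
          lintegral_radialMeasure_schurWeight,
          show t + m - b + 1 = u - 1 by ring]
    _ ≤ ENNReal.ofReal (‖w‖ ^ (-b)) * (ENNReal.ofReal (2 * π) *
          (ENNReal.ofReal (4 / u + 2 * (1 / (1 - ε) + 1 / ε))
            * ENNReal.ofReal ((1 - ‖w‖) ^ (-ε)))) := by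
        gcongr
        exact lintegral_forelliRudin_le hu hε ⟨norm_nonneg w, hw1⟩
    _ = _ := by
        have : 0 ≤ (1 - ‖w‖) ^ (-ε) := Real.rpow_nonneg (by linarith) _
        rw [schurWeight, ENNReal.ofReal_mul this, ENNReal.coe_mul]
        simp only [ENNReal.ofReal]
        ring

instance (s' : ℝ) : SFinite (hartogsMeasure s') := by
  rw [← (measurePreserving_hartogsMap s').map_eq]
  infer_instance

/-- The test functions for the Schur test on the Hartogs triangle. -/
noncomputable def hartogsSchurWeight (ε b : ℝ) (z : ℂ × ℂ) : ℝ≥0∞ :=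
  schurWeight ε 0 (hartogsCoord z).1 * schurWeight ε b (hartogsCoord z).2

@[fun_prop]
theorem measurable_hartogsSchurWeight (ε b : ℝ) : Measurable (hartogsSchurWeight ε b) := by
  unfold hartogsSchurWeight; fun_prop

theorem ae_hartogsCoord_mem (s' : ℝ) : ∀ᵐ z ∂(hartogsMeasure s'),
    hartogsCoord z ∈ (ball (0 : ℂ) 1 \ {0}) ×ˢ (ball (0 : ℂ) 1 \ {0}) :=
  (measurePreserving_hartogsCoord s').quasiMeasurePreserving.ae (ae_prod_diskMeasure_mem 0 (s' + 2))

theorem hartogsSchurWeight_rpow (ε b : ℝ) {q : ℝ} (hq : 0 ≤ q) {z : ℂ × ℂ}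
    (hz : hartogsCoord z ∈ ball (0 : ℂ) 1 ×ˢ ball (0 : ℂ) 1) :
    hartogsSchurWeight ε b z ^ q = hartogsSchurWeight (ε * q) (b * q) z := by
  rw [hartogsSchurWeight, hartogsSchurWeight, ENNReal.mul_rpow_of_nonneg _ _ hq,
    schurWeight_rpow _ _ hq hz.1, schurWeight_rpow _ _ hq hz.2, zero_mul]

theorem lintegral_hartogsKernel_mul_hartogsSchurWeight_le {c : ℝ} (hc : c ∈ Ioc (0 : ℝ) 1)
    {m : ℤ} {s' : ℝ} (hs : s' + 2 = 2 * c - 2 - 2 * m) {ε b : ℝ} (hε : ε ∈ Ioo (0 : ℝ) 1)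
    (hb : b ∈ Ico (-m : ℝ) (2 * c - m)) :
    ∃ C : ℝ≥0, ∀ᵐ z ∂(hartogsMeasure s'),
      ∫⁻ ζ, ‖hartogsKernel c m z ζ‖ₑ * hartogsSchurWeight ε b ζ ∂(hartogsMeasure s')
        ≤ C * hartogsSchurWeight ε b z := by
  obtain ⟨C, hC⟩ := lintegral_diskKernel_mul_schurWeight_le hc hε hb
  obtain ⟨D, hD⟩ := lintegral_diskKernel_mul_schurWeight_le (right_mem_Ioc.2 one_pos) (m := 0)
    (b := 0) hε (by norm_num)
  norm_num at hD
  refine ⟨D * C, ?_⟩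
  filter_upwards [ae_hartogsCoord_mem s'] with z hz
  let k₁ : ℂ → ℝ≥0∞ := fun a => ‖diskKernel 1 0 (hartogsCoord z).1 a‖ₑ * schurWeight ε 0 a
  let k₂ : ℂ → ℝ≥0∞ := fun b' => ‖diskKernel c m (hartogsCoord z).2 b'‖ₑ * schurWeight ε b b'
  have hk₁ : Measurable k₁ :=
    (measurable_diskKernel_right 1 0 _).enorm.mul (measurable_schurWeight _ _)
  have hk₂ : Measurable k₂ :=
    (measurable_diskKernel_right c m _).enorm.mul (measurable_schurWeight _ _)
  calc ∫⁻ ζ, ‖hartogsKernel c m z ζ‖ₑ * hartogsSchurWeight ε b ζ ∂(hartogsMeasure s')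
      = ∫⁻ ζ, k₁ (hartogsCoord ζ).1 * k₂ (hartogsCoord ζ).2 ∂(hartogsMeasure s') := by
        refine lintegral_congr fun ζ => ?_
        simp only [hartogsKernel, hartogsSchurWeight, enorm_mul, k₁, k₂]
        ring
    _ = (∫⁻ a, k₁ a ∂(diskMeasure 0)) * ∫⁻ b', k₂ b' ∂(diskMeasure (s' + 2)) := by
        rw [(measurePreserving_hartogsCoord s').lintegral_comp
          (f := fun w : ℂ × ℂ => k₁ w.1 * k₂ w.2) (by fun_prop),
          lintegral_prod_mul hk₁.aemeasurable hk₂.aemeasurable]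
    _ ≤ (D * schurWeight ε 0 (hartogsCoord z).1) * (C * schurWeight ε b (hartogsCoord z).2) := by
        rw [hs]
        exact mul_le_mul' (hD _ (mem_ball_zero_iff.1 hz.1.1) hz.1.2) (hC _ hz.2)
    _ = _ := by
        rw [hartogsSchurWeight, ENNReal.coe_mul]
        ring

theorem lintegral_hartogsKernel_mul_hartogsSchurWeight_rpow_le {c : ℝ} (hc : c ∈ Ioc (0 : ℝ) 1)
    {m : ℤ} {s' : ℝ} (hs : s' + 2 = 2 * c - 2 - 2 * m) {ε b q : ℝ} (hq : 0 ≤ q)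
    (hε : ε * q ∈ Ioo (0 : ℝ) 1) (hb : b * q ∈ Ico (-m : ℝ) (2 * c - m)) :
    ∃ C : ℝ≥0, ∀ᵐ z ∂(hartogsMeasure s'),
      ∫⁻ ζ, ‖hartogsKernel c m z ζ‖ₑ * hartogsSchurWeight ε b ζ ^ q ∂(hartogsMeasure s')
        ≤ C * hartogsSchurWeight ε b z ^ q := by
  have hpow : ∀ᵐ z ∂(hartogsMeasure s'),
      hartogsSchurWeight ε b z ^ q = hartogsSchurWeight (ε * q) (b * q) z :=
    (ae_hartogsCoord_mem s').mono fun z hz =>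
      hartogsSchurWeight_rpow ε b hq (prod_mono sdiff_subset sdiff_subset hz)
  obtain ⟨C, hC⟩ := lintegral_hartogsKernel_mul_hartogsSchurWeight_le hc hs hε hb
  refine ⟨C, ?_⟩
  filter_upwards [hC, hpow] with z hCz hz
  rw [hz]
  exact (lintegral_congr_ae (hpow.mono fun ζ hζ => by simp only [hζ])).trans_le hCz

theorem exists_schur_exponent {p q c m : ℝ} (hpq : p.HolderConjugate q) (hc : 0 < c)
    (hp : 0 < m * p + (2 * c - 2 * m)) (hq : 0 < m * q + (2 * c - 2 * m)) :
    ∃ b : ℝ, b * p ∈ Ico (-m) (2 * c - m) ∧ b * q ∈ Ico (-m) (2 * c - m) := by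
  have hp0 := hpq.pos
  have hq0 := hpq.symm.pos
  refine ⟨max (-m / p) (-m / q), ?_, ?_⟩
  · rw [max_mul_of_nonneg _ _ hp0.le, div_mul_cancel₀ _ hp0.ne', div_mul_eq_mul_div,
      mul_div_assoc, hpq.div_conj_eq_sub_one]
    exact ⟨le_max_left _ _, max_lt (by linarith) (by linarith)⟩
  · rw [max_mul_of_nonneg _ _ hq0.le, div_mul_cancel₀ _ hq0.ne', div_mul_eq_mul_div,
      mul_div_assoc, hpq.symm.div_conj_eq_sub_one]
    exact ⟨le_max_right _ _, max_lt (by linarith) (by linarith)⟩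

theorem bergmanProjectionLpBounded_of_lt {c : ℝ} (hc : c ∈ Ioc (0 : ℝ) 1) {m : ℤ} {s' : ℝ}
    (hs : s' + 2 = 2 * c - 2 - 2 * m) {p q : ℝ} (hpq : p.HolderConjugate q)
    (hp : 0 < m * p + (2 * c - 2 * m)) (hq : 0 < m * q + (2 * c - 2 * m)) :
    BergmanProjectionLpBounded hartogsTriangle (hartogsWeight s') p := by
  have hp0 := hpq.pos
  have hq0 := hpq.symm.pos
  obtain ⟨b, hbp, hbq⟩ := exists_schur_exponent hpq hc.1 hp hq
  let ε := 1 / (p * q)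
  have hεp : ε * p = q⁻¹ := by simp only [ε]; field_simp
  have hεq : ε * q = p⁻¹ := by simp only [ε]; field_simp
  obtain ⟨C, hC⟩ := lintegral_hartogsKernel_mul_hartogsSchurWeight_rpow_le hc hs hq0.le
    (ε := ε) (hεq ▸ ⟨inv_pos.2 hp0, inv_lt_one_of_one_lt₀ hpq.lt⟩) hbq
  obtain ⟨D, hD⟩ := lintegral_hartogsKernel_mul_hartogsSchurWeight_rpow_le hc hs hp0.le
    (ε := ε) (hεp ▸ ⟨inv_pos.2 hq0, inv_lt_one_of_one_lt₀ hpq.symm.lt⟩) hbp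
  have hweight : ∀ᵐ z ∂(hartogsMeasure s'),
      hartogsSchurWeight ε b z ≠ 0 ∧ hartogsSchurWeight ε b z ≠ ∞ := by
    filter_upwards [ae_hartogsCoord_mem s'] with z hz
    exact ⟨mul_ne_zero (schurWeight_ne_zero _ _ hz.1) (schurWeight_ne_zero _ _ hz.2),
      ENNReal.mul_ne_top ENNReal.ofReal_ne_top ENNReal.ofReal_ne_top⟩
  refine ⟨C ^ (1 / q) * D ^ (1 / p), fun f _ => ?_⟩
  rw [eLpNorm_congr_ae (bergmanProjection_ae_eq hc hs f), ENNReal.coe_mul,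
    ENNReal.coe_rpow_of_nonneg _ (by positivity), ENNReal.coe_rpow_of_nonneg _ (by positivity)]
  refine eLpNorm_integral_mul_le_of_schur hpq (measurable_hartogsKernel c m)
    (measurable_hartogsSchurWeight ε b) (measurable_hartogsSchurWeight ε b) hweight hC ?_
    (Lp.aestronglyMeasurable f)
  exact hD.mono fun ζ hζ =>
    (lintegral_congr fun z => by rw [← hartogsKernel_conj, RCLike.enorm_conj]).trans_le hζ

/-! ### Tensor products of test functions -/

/-- The integral operator on `(𝔻, |ζ|^t dV)` with kernel `diskKernel c m`, one of the two factors of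
the weighted Bergman projection in the coordinates `hartogsCoord`. -/
noncomputable def diskOperator (c : ℝ) (m : ℤ) (t : ℝ) (F : ℂ → ℂ) (w : ℂ) : ℂ :=
  ∫ ζ, diskKernel c m w ζ * F ζ ∂(diskMeasure t)

theorem aestronglyMeasurable_diskOperator (c : ℝ) (m : ℤ) {t t' : ℝ} {F : ℂ → ℂ}
    (hF : AEStronglyMeasurable F (diskMeasure t)) :
    AEStronglyMeasurable (diskOperator c m t F) (diskMeasure t') :=
  ((measurable_diskKernel c m).aestronglyMeasurable.mul hF.comp_snd).integral_prod_right'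

theorem integral_hartogsKernel_mul_tensor {c : ℝ} {m : ℤ} {s' : ℝ} {F G : ℂ → ℂ}
    (hF : AEStronglyMeasurable F (diskMeasure 0))
    (hG : AEStronglyMeasurable G (diskMeasure (s' + 2))) (z : ℂ × ℂ) :
    ∫ ζ, hartogsKernel c m z ζ * (F (hartogsCoord ζ).1 * G (hartogsCoord ζ).2)
        ∂(hartogsMeasure s')
      = diskOperator 1 0 0 F (hartogsCoord z).1 *
        diskOperator c m (s' + 2) G (hartogsCoord z).2 := by
  have hΨ := measurePreserving_hartogsCoord s'
  have hprod : AEStronglyMeasurable (fun w : ℂ × ℂ => diskKernel 1 0 (hartogsCoord z).1 w.1 * F w.1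
      * (diskKernel c m (hartogsCoord z).2 w.2 * G w.2))
      (Measure.map hartogsCoord (hartogsMeasure s')) := by
    rw [hΨ.map_eq]
    exact ((measurable_diskKernel_right 1 0 _).aestronglyMeasurable.mul hF).comp_fst.mul
      ((measurable_diskKernel_right c m _).aestronglyMeasurable.mul hG).comp_snd
  rw [diskOperator, diskOperator, ← integral_prod_mul, ← hΨ.map_eq,
    integral_map hΨ.measurable.aemeasurable hprod]
  refine integral_congr_ae (.of_forall fun ζ => ?_)
  simp only [hartogsKernel]
  ring

theorem eLpNorm_diskOperator_mul_le_of_bounded {c : ℝ} (hc : c ∈ Ioc (0 : ℝ) 1) {m : ℤ} {s' : ℝ}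
    (hs : s' + 2 = 2 * c - 2 - 2 * m) {p : ℝ} (hp : 0 < p)
    (hB : BergmanProjectionLpBounded hartogsTriangle (hartogsWeight s') p) :
    ∃ C : ℝ≥0, ∀ F G : ℂ → ℂ, MemLp F 2 (diskMeasure 0) → MemLp G 2 (diskMeasure (s' + 2)) →
      MemLp F (ENNReal.ofReal p) (diskMeasure 0) →
      MemLp G (ENNReal.ofReal p) (diskMeasure (s' + 2)) →
      eLpNorm (diskOperator 1 0 0 F) (ENNReal.ofReal p) (diskMeasure 0)
        * eLpNorm (diskOperator c m (s' + 2) G) (ENNReal.ofReal p) (diskMeasure (s' + 2))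
        ≤ C * (eLpNorm F (ENNReal.ofReal p) (diskMeasure 0)
          * eLpNorm G (ENNReal.ofReal p) (diskMeasure (s' + 2))) := by
  obtain ⟨C, hC⟩ := hB
  refine ⟨C, fun F G hF₂ hG₂ hF hG => ?_⟩
  have hΨ := measurePreserving_hartogsCoord s'
  have hp0 : ENNReal.ofReal p ≠ 0 := by simpa using hp
  have hpt : ENNReal.ofReal p ≠ ∞ := ENNReal.ofReal_ne_top
  have hf₂ := (memLp_prod_mul two_ne_zero ENNReal.ofNat_ne_top hF₂ hG₂).comp_measurePreserving hΨ
  have hf := (memLp_prod_mul hp0 hpt hF hG).comp_measurePreserving hΨ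
  have hle := hC (hf₂.toLp _) ((memLp_congr_ae hf₂.coeFn_toLp).2 hf)
  have hproj : bergmanProjection hartogsTriangle (hartogsWeight s') (hf₂.toLp _)
      =ᵐ[hartogsMeasure s']
        (fun w => diskOperator 1 0 0 F w.1 * diskOperator c m (s' + 2) G w.2) ∘ hartogsCoord := by
    refine (bergmanProjection_ae_eq hc hs _).trans (.of_forall fun z => ?_)
    refine (integral_congr_ae ?_).trans (integral_hartogsKernel_mul_tensor hF.1 hG.1 z)
    filter_upwards [hf₂.coeFn_toLp] with ζ hζ
    rw [hζ, Function.comp_apply]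
  have hTF := aestronglyMeasurable_diskOperator 1 0 (t' := 0) hF.1
  have hTG := aestronglyMeasurable_diskOperator c m (t' := s' + 2) hG.1
  rwa [eLpNorm_congr_ae hproj, eLpNorm_congr_ae hf₂.coeFn_toLp,
    eLpNorm_comp_measurePreserving (hTF.comp_fst.fun_mul hTG.comp_snd) hΨ,
    eLpNorm_comp_measurePreserving (hF.1.comp_fst.fun_mul hG.1.comp_snd) hΨ,
    eLpNorm_prod_mul hTF hTG hp0 hpt, eLpNorm_prod_mul hF.1 hG.1 hp0 hpt] at hle

/-! ### Necessity of the integrability conditions -/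

theorem measurableSet_lt_norm (δ : ℝ) : MeasurableSet {ζ : ℂ | δ < ‖ζ‖} :=
  measurableSet_lt measurable_const measurable_norm

/-- The integral of `|ζ|^e` against `|ζ|^t dV` over the annulus `δ < |ζ| < 1`. -/
noncomputable def annulusMoment (t e δ : ℝ) : ℝ≥0∞ :=
  ∫⁻ ζ in {ζ | δ < ‖ζ‖}, ENNReal.ofReal (‖ζ‖ ^ e) ∂(diskMeasure t)

theorem annulusMoment_ne_top (t e : ℝ) {δ : ℝ} (hδ : 0 < δ) : annulusMoment t e δ ≠ ∞ := by
  have hle : ∀ ζ ∈ {ζ : ℂ | δ < ‖ζ‖}, ENNReal.ofReal (‖ζ‖ ^ e) ≤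
      ENNReal.ofReal (δ ^ (e - max e (-t))) * ENNReal.ofReal (‖ζ‖ ^ max e (-t)) := fun ζ hζ => by
    have hζ0 : 0 < ‖ζ‖ := hδ.trans hζ
    rw [← ENNReal.ofReal_mul (by positivity)]
    refine ENNReal.ofReal_le_ofReal ?_
    calc ‖ζ‖ ^ e = ‖ζ‖ ^ (e - max e (-t)) * ‖ζ‖ ^ max e (-t) := by
          rw [← Real.rpow_add hζ0, sub_add_cancel]
      _ ≤ δ ^ (e - max e (-t)) * ‖ζ‖ ^ max e (-t) := by
          refine mul_le_mul_of_nonneg_right ?_ (by positivity)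
          exact Real.rpow_le_rpow_of_nonpos hδ (le_of_lt hζ) (sub_nonpos.2 (le_max_left _ _))
  refine ne_top_of_le_ne_top ?_ ((setLIntegral_mono' (measurableSet_lt_norm δ) hle).trans
    (setLIntegral_le_lintegral _ _))
  rw [lintegral_const_mul' _ _ ENNReal.ofReal_ne_top]
  refine ENNReal.mul_ne_top ENNReal.ofReal_ne_top (lintegral_norm_rpow_lt_top_iff.2 ?_).ne
  linarith [le_max_right e (-t)]

theorem annulusMoment_pos (t e : ℝ) {δ : ℝ} (hδ : δ ∈ Ioo (0 : ℝ) 1) : 0 < annulusMoment t e δ := by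
  have hradial : annulusMoment t e δ
      = ∫⁻ ζ, (Ioi δ).indicator (fun r => ENNReal.ofReal (r ^ e)) ‖ζ‖ ∂(diskMeasure t) := by
    rw [annulusMoment, ← lintegral_indicator (measurableSet_lt_norm δ)]
    rfl
  have hmeas : Measurable ((Ioi δ).indicator fun r : ℝ => ENNReal.ofReal (r ^ e)) :=
    Measurable.indicator (by fun_prop) measurableSet_Ioi
  rw [hradial, lintegral_diskMeasure_radial t hmeas]
  refine ENNReal.mul_pos (by simp [Real.pi_pos]) (ne_of_gt ?_)
  rw [setLIntegral_pos_iff (by fun_prop)]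
  refine lt_of_lt_of_le ?_ (measure_mono (s := Ioo δ 1) fun r hr => ?_)
  · simpa using hδ.2
  · have hr0 : 0 < r := hδ.1.trans hr.1
    refine ⟨?_, hr0, hr.2⟩
    rw [Function.mem_support, indicator_of_mem (mem_Ioi.2 hr.1)]
    simp [Real.rpow_pos_of_pos hr0]

theorem lintegral_norm_rpow_le_of_annulusMoment_le {t e : ℝ} {M : ℝ≥0∞}
    (hM : ∀ δ ∈ Ioo (0 : ℝ) 1, annulusMoment t e δ ≤ M) :
    ∫⁻ ζ, ENNReal.ofReal (‖ζ‖ ^ e) ∂(diskMeasure t) ≤ M := by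
  have hcover : AECover (diskMeasure t) (𝓝[>] (0 : ℝ)) fun δ => {ζ : ℂ | δ < ‖ζ‖} := by
    refine ⟨?_, measurableSet_lt_norm⟩
    filter_upwards [ae_diskMeasure_mem t] with ζ hζ
    exact mem_nhdsWithin_of_mem_nhds (Iio_mem_nhds (norm_pos_iff.2 hζ.2))
  refine le_of_tendsto (hcover.lintegral_tendsto_of_countably_generated (by fun_prop)) ?_
  filter_upwards [Ioo_mem_nhdsGT one_pos] with δ hδ using hM δ hδ

theorem diskMeasure_ne_zero (t : ℝ) : diskMeasure t ≠ 0 := fun h => by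
  have hpos := annulusMoment_pos t 0 (δ := 1 / 2) ⟨by norm_num, by norm_num⟩
  simp [annulusMoment, h] at hpos

theorem eLpNorm_diskMeasure_ne_zero {t : ℝ} {f : ℂ → ℂ} (hf : Measurable f)
    (hne : ∀ ζ ≠ 0, f ζ ≠ 0) {p : ℝ≥0∞} (hp : p ≠ 0) : eLpNorm f p (diskMeasure t) ≠ 0 := by
  rw [Ne, eLpNorm_eq_zero_iff hf.aestronglyMeasurable hp]
  intro hzero
  have : (ae (diskMeasure t)).NeBot := ae_neBot.2 (diskMeasure_ne_zero t)
  obtain ⟨ζ, hζ, hmem⟩ := (hzero.and (ae_diskMeasure_mem t)).exists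
  exact hne ζ hmem.2 hζ

theorem eLpNorm_zpow_ne_zero (m : ℤ) (t : ℝ) {p : ℝ≥0∞} (hp : p ≠ 0) :
    eLpNorm (fun ζ : ℂ => ζ ^ m) p (diskMeasure t) ≠ 0 :=
  eLpNorm_diskMeasure_ne_zero (measurable_id.pow_const m) (fun _ => zpow_ne_zero m) hp

/-- The function `ζ^m |ζ|^τ`, cut off near the origin so that it lies in every `L^p`. -/
noncomputable def cutoffPower (m : ℤ) (τ δ : ℝ) : ℂ → ℂ :=
  {ζ : ℂ | δ < ‖ζ‖}.indicator fun ζ => ζ ^ m * (‖ζ‖ ^ τ : ℝ)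

theorem measurable_cutoffPower (m : ℤ) (τ δ : ℝ) : Measurable (cutoffPower m τ δ) :=
  ((measurable_id.pow_const m).mul (Complex.measurable_ofReal.comp
    (measurable_norm.pow_const τ))).indicator (measurableSet_lt_norm δ)

theorem eLpNorm_cutoffPower (m : ℤ) (τ t : ℝ) {δ : ℝ} (hδ : 0 < δ) {p : ℝ} (hp : 0 < p) :
    eLpNorm (cutoffPower m τ δ) (ENNReal.ofReal p) (diskMeasure t)
      = annulusMoment t ((m + τ) * p) δ ^ (1 / p) := by
  rw [cutoffPower, eLpNorm_indicator_eq_eLpNorm_restrict (measurableSet_lt_norm δ),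
    eLpNorm_eq_lintegral_rpow_enorm_toReal (by simpa using hp) ENNReal.ofReal_ne_top,
    ENNReal.toReal_ofReal hp.le, annulusMoment]
  congr 1
  refine setLIntegral_congr_fun (measurableSet_lt_norm δ) fun ζ hζ => ?_
  have hζ0 : 0 < ‖ζ‖ := hδ.trans hζ
  change ‖ζ ^ m * (‖ζ‖ ^ τ : ℝ)‖ₑ ^ p = ENNReal.ofReal (‖ζ‖ ^ ((m + τ) * p))
  rw [← ofReal_norm, ENNReal.ofReal_rpow_of_nonneg (norm_nonneg _) hp.le, norm_mul, norm_zpow,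
    Complex.norm_of_nonneg (by positivity), ← Real.rpow_intCast, ← Real.rpow_add hζ0,
    ← Real.rpow_mul hζ0.le]

theorem memLp_cutoffPower (m : ℤ) (τ t : ℝ) {δ : ℝ} (hδ : 0 < δ) {p : ℝ} (hp : 0 < p) :
    MemLp (cutoffPower m τ δ) (ENNReal.ofReal p) (diskMeasure t) := by
  refine ⟨(measurable_cutoffPower m τ δ).aestronglyMeasurable, ?_⟩
  rw [eLpNorm_cutoffPower m τ t hδ hp]
  exact ENNReal.rpow_lt_top_of_nonneg (by positivity) (annulusMoment_ne_top _ _ hδ)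

theorem integral_symbol_mul_radial {c : ℝ} (hc : c ∈ Icc (0 : ℝ) 1) {t : ℝ} {φ : ℂ → ℝ}
    (hφ : Integrable φ (diskMeasure t)) (hrad : ∀ ζ, φ ζ = φ ‖ζ‖) {w : ℂ}
    (hw : w ∈ ball (0 : ℂ) 1) :
    ∫ ζ, symbol c (w * conj ζ) * φ ζ ∂(diskMeasure t) = c * ∫ ζ, φ ζ ∂(diskMeasure t) := by
  have hconj : ∀ ζ, symbol c (w * conj ζ) * φ ζ = conj (φ ζ * symbol c (conj w * ζ)) := fun ζ => by
    rw [map_mul, Complex.conj_ofReal, ← symbol_conj, map_mul, Complex.conj_conj, mul_comm]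
  have hdiff : DifferentiableOn ℂ (fun ζ => symbol c (conj w * ζ)) (ball 0 1) := by
    refine (differentiableOn_symbol c).comp (by fun_prop) fun ζ hζ => ?_
    have hw' : conj w ∈ ball (0 : ℂ) 1 := by simpa using hw
    have hζ' : conj ζ ∈ ball (0 : ℂ) 1 := by simpa using hζ
    simpa using norm_mul_conj_lt_one hw' hζ'
  have hφℂ : Integrable (fun ζ => (φ ζ : ℂ)) (diskMeasure t) := hφ.ofReal
  have hint : Integrable (fun ζ => φ ζ * symbol c (conj w * ζ)) (diskMeasure t) := by
    simpa [hconj] using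
      (Complex.conjCLE : ℂ →L[ℝ] ℂ).integrable_comp (integrable_symbol_mul hc hφℂ hw)
  have hmean := integral_diskMeasure_radial_mul hφℂ
    (fun ζ => congrArg _ (hrad ζ)) hdiff hint
  simp only [hconj]
  rw [integral_conj, hmean, integral_complex_ofReal]
  simp [symbol, mul_comm]

theorem integral_indicator_norm_rpow (t e : ℝ) (δ : ℝ) :
    ∫ ζ, {ζ : ℂ | δ < ‖ζ‖}.indicator (fun ζ => ‖ζ‖ ^ e) ζ ∂(diskMeasure t)
      = (annulusMoment t e δ).toReal := by
  rw [integral_indicator (measurableSet_lt_norm δ), annulusMoment,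
    integral_eq_lintegral_of_nonneg_ae (.of_forall fun ζ => by positivity)
      (measurable_norm.pow_const e).aestronglyMeasurable]

theorem diskKernel_mul_cutoffPower (c : ℝ) (m : ℤ) (τ : ℝ) {δ : ℝ} (hδ : 0 < δ) (w ζ : ℂ) :
    diskKernel c m w ζ * cutoffPower m τ δ ζ
      = (π : ℂ)⁻¹ * w ^ m * (symbol c (w * conj ζ) *
        ({ζ : ℂ | δ < ‖ζ‖}.indicator (fun ζ => ‖ζ‖ ^ (2 * m + τ)) ζ : ℝ)) := by
  by_cases hζ : ζ ∈ {ζ : ℂ | δ < ‖ζ‖}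
  · have hζ0 : 0 < ‖ζ‖ := hδ.trans hζ
    have hnorm : conj ζ ^ m * ζ ^ m = (‖ζ‖ ^ (2 * m : ℝ) : ℝ) := by
      rw [← mul_zpow, Complex.conj_mul', Real.rpow_mul hζ0.le, Real.rpow_intCast, Real.rpow_two]
      push_cast
      rfl
    rw [cutoffPower, indicator_of_mem hζ, indicator_of_mem hζ, Real.rpow_add hζ0, diskKernel,
      mul_zpow, Complex.ofReal_mul, ← hnorm]
    ring
  · simp [cutoffPower, indicator_of_notMem hζ]

theorem diskOperator_cutoffPower {c : ℝ} (hc : c ∈ Icc (0 : ℝ) 1) (m : ℤ) (τ t : ℝ) {δ : ℝ}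
    (hδ : 0 < δ) {w : ℂ} (hw : w ∈ ball (0 : ℂ) 1) :
    diskOperator c m t (cutoffPower m τ δ) w
      = (c / π * (annulusMoment t (2 * m + τ) δ).toReal : ℝ) * w ^ m := by
  have hint : Integrable ({ζ : ℂ | δ < ‖ζ‖}.indicator fun ζ => ‖ζ‖ ^ (2 * m + τ))
      (diskMeasure t) := by
    rw [integrable_indicator_iff (measurableSet_lt_norm δ)]
    refine ⟨(measurable_norm.pow_const _).aestronglyMeasurable,
      (lintegral_congr fun ζ => ?_).trans_lt (annulusMoment_ne_top t (2 * m + τ) hδ).lt_top⟩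
    rw [Real.enorm_of_nonneg (by positivity)]
  have hrad (ζ : ℂ) : {ζ : ℂ | δ < ‖ζ‖}.indicator (fun ζ => ‖ζ‖ ^ (2 * m + τ)) ζ
      = {ζ : ℂ | δ < ‖ζ‖}.indicator (fun ζ => ‖ζ‖ ^ (2 * m + τ)) (‖ζ‖ : ℂ) := by
    simp [indicator]
  simp only [diskOperator, diskKernel_mul_cutoffPower c m τ hδ]
  rw [integral_const_mul, integral_symbol_mul_radial hc hint hrad hw, integral_indicator_norm_rpow]
  push_cast
  ring

theorem eLpNorm_diskOperator_cutoffPower {c : ℝ} (hc : c ∈ Icc (0 : ℝ) 1) (m : ℤ) (τ t : ℝ)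
    {δ : ℝ} (hδ : 0 < δ) (p : ℝ≥0∞) :
    eLpNorm (diskOperator c m t (cutoffPower m τ δ)) p (diskMeasure t)
      = ENNReal.ofReal (c / π) * annulusMoment t (2 * m + τ) δ
        * eLpNorm (fun ζ : ℂ => ζ ^ m) p (diskMeasure t) := by
  have hae : diskOperator c m t (cutoffPower m τ δ) =ᵐ[diskMeasure t]
      ((c / π * (annulusMoment t (2 * m + τ) δ).toReal : ℝ) : ℂ) • fun w : ℂ => w ^ m := by
    filter_upwards [ae_diskMeasure_mem t] with w hw
    rw [diskOperator_cutoffPower hc m τ t hδ hw.1, Pi.smul_apply, smul_eq_mul]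
  have hnonneg : 0 ≤ c / π := div_nonneg hc.1 Real.pi_pos.le
  rw [eLpNorm_congr_ae hae, eLpNorm_const_smul, ← ofReal_norm,
    Complex.norm_of_nonneg (by positivity), ENNReal.ofReal_mul hnonneg,
    ENNReal.ofReal_toReal (annulusMoment_ne_top t _ hδ)]

theorem le_div_rpow_of_mul_le_mul_rpow {p q : ℝ} (hpq : p.HolderConjugate q) {a b C : ℝ≥0∞}
    (ha : a ≠ ∞) (hb : b ≠ 0) (hC : C ≠ ∞) (h : a * b ≤ C * a ^ (1 / p)) : a ≤ (C / b) ^ q := by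
  rcases eq_or_ne a 0 with rfl | ha0
  · exact zero_le
  have hsplit : a = a ^ (1 / q) * a ^ (1 / p) := by
    rw [← ENNReal.rpow_add _ _ ha0 ha, one_div, one_div, add_comm, hpq.inv_add_inv_eq_one,
      ENNReal.rpow_one]
  have hle : a ^ (1 / q) ≤ C / b := by
    rw [ENNReal.le_div_iff_mul_le (.inl hb) (.inr hC), ← ENNReal.mul_le_mul_iff_left
      (ENNReal.rpow_pos (pos_iff_ne_zero.2 ha0) ha).ne'
      (ENNReal.rpow_ne_top_of_nonneg (one_div_nonneg.2 hpq.nonneg) ha), mul_right_comm, ← hsplit]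
    exact h
  rwa [one_div, ENNReal.rpow_inv_le_iff hpq.symm.pos] at hle

section Necessity

variable {c : ℝ} {m : ℤ} {s' : ℝ} {p : ℝ}

theorem annulusMoment_mul_le_of_bounded (hc : c ∈ Ioc (0 : ℝ) 1)
    (hs : s' + 2 = 2 * c - 2 - 2 * m) (hp : 0 < p)
    (hB : BergmanProjectionLpBounded hartogsTriangle (hartogsWeight s') p) :
    ∃ C : ℝ≥0, ∀ τ δ : ℝ, 0 < δ → annulusMoment (s' + 2) (2 * m + τ) δ *
        (ENNReal.ofReal (c / π) *
          eLpNorm (fun ζ : ℂ => ζ ^ m) (ENNReal.ofReal p) (diskMeasure (s' + 2)))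
      ≤ C * annulusMoment (s' + 2) ((m + τ) * p) δ ^ (1 / p) := by
  obtain ⟨C, hC⟩ := eLpNorm_diskOperator_mul_le_of_bounded hc hs hp hB
  refine ⟨C, fun τ δ hδ => ?_⟩
  have : IsFiniteMeasure (diskMeasure 0) := isFiniteMeasure_diskMeasure (by norm_num)
  have hone : diskOperator 1 0 0 (fun _ => 1) =ᵐ[diskMeasure 0] fun _ => (1 : ℂ) := by
    filter_upwards [ae_diskMeasure_mem 0] with w hw
    exact integral_diskKernel_one_zero_mul (differentiableOn_const 1) (integrable_const 1) hw.1
  have hle := hC (fun _ => 1) (cutoffPower m τ δ) (memLp_const 1)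
    (by simpa using memLp_cutoffPower m τ (s' + 2) hδ two_pos) (memLp_const 1)
    (memLp_cutoffPower m τ (s' + 2) hδ hp)
  have hnorm_ne_zero : eLpNorm (fun _ : ℂ => (1 : ℂ)) (ENNReal.ofReal p) (diskMeasure 0) ≠ 0 :=
    eLpNorm_diskMeasure_ne_zero measurable_const (fun _ _ => one_ne_zero) (by simpa using hp)
  rw [eLpNorm_congr_ae hone, eLpNorm_diskOperator_cutoffPower (Ioc_subset_Icc_self hc) m τ _ hδ,
    eLpNorm_cutoffPower m τ _ hδ hp, mul_left_comm (C : ℝ≥0∞),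
    ENNReal.mul_le_mul_iff_right hnorm_ne_zero (memLp_const (1 : ℂ)).2.ne] at hle
  rwa [← mul_assoc, mul_comm (annulusMoment _ _ _)]

theorem integrability_of_bounded (hc : c ∈ Ioc (0 : ℝ) 1)
    (hs : s' + 2 = 2 * c - 2 - 2 * m) (hp : 0 < p)
    (hB : BergmanProjectionLpBounded hartogsTriangle (hartogsWeight s') p) :
    0 < m * p + (2 * c - 2 * m) := by
  obtain ⟨C, hC⟩ := annulusMoment_mul_le_of_bounded hc hs hp hB
  have hκ : ENNReal.ofReal (c / π) ≠ 0 := by simpa using div_pos hc.1 Real.pi_pos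
  have hmoment := annulusMoment_pos (s' + 2) (2 * m + 0) (δ := 1 / 2) ⟨by norm_num, by norm_num⟩
  have hfinite : (C : ℝ≥0∞) * annulusMoment (s' + 2) ((m + 0) * p) (1 / 2) ^ (1 / p) ≠ ∞ :=
    ENNReal.mul_ne_top ENNReal.coe_ne_top (ENNReal.rpow_ne_top_of_nonneg (by positivity)
      (annulusMoment_ne_top _ _ (by norm_num)))
  have hnorm : eLpNorm (fun ζ : ℂ => ζ ^ m) (ENNReal.ofReal p) (diskMeasure (s' + 2)) < ∞ :=
    ENNReal.lt_top_of_mul_ne_top_right (ENNReal.lt_top_of_mul_ne_top_right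
      (ne_top_of_le_ne_top hfinite (hC 0 (1 / 2) (by norm_num))) hmoment.ne').ne hκ
  have hexp := (memLp_zpow_iff hp).1 ⟨(measurable_id.pow_const m).aestronglyMeasurable, hnorm⟩
  linarith

theorem dual_integrability_of_bounded {q : ℝ} (hc : c ∈ Ioc (0 : ℝ) 1)
    (hs : s' + 2 = 2 * c - 2 - 2 * m) (hpq : p.HolderConjugate q)
    (hB : BergmanProjectionLpBounded hartogsTriangle (hartogsWeight s') p) :
    0 < m * q + (2 * c - 2 * m) := by
  obtain ⟨C, hC⟩ := annulusMoment_mul_le_of_bounded hc hs hpq.pos hB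
  set κ := ENNReal.ofReal (c / π) * eLpNorm (fun ζ : ℂ => ζ ^ m) (ENNReal.ofReal p)
    (diskMeasure (s' + 2))
  have hκ : κ ≠ 0 := mul_ne_zero (by simpa using div_pos hc.1 Real.pi_pos)
      (eLpNorm_zpow_ne_zero m _ (by simpa using hpq.pos))
  have hbound : ∀ δ ∈ Ioo (0 : ℝ) 1, annulusMoment (s' + 2) (m * q) δ ≤ (C / κ) ^ q := by
    intro δ hδ
    refine le_div_rpow_of_mul_le_mul_rpow hpq (annulusMoment_ne_top _ _ hδ.1) hκ
      ENNReal.coe_ne_top ?_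
    -- With this exponent the test function and its image have moments of the same order.
    convert hC (m * (q - 2)) δ hδ.1 using 4
    · ring
    · linear_combination -(m : ℝ) * hpq.mul_eq_add
  have hfinite := (lintegral_norm_rpow_le_of_annulusMoment_le hbound).trans_lt
    (ENNReal.rpow_lt_top_of_nonneg hpq.symm.nonneg (ENNReal.div_ne_top ENNReal.coe_ne_top hκ))
  linarith [lintegral_norm_rpow_lt_top_iff.1 hfinite]

end Necessity

/-! ### Failure of the `L¹` bound -/

theorem diskOperator_indicator_ball {a : ℂ} {r : ℝ} (hr : 0 < r)
    (hsub : ball a r ⊆ ball (0 : ℂ) 1) {w : ℂ} (hw : w ∈ ball (0 : ℂ) 1) :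
    diskOperator 1 0 0 ((ball a r).indicator 1) w = π * r ^ 2 * diskKernel 1 0 w a := by
  have : IsFiniteMeasure (diskMeasure 0) := isFiniteMeasure_diskMeasure (by norm_num)
  have hdiff : DifferentiableOn ℂ (fun ζ => diskKernel 1 0 ζ w) (ball a r) := fun ζ hζ =>
    (differentiableAt_diskKernel 1 (hsub hζ) hw (.inr le_rfl)).differentiableWithinAt
  have hint : IntegrableOn (fun ζ => diskKernel 1 0 ζ w) (ball a r) := by
    have hkernel : Integrable (fun ζ => conj (diskKernel 1 0 w ζ)) (diskMeasure 0) :=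
      (Complex.conjCLE : ℂ →L[ℝ] ℂ).integrable_comp
        ((memLp_diskKernel_one_zero hw).integrable one_le_two)
    simp only [diskKernel_conj, diskMeasure_zero] at hkernel
    exact IntegrableOn.mono_set hkernel hsub
  calc diskOperator 1 0 0 ((ball a r).indicator 1) w
      = ∫ ζ in ball 0 1, (ball a r).indicator (diskKernel 1 0 w) ζ := by
        rw [diskOperator, diskMeasure_zero]
        refine integral_congr_ae (.of_forall fun ζ => ?_)
        simp [indicator]
    _ = ∫ ζ in ball a r, conj (diskKernel 1 0 ζ w) := by
        rw [setIntegral_indicator measurableSet_ball, inter_eq_self_of_subset_right hsub]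
        simp only [diskKernel_conj]
    _ = π * r ^ 2 * diskKernel 1 0 w a := by
        rw [integral_conj, setIntegral_ball_eq_mul hr hdiff hint, map_mul, diskKernel_conj]
        simp

theorem enorm_ofReal_pi : ‖(π : ℂ)‖ₑ = ENNReal.ofReal π := by
  rw [← ofReal_norm, Complex.norm_of_nonneg Real.pi_pos.le]

theorem eLpNorm_one_indicator_ball {a : ℂ} {r : ℝ} (hr : 0 < r) (hsub : ball a r ⊆ ball 0 1) :
    eLpNorm ((ball a r).indicator (1 : ℂ → ℂ)) 1 (diskMeasure 0) = ‖(π * r ^ 2 : ℂ)‖ₑ := by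
  rw [Pi.one_def, eLpNorm_indicator_const measurableSet_ball one_ne_zero ENNReal.one_ne_top,
    diskMeasure_zero, Measure.restrict_apply measurableSet_ball,
    inter_eq_self_of_subset_left hsub, Complex.volume_ball, enorm_mul, enorm_pow,
    enorm_ofReal_pi, ← NNReal.coe_real_pi, ENNReal.ofReal_coe_nnreal,
    ← ofReal_norm (r : ℂ), Complex.norm_of_nonneg hr.le]
  simp [mul_comm]

theorem eLpNorm_one_diskOperator_indicator_ball {a : ℂ} {r : ℝ} (hr : 0 < r)
    (hsub : ball a r ⊆ ball (0 : ℂ) 1) :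
    eLpNorm (diskOperator 1 0 0 ((ball a r).indicator 1)) 1 (diskMeasure 0)
      = eLpNorm ((ball a r).indicator (1 : ℂ → ℂ)) 1 (diskMeasure 0) *
        eLpNorm (fun w => diskKernel 1 0 w a) 1 (diskMeasure 0) := by
  have hae : diskOperator 1 0 0 ((ball a r).indicator 1) =ᵐ[diskMeasure 0]
      (π * r ^ 2 : ℂ) • fun w => diskKernel 1 0 w a := by
    filter_upwards [ae_diskMeasure_mem 0] with w hw
    rw [diskOperator_indicator_ball hr hsub hw.1, Pi.smul_apply, smul_eq_mul]
  rw [eLpNorm_congr_ae hae, eLpNorm_const_smul, eLpNorm_one_indicator_ball hr hsub]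

theorem integral_two_mul_sq_mul_div_one_sub {a : ℝ} (ha : a ^ 2 < 1) :
    ∫ r in (0 : ℝ)..1, 2 * a ^ 2 * r / (1 - a ^ 2 * r ^ 2) = -Real.log (1 - a ^ 2) := by
  have hpos : ∀ r ∈ uIcc (0 : ℝ) 1, 1 - a ^ 2 * r ^ 2 ≠ 0 := fun r hr => by
    rw [uIcc_of_le zero_le_one] at hr
    have hr₂ : r ^ 2 ≤ 1 := pow_le_one₀ hr.1 hr.2
    nlinarith [sq_nonneg a]
  have hderiv : ∀ r ∈ uIcc (0 : ℝ) 1, HasDerivAt (fun r => -Real.log (1 - a ^ 2 * r ^ 2))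
      (2 * a ^ 2 * r / (1 - a ^ 2 * r ^ 2)) r := fun r hr => by
    have hinner : HasDerivAt (fun r : ℝ => 1 - a ^ 2 * r ^ 2) (-(a ^ 2 * (2 * r))) r := by
      simpa using (((hasDerivAt_id r).fun_pow 2).const_mul (a ^ 2)).const_sub 1
    exact (hinner.log (hpos r hr)).fun_neg.congr_deriv (by ring)
  rw [intervalIntegral.integral_eq_sub_of_hasDerivAt hderiv
    (ContinuousOn.intervalIntegrable (.div (by fun_prop) (by fun_prop) hpos))]
  simp

theorem eLpNorm_one_diskKernel {a : ℝ} (ha : a ∈ Ioo (0 : ℝ) 1) :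
    eLpNorm (fun w => diskKernel 1 0 w a) 1 (diskMeasure 0)
      = ∫⁻ r in Ioo (0 : ℝ) 1, ENNReal.ofReal (2 * r / (1 - a ^ 2 * r ^ 2)) := by
  have hnorm : ‖(a : ℂ)‖ = a := Complex.norm_of_nonneg ha.1.le
  have hkernel : ∀ w ∈ ball (0 : ℂ) 1, ‖diskKernel 1 0 w a‖ₑ
      = ENNReal.ofReal π⁻¹ * ‖1 - (a : ℂ) * conj w‖ₑ⁻¹ ^ 2 := fun w hw => by
    have ha' : (a : ℂ) ∈ ball (0 : ℂ) 1 := by simpa [abs_of_pos ha.1] using ha.2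
    have hne := one_sub_ne_zero_of_norm_lt_one (norm_mul_conj_lt_one ha' hw)
    rw [← diskKernel_conj, RCLike.enorm_conj, ENNReal.ofReal_inv_of_pos Real.pi_pos]
    simp [diskKernel, symbol, enorm_inv, hne, ENNReal.inv_pow, enorm_ofReal_pi]
  have hae : (fun w => ‖diskKernel 1 0 w a‖ₑ) =ᵐ[diskMeasure 0]
      fun w => ENNReal.ofReal π⁻¹ * ‖1 - (a : ℂ) * conj w‖ₑ⁻¹ ^ 2 :=
    (ae_diskMeasure_mem 0).mono fun w hw => hkernel w hw.1
  rw [eLpNorm_one_eq_lintegral_enorm, lintegral_congr_ae hae,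
    lintegral_diskMeasure_radial_mul_enorm_one_sub 0 (φ := fun _ => ENNReal.ofReal π⁻¹)
      measurable_const (hnorm.trans_le ha.2.le), lintegral_radialMeasure, hnorm]
  refine setLIntegral_congr_fun measurableSet_Ioo fun r hr => ?_
  rw [← ENNReal.ofReal_mul (by positivity), ← ENNReal.ofReal_mul (by simpa using hr.1.le), zero_add,
    Real.rpow_one]
  congr 1
  field_simp

theorem neg_log_le_eLpNorm_one_diskKernel {a : ℝ} (ha : a ∈ Ioo (0 : ℝ) 1) :
    ENNReal.ofReal (-Real.log (1 - a ^ 2)) ≤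
      eLpNorm (fun w => diskKernel 1 0 w a) 1 (diskMeasure 0) := by
  have ha₂ : a ^ 2 < 1 := by nlinarith [ha.1, ha.2]
  have hpos : ∀ r ∈ Ioo (0 : ℝ) 1, 0 < 1 - a ^ 2 * r ^ 2 := fun r hr => by
    nlinarith [hr.1, hr.2, sq_nonneg a]
  rw [eLpNorm_one_diskKernel ha, ← integral_two_mul_sq_mul_div_one_sub ha₂,
    intervalIntegral.integral_of_le zero_le_one, integral_Ioc_eq_integral_Ioo]
  refine (Real.ofReal_le_enorm _).trans ((enorm_integral_le_lintegral_enorm _).trans ?_)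
  refine setLIntegral_mono' measurableSet_Ioo fun r hr => ?_
  have hr₀ := hr.1
  have hden := hpos r hr
  rw [Real.enorm_of_nonneg (by positivity)]
  refine ENNReal.ofReal_le_ofReal (div_le_div_of_nonneg_right ?_ hden.le)
  nlinarith

theorem eLpNorm_one_diskKernel_le_of_bounded {c : ℝ} (hc : c ∈ Ioc (0 : ℝ) 1) {m : ℤ} {s' : ℝ}
    (hs : s' + 2 = 2 * c - 2 - 2 * m)
    (hB : BergmanProjectionLpBounded hartogsTriangle (hartogsWeight s') 1) :
    ∃ M : ℝ≥0∞, M ≠ ∞ ∧ ∀ a ∈ Ioo (0 : ℝ) 1,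
      eLpNorm (fun w => diskKernel 1 0 w a) 1 (diskMeasure 0) ≤ M := by
  obtain ⟨C, hC⟩ := eLpNorm_diskOperator_mul_le_of_bounded hc hs one_pos hB
  simp only [ENNReal.ofReal_one] at hC
  have : IsFiniteMeasure (diskMeasure 0) := isFiniteMeasure_diskMeasure (by norm_num)
  let G := cutoffPower m 0 (1 / 2)
  have hG : MemLp G 1 (diskMeasure (s' + 2)) := by
    simpa only [ENNReal.ofReal_one] using memLp_cutoffPower m 0 (s' + 2) one_half_pos one_pos
  have hG₂ : MemLp G 2 (diskMeasure (s' + 2)) := by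
    simpa only [ENNReal.ofReal_ofNat] using memLp_cutoffPower m 0 (s' + 2) one_half_pos two_pos
  have hTG : eLpNorm (diskOperator c m (s' + 2) G) 1 (diskMeasure (s' + 2)) ≠ 0 := by
    rw [eLpNorm_diskOperator_cutoffPower (Ioc_subset_Icc_self hc) m 0 _ one_half_pos]
    exact mul_ne_zero (mul_ne_zero (by simpa using div_pos hc.1 Real.pi_pos)
      (annulusMoment_pos _ _ ⟨by norm_num, by norm_num⟩).ne') (eLpNorm_zpow_ne_zero m _ one_ne_zero)
  have hCG := ENNReal.mul_ne_top (ENNReal.coe_ne_top (r := C)) hG.2.ne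
  refine ⟨_, ENNReal.div_ne_top hCG hTG, fun a ha => ?_⟩
  have hr : 0 < 1 - a := sub_pos.2 ha.2
  have hsub : ball (a : ℂ) (1 - a) ⊆ ball 0 1 :=
    ball_subset_ball' (by simp [abs_of_pos ha.1])
  let F : ℂ → ℂ := (ball (a : ℂ) (1 - a)).indicator 1
  have hF (p : ℝ≥0∞) : MemLp F p (diskMeasure 0) := (memLp_const 1).indicator measurableSet_ball
  have hF₀ : eLpNorm F 1 (diskMeasure 0) ≠ 0 := by
    rw [eLpNorm_one_indicator_ball hr hsub, enorm_ne_zero]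
    exact mul_ne_zero (by simp) (pow_ne_zero 2 (by exact_mod_cast hr.ne'))
  have hle := hC F G (hF 2) hG₂ (hF 1) hG
  rw [eLpNorm_one_diskOperator_indicator_ball hr hsub, mul_assoc, mul_left_comm (C : ℝ≥0∞),
    ENNReal.mul_le_mul_iff_right hF₀ (hF 1).2.ne] at hle
  exact (ENNReal.le_div_iff_mul_le (.inl hTG) (.inr hCG)).2 hle

theorem not_bergmanProjectionLpBounded_one {c : ℝ} (hc : c ∈ Ioc (0 : ℝ) 1) {m : ℤ} {s' : ℝ}
    (hs : s' + 2 = 2 * c - 2 - 2 * m) :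
    ¬ BergmanProjectionLpBounded hartogsTriangle (hartogsWeight s') 1 := by
  intro hB
  obtain ⟨M, hM, hle⟩ := eLpNorm_one_diskKernel_le_of_bounded hc hs hB
  -- The radius at which `-log (1 - a ^ 2)` exceeds `M`.
  let x := Real.exp (-(M.toReal + 1))
  have hx : x ∈ Ioo (0 : ℝ) 1 :=
    ⟨Real.exp_pos _, Real.exp_lt_one_iff.2 (by linarith [ENNReal.toReal_nonneg (a := M)])⟩
  have ha : √(1 - x) ∈ Ioo (0 : ℝ) 1 :=
    ⟨Real.sqrt_pos.2 (by linarith [hx.2]), (Real.sqrt_lt' one_pos).2 (by linarith [hx.1])⟩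
  have hlog := (neg_log_le_eLpNorm_one_diskKernel ha).trans (hle _ ha)
  rw [Real.sq_sqrt (by linarith [hx.2]), sub_sub_cancel, Real.log_exp, neg_neg,
    ENNReal.ofReal_le_iff_le_toReal hM] at hlog
  linarith

/-! ### The range of exponents -/

theorem bergmanProjectionLpBounded_iff_of_holderConjugate {c : ℝ} (hc : c ∈ Ioc (0 : ℝ) 1) {m : ℤ}
    {s' : ℝ} (hs : s' + 2 = 2 * c - 2 - 2 * m) {p q : ℝ} (hpq : p.HolderConjugate q) :
    BergmanProjectionLpBounded hartogsTriangle (hartogsWeight s') p ↔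
      0 < m * p + (2 * c - 2 * m) ∧ 0 < m * q + (2 * c - 2 * m) :=
  ⟨fun hB =>
      ⟨integrability_of_bounded hc hs hpq.pos hB, dual_integrability_of_bounded hc hs hpq hB⟩,
    fun h => bergmanProjectionLpBounded_of_lt hc hs hpq h.1 h.2⟩

/-- The exponents `p > 1` for which `ζ ^ (-k - 2)` belongs to both `L^p` and `L^q`, where
`1/p + 1/q = 1`, of the disk with measure `|ζ|^(s + 2k + 2) dV`. The condition on `q` is multiplied
by `p - 1`, which makes it linear in `p`. -/
def IsAdmissibleExponent (s : ℝ) (k : ℤ) (p : ℝ) : Prop :=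
  1 < p ∧ p * (k + 2) < s + 2 * k + 4 ∧ s + 2 * k + 4 < p * (s + k + 2)

theorem bergmanProjectionLpBounded_iff_isAdmissibleExponent {s : ℝ} (hs : s ∈ Ioc (0 : ℝ) 2) (k : ℤ)
    {p : ℝ} (hp : 1 ≤ p) :
    BergmanProjectionLpBounded hartogsTriangle (hartogsWeight (s + 2 * k)) p ↔
      IsAdmissibleExponent s k p := by
  have hc : s / 2 ∈ Ioc (0 : ℝ) 1 := ⟨by linarith [hs.1], by linarith [hs.2]⟩
  have hm : s + 2 * k + 2 = 2 * (s / 2) - 2 - 2 * ((-k - 2 : ℤ) : ℝ) := by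
    push_cast
    ring
  rcases hp.eq_or_lt with rfl | hp₁
  · exact iff_of_false (not_bergmanProjectionLpBounded_one hc hm) fun h => lt_irrefl _ h.1
  · have hq := Real.HolderConjugate.conjExponent hp₁
    have hp₀ : 0 < p - 1 := sub_pos.2 hp₁
    rw [bergmanProjectionLpBounded_iff_of_holderConjugate hc hm hq, IsAdmissibleExponent,
      and_iff_right hp₁, Real.conjExponent]
    have hdual : ((-k - 2 : ℤ) : ℝ) * (p / (p - 1)) + (2 * (s / 2) - 2 * ((-k - 2 : ℤ) : ℝ))
        = (p * (s + k + 2) - (s + 2 * k + 4)) / (p - 1) := by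
      push_cast
      field_simp
      ring
    rw [hdual, div_pos_iff_of_pos_right hp₀, sub_pos]
    refine and_congr_left' ?_
    push_cast
    constructor <;> intro h <;> linarith

theorem isAdmissibleExponent_iff_mem_Ioo_of_neg_two_lt {s : ℝ} (hs : s ∈ Ioc (0 : ℝ) 2) {k : ℤ}
    (hk : -2 < s + 2 * k) {p : ℝ} : IsAdmissibleExponent s k p ↔
      p ∈ Ioo ((s + 2 * k + 4) / (s + k + 2)) ((s + 2 * k + 4) / (k + 2)) := by
  obtain ⟨hs₀, hs₂⟩ := hs
  have hk_lt : -2 < k := by exact_mod_cast (by linarith : (-2 : ℝ) < k)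
  have hk_le : (-1 : ℝ) ≤ k := by exact_mod_cast Int.add_one_le_of_lt hk_lt
  rw [mem_Ioo, div_lt_iff₀ (by linarith), lt_div_iff₀ (by linarith)]
  exact ⟨fun h => ⟨h.2.2, h.2.1⟩, fun h => ⟨by nlinarith, h.2, h.1⟩⟩

theorem isAdmissibleExponent_neg_two_iff_one_lt {s : ℝ} (hs : 0 < s) {p : ℝ} :
    IsAdmissibleExponent s (-2) p ↔ 1 < p := by
  refine ⟨fun h => h.1, fun hp => ⟨hp, ?_⟩⟩
  push_cast
  constructor <;> nlinarith

theorem isAdmissibleExponent_neg_three_iff {s p : ℝ} :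
    IsAdmissibleExponent s (-3) p ↔ 1 < p ∧ 2 - s < p ∧ p * (1 - s) < 2 - s := by
  unfold IsAdmissibleExponent
  push_cast
  refine and_congr_right' (and_congr ?_ ?_) <;> constructor <;> intro h <;> linarith

theorem isAdmissibleExponent_iff_one_lt_of_mem_Icc {s : ℝ} (hs : s ∈ Ioc (0 : ℝ) 2) {k : ℤ}
    (hk : s + 2 * k ∈ Icc (-5 : ℝ) (-2)) {p : ℝ} : IsAdmissibleExponent s k p ↔ 1 < p := by
  have hk₁ : k < -1 := by exact_mod_cast (by linarith [hs.1, hk.2] : (k : ℝ) < -1)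
  have hk₂ : -4 < k := by exact_mod_cast (by linarith [hs.2, hk.1] : (-4 : ℝ) < k)
  obtain rfl | rfl : k = -2 ∨ k = -3 := by omega
  · exact isAdmissibleExponent_neg_two_iff_one_lt hs.1
  · have hs₁ : 1 ≤ s := by
      have := hk.1
      push_cast at this
      linarith
    rw [isAdmissibleExponent_neg_three_iff]
    exact ⟨fun h => h.1, fun hp => ⟨hp, by linarith, by nlinarith⟩⟩

theorem eq_neg_three_of_mem_Ioo {s : ℝ} (hs : s ∈ Ioc (0 : ℝ) 2) {k : ℤ}
    (hk : s + 2 * k ∈ Ioo (-6 : ℝ) (-5)) : k = -3 ∧ s ∈ Ioo (0 : ℝ) 1 := by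
  have hk₁ : k < -2 := by exact_mod_cast (by linarith [hs.1, hk.2] : (k : ℝ) < -2)
  have hk₂ : -4 < k := by exact_mod_cast (by linarith [hs.2, hk.1] : (-4 : ℝ) < k)
  obtain rfl : k = -3 := by omega
  have := hk.2
  push_cast at this
  exact ⟨rfl, hs.1, by linarith⟩

theorem isAdmissibleExponent_neg_three_iff_mem_Ioo {s : ℝ} (hs : s < 1) {p : ℝ} :
    IsAdmissibleExponent s (-3) p ↔ p ∈ Ioo (2 - s) ((2 - s) / (1 - s)) := by
  rw [isAdmissibleExponent_neg_three_iff, mem_Ioo, lt_div_iff₀ (sub_pos.2 hs)]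
  exact and_iff_right_of_imp fun h => by linarith [h.1]

theorem isAdmissibleExponent_iff_one_lt_of_eq_neg_six {s : ℝ} (hs : s ∈ Ioc (0 : ℝ) 2) {k : ℤ}
    (hk : s + 2 * k = -6) {p : ℝ} : IsAdmissibleExponent s k p ↔ 1 < p := by
  obtain ⟨hs₀, hs₂⟩ := hs
  have hk₁ : k < -3 := by exact_mod_cast (by linarith : (k : ℝ) < -3)
  have hk₂ : -5 < k := by exact_mod_cast (by linarith : (-5 : ℝ) < k)
  obtain rfl : k = -4 := by omega
  push_cast at hk
  obtain rfl : s = 2 := by linarith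
  refine ⟨fun h => h.1, fun hp => ⟨hp, ?_⟩⟩
  push_cast
  constructor <;> linarith

theorem isAdmissibleExponent_iff_mem_Ioo_of_lt_neg_six {s : ℝ} (hs : s ∈ Ioc (0 : ℝ) 2) {k : ℤ}
    (hk : s + 2 * k < -6) {p : ℝ} : IsAdmissibleExponent s k p ↔
      p ∈ Ioo ((s + 2 * k + 4) / (k + 2)) ((s + 2 * k + 4) / (s + k + 2)) := by
  obtain ⟨hs₀, hs₂⟩ := hs
  have hk_lt : k < -3 := by exact_mod_cast (by linarith : (k : ℝ) < -3)
  have hk_le : (k : ℝ) ≤ -4 := by exact_mod_cast Int.le_sub_one_of_lt hk_lt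
  rw [mem_Ioo, div_lt_iff_of_neg (by linarith [hk_le]), lt_div_iff_of_neg (by linarith)]
  exact ⟨fun h => h.2, fun h => ⟨by nlinarith [h.1], h⟩⟩

theorem existsUnique_eq_add_two_mul (s' : ℝ) :
    ∃! sk : ℝ × ℤ, sk.1 ∈ Ioc (0 : ℝ) 2 ∧ s' = sk.1 + 2 * (sk.2 : ℝ) := by
  obtain ⟨j, hj, huniq⟩ := existsUnique_add_zsmul_mem_Ioc (two_pos : (0 : ℝ) < 2) s' 0
  refine ⟨(s' + j • (2 : ℝ), -j), ⟨by simpa using hj, by simp [mul_comm]⟩, ?_⟩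
  rintro ⟨s, k⟩ ⟨hs, rfl⟩
  have hk : -k = j := huniq (-k) (by simpa [mul_comm] using hs)
  simp [← hk, mul_comm]

end HartogsBergman

theorem theorem1p1 (s' : ℝ) :
    (∃! sk : ℝ × ℤ, sk.1 ∈ Set.Ioc (0 : ℝ) 2 ∧ s' = sk.1 + 2 * (sk.2 : ℝ)) ∧
    ∀ (s : ℝ) (k : ℤ), s ∈ Set.Ioc (0 : ℝ) 2 → s' = s + 2 * (k : ℝ) →
      (s' ∈ Set.Ioi (-2 : ℝ) → ∀ p : ℝ, 1 ≤ p →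
        (HartogsBergman.BergmanProjectionLpBounded HartogsBergman.hartogsTriangle
            (HartogsBergman.hartogsWeight s') p ↔
          p ∈ Set.Ioo ((s + 2 * k + 4) / (s + k + 2)) ((s + 2 * k + 4) / (k + 2)))) ∧
      (s' ∈ Set.Icc (-5 : ℝ) (-2) → ∀ p : ℝ, 1 ≤ p →
        (HartogsBergman.BergmanProjectionLpBounded HartogsBergman.hartogsTriangle
            (HartogsBergman.hartogsWeight s') p ↔
          p ∈ Set.Ioi (1 : ℝ))) ∧
      (s' ∈ Set.Ioo (-6 : ℝ) (-5) → k = -3 ∧ s ∈ Set.Ioo (0 : ℝ) 1 ∧ ∀ p : ℝ, 1 ≤ p →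
        (HartogsBergman.BergmanProjectionLpBounded HartogsBergman.hartogsTriangle
            (HartogsBergman.hartogsWeight s') p ↔
          p ∈ Set.Ioo (2 - s) ((2 - s) / (1 - s)))) ∧
      (s' = -6 → ∀ p : ℝ, 1 ≤ p →
        (HartogsBergman.BergmanProjectionLpBounded HartogsBergman.hartogsTriangle
            (HartogsBergman.hartogsWeight s') p ↔
          p ∈ Set.Ioi (1 : ℝ))) ∧
      (s' ∈ Set.Iio (-6 : ℝ) → ∀ p : ℝ, 1 ≤ p →
        (HartogsBergman.BergmanProjectionLpBounded HartogsBergman.hartogsTriangle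
            (HartogsBergman.hartogsWeight s') p ↔
          p ∈ Set.Ioo ((s + 2 * k + 4) / (k + 2)) ((s + 2 * k + 4) / (s + k + 2)))) := by
  refine ⟨HartogsBergman.existsUnique_eq_add_two_mul s', ?_⟩
  rintro s k hs rfl
  have hbounded {p : ℝ} (hp : 1 ≤ p) :=
    HartogsBergman.bergmanProjectionLpBounded_iff_isAdmissibleExponent hs k hp
  refine ⟨fun h p hp => (hbounded hp).trans ?_, fun h p hp => (hbounded hp).trans ?_, fun h => ?_,
    fun h p hp => (hbounded hp).trans ?_, fun h p hp => (hbounded hp).trans ?_⟩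
  · exact HartogsBergman.isAdmissibleExponent_iff_mem_Ioo_of_neg_two_lt hs h
  · exact HartogsBergman.isAdmissibleExponent_iff_one_lt_of_mem_Icc hs h
  · obtain ⟨rfl, hs₁⟩ := HartogsBergman.eq_neg_three_of_mem_Ioo hs h
    exact ⟨rfl, hs₁, fun p hp => (hbounded hp).trans
      (HartogsBergman.isAdmissibleExponent_neg_three_iff_mem_Ioo hs₁.2)⟩
  · exact HartogsBergman.isAdmissibleExponent_iff_one_lt_of_eq_neg_six hs h
  · exact HartogsBergman.isAdmissibleExponent_iff_mem_Ioo_of_lt_neg_six hs h
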